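/- **Programs.** Fix typed global variables $\mathcal G$ and typed local variables $\mathcal X$, each with an initial value, a set of mutexes $\mathcal M$, and a finite set of thread templates, one of which is $\mathsf{main}$. A *program in $\mathsf{Lang}$* gives each template a finite control-flow graph. The node sets of the graphs are disjoint, there is at most one edge $(u,a,v)$ for given nodes $u,v$, and each graph has a start node without incoming edges. Edges are labelled by one of the actions $\mathtt{lock}(m)$, $\mathtt{unlock}(m)$, $\mathtt{create}(T)$ ($T$ a template), $l:=f(l)$, $l:=f(l,g)$ (read of the global $g$), $g:=f(l)$ (write of $g$), $\mathtt{assert}(p(l))$, $\mathtt{Pos}(c(l))$, $\mathtt{Neg}(c(l))$. Here $l$ is the local state of the executing thread, which contains, besides the values of $\mathcal X$, the thread id $\mathtt{self}$; this is set only when the thread is created. In $\mathsf{Lang}_{\mathit{Atomic}}$ edges may also be labelled by atomic blocks $\mathtt{atomic}\{a_1;\dots;a_n\}$, where $a_1$ is any of the above actions and $a_2,\dots,a_n$ are local updates, reads, writes or assertions. **Interleaving semantics.** The initial thread has the empty sequence as its id, and the $n$-th thread (counting from $0$) created by $t$ has the id $t\cdot n$. A state $(L,M,G)$ consists of a partial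 map $L$ from thread ids to pairs (node, local state), a partial map $M$ from mutexes to the threads holding them, and a valuation $G$ of the globals. Initially only the initial thread exists, at the start node of $\mathsf{main}$, no mutex is held, and all variables have their initial values. An *interleaving* is a finite sequence of steps from the initial state. In each step a thread $t$ at node $u$ takes an edge $(u,a,v)$ whose (first) action is admissible: $\mathtt{lock}(m)$ requires that nobody holds $m$, $\mathtt{unlock}(m)$ that $t$ holds $m$, $\mathtt{Pos}(c)$ and $\mathtt{Neg}(c)$ that $c$ is true, respectively false, and all other actions are always admissible. Then $t$ moves to $v$ and the effect of $a$ takes place, for an atomic block the composition of the effects of $a_1,\dots,a_n$ in one step. A created thread starts at the start node of its template with a copy of the local state of its creator, except for $\mathtt{self}$. Assertions have no effect; one is violated in an interleaving if it evaluates to false when executed there (for $a_k$ in an atomic block: after $a_1,\dots,a_{k-1}$). A program is *safe w.r.t. the interleaving semantics* if no interleaving violates an assertion. **Local trace semantics** (for programs without atomic blocks in which every access to a global $g$ happens while holding a dedicated mutex $m_g$). A *global trace* consists of finitely many threads, each with a finite path of local configurations $(n,u,l)$ ($n$ steps performed so far, node $u$, local state $l$) along the edges of its control-flow graph, together with a create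 order and, for each mutex, a lock order between configurations, such that: * The initial thread starts in the initial configuration at the start node of $\mathsf{main}$. * The *causality order*, i.e. the reflexive transitive closure of the program order, the create order and the lock orders, is a partial order whose least element is the initial configuration of the initial thread. * The create order leads from a configuration at which a $\mathtt{create}(T)$ edge starts to the first configuration of the created thread, whose id is that of the creator followed by the number of threads the creator has created before, and which starts at the start node of $T$ with a copy of the local state of the creator except for $\mathtt{self}$. The create step is either taken in the trace, or it is missing and its thread takes no further step. Each thread except the initial one is created by exactly one create action, and each create action creates at most one thread. * The lock order of $m$ leads from the configuration after an $\mathtt{unlock}(m)$, or from the initial configuration, to the configuration after a $\mathtt{lock}(m)$. Each lock of $m$ has exactly one predecessor in it, and each $\mathtt{unlock}(m)$ and the initial configuration have at most one successor. Thus each lock is preceded by exactly one unlock or is the first lock of $m$, and each unlock is followed by at most one lock. A thread performs $\mathtt{unlock}(m)$ only if it has locked $m$ and not unlocked it since. * Local states evolve according to the actions, guards are passed only if satisfied, and a read of $g$ yields the value of the last write to $g$ that precedes it in the causality order, or the initial value of $g$ if there is none. A *local trace* is a global trace with a unique maximal element. A program is *safe w.r.t. the local trace semantics* if no assertion evaluates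 to false in a local trace of it. **Ghost witnesses.** A *ghost witness* $W$ for a program $P\in\mathsf{Lang}$ consists of new (ghost) global and local variables with types and initial values, a partial map $\mathbb U$ from edges of $P$ to non-empty sequences of ghost statements, and a partial map $\mathbb I$ from nodes of $P$ to boolean expressions over program and ghost variables. Ghost statements may read all variables but modify only ghost variables: they are updates of ghost locals, reads of program or ghost globals into ghost locals, and writes of ghost globals. The *witness-instrumented program* $P^W_{\mathrm{gh}}\in\mathsf{Lang}_{\mathit{Atomic}}$ has the additional variables and replaces each edge $(u,a,v)$ as follows. Let $a'=\mathtt{atomic}\{a;a_1;\dots;a_k\}$ if $\mathbb U(u,a,v)=a_1;\dots;a_k$ is defined, and $a'=a$ otherwise. If $\mathbb I(u)$ is undefined, the edge becomes $(u,a',v)$. If $\mathbb I(u)$ is defined, it becomes the two edges $(u,b,(u,v))$ and $((u,v),a',v)$ with a new node $(u,v)$, where $b$ is an atomic block that evaluates $\mathbb I(u)$, reading the globals in it into fresh local temporaries, and asserts it. **Split.** For $P\in\mathsf{Lang}_{\mathit{Atomic}}$ and a total order on its globals, $\mathsf{split}\,P$ has, besides the mutexes of $P$, a new mutex $m_g$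 for each global $g$. It replaces each edge from $u$ to $v$, with label $a$ or $\mathtt{atomic}\{a_1;\dots;a_n\}$, by a path through new nodes from $u$ to $v$ that locks the mutexes $m_g$ of all globals $g$ accessed by the label in increasing order, performs $a$, respectively $a_1;\dots;a_n$, and unlocks these mutexes in reverse order. **Theorem.** Let $P\in\mathsf{Lang}$ and let $W$ be a ghost witness for $P$. Then $W$ is valid w.r.t. the interleaving semantics, i.e. $P^W_{\mathrm{gh}}$ is safe w.r.t. the interleaving semantics, if and only if $W$ is valid w.r.t. the local trace semantics, i.e. $\mathsf{split}\,P^W_{\mathrm{gh}}$ is safe w.r.t. the local trace semantics. This holds for every choice of the total order on the globals of $P^W_{\mathrm{gh}}$ used by $\mathsf{split}$. -/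

import Mathlib

universe u

noncomputable section

namespace GhostWitness

/-! ### Programs -/

/-- Thread ids: the initial thread is `[]`; the `n`-th thread (counting from `0`) created by `p` is
`p ++ [n]`. -/
abbrev Tid : Type := List ℕ

/-- A set of declared variables: names, a type for each name, and an initial value for each name.
Used both for global and for local variables. -/
structure Decls where
  Name : Type u
  Ty : Name → Type u
  init : ∀ x, Ty x

/-- Type-correct valuations of declared variables. -/
abbrev Decls.Val (D : Decls.{u}) : Type u := ∀ x, D.Ty x

/-- Disjoint union of two sets of declarations. -/
def Decls.sum (D E : Decls.{u}) : Decls.{u} where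
  Name := D.Name ⊕ E.Name
  Ty := Sum.elim D.Ty E.Ty
  init
    | .inl x => D.init x
    | .inr y => E.init y

/-- The valuation of the disjoint union given by a valuation of each part. -/
def Decls.join {D E : Decls.{u}} (v : D.Val) (w : E.Val) : (D.sum E).Val
  | .inl x => v x
  | .inr y => w y

/-- The part of a valuation of the disjoint union on the left summand. -/
def Decls.left {D E : Decls.{u}} (v : (D.sum E).Val) : D.Val := fun x => v (.inl x)

/-- The part of a valuation of the disjoint union on the right summand. -/
def Decls.right {D E : Decls.{u}} (v : (D.sum E).Val) : E.Val := fun y => v (.inr y)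

/-- Local states: the value of the variable `self`, which no statement can write, and the values of
the other local variables. -/
structure LState (X : Decls.{u}) where
  self : Tid
  vars : X.Val

/-- The always admissible statements that may stand at any position of an atomic block. -/
inductive SimpleStmt (G X : Decls.{u}) : Type u
  /-- `l := f l` -/
  | update (f : LState X → X.Val)
  /-- `l := f l g` -/
  | read (g : G.Name) (f : LState X → G.Ty g → X.Val)
  /-- `g := f l` -/
  | write (g : G.Name) (f : LState X → G.Ty g)
  /-- `assert (p l)` -/
  | assert (p : LState X → Bool)

/-- The actions of `Lang`. -/
inductive Stmt (G X : Decls.{u}) (M T : Type u) : Type u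
  | simple (s : SimpleStmt G X)
  | lock (m : M)
  | unlock (m : M)
  | create (t : T)
  | pos (c : LState X → Bool)
  | neg (c : LState X → Bool)

/-- The actions of `Lang` with atomic blocks: a statement, or `atomic{a₁; a₂; …; aₙ}`. -/
inductive Action (G X : Decls.{u}) (M T : Type u) : Type u
  | base (a : Stmt G X M T)
  | atomic (a₁ : Stmt G X M T) (as : List (SimpleStmt G X))

/-- Programs whose edges are labelled by `Lab`. The control-flow graph of the thread template `T`
consists of the nodes `u` with `tmpl u = T`, so the graphs are disjoint. `edge u v` is the action of
the edge from `u` to `v`, if there is one; there is at most one. -/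
structure Program (Lab : Decls.{u} → Decls.{u} → Type u → Type u → Type u) where
  glob : Decls.{u}
  loc : Decls.{u}
  Mutex : Type u
  Templ : Type u
  Node : Type u
  finite_templ : Finite Templ
  finite_node : Finite Node
  main : Templ
  tmpl : Node → Templ
  start : Templ → Node
  edge : Node → Node → Option (Lab glob loc Mutex Templ)
  tmpl_start : ∀ T, tmpl (start T) = T
  tmpl_edge : ∀ u v, (edge u v).isSome → tmpl u = tmpl v
  edge_start : ∀ u T, edge u (start T) = none

/-- Programs without atomic blocks. -/
abbrev Lang : Type (u + 1) := Program.{u} Stmt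

/-- Programs with atomic blocks. -/
abbrev LangAtomic : Type (u + 1) := Program.{u} Action

/-- The initial local state of the initial thread. -/
def Program.initLoc {Lab} (P : Program.{u} Lab) : LState P.loc := ⟨[], P.loc.init⟩

/-! ### Interleaving semantics -/

section Interleavings

/-- The first statement of an action. -/
def Action.first {G X : Decls.{u}} {M T : Type u} : Action G X M T → Stmt G X M T
  | .base a => a
  | .atomic a₁ _ => a₁

/-- The sequence of statements of an action. -/
def Action.stmts {G X : Decls.{u}} {M T : Type u} : Action G X M T → List (Stmt G X M T)
  | .base a => [a]
  | .atomic a₁ as => a₁ :: as.map .simple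

/-- The statement is a thread creation. -/
def Stmt.IsCreate {G X : Decls.{u}} {M T : Type u} : Stmt G X M T → Prop
  | .create _ => True
  | _ => False

/-- Program configurations `(L, M, G)`. -/
structure State (P : LangAtomic.{u}) where
  L : Tid → Option (P.Node × LState P.loc)
  M : P.Mutex → Option Tid
  G : P.glob.Val

/-- The initial configuration. -/
def State.initial (P : LangAtomic.{u}) : State P where
  L t := if t = [] then some (P.start P.main, P.initLoc) else none
  M _ := none
  G := P.glob.init

/-- A statement is admissible for a thread `t` with local state `l` under the mutex ownership `M`. -/
def Stmt.Admissible {G X : Decls.{u}} {M T : Type u} (a : Stmt G X M T) (t : Tid) (l : LState X)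
    (own : M → Option Tid) : Prop :=
  match a with
  | .lock m => own m = none
  | .unlock m => own m = some t
  | .pos c => c l = true
  | .neg c => c l = false
  | _ => True

open Classical in
/-- The configuration after thread `t` has executed the statement `a` in `s` and moved to node `v`;
`c` is the thread id used if `a` creates a thread. -/
def Stmt.effect {P : LangAtomic.{u}} (t : Tid) (v : P.Node) (c : Tid) (s : State P)
    (a : Stmt P.glob P.loc P.Mutex P.Templ) : State P :=
  match s.L t with
  | none => s
  | some (_, l) =>
    match a with
    | .simple (.update f) =>
        { s with L := Function.update s.L t (some (v, ⟨l.self, f l⟩)) }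
    | .simple (.read g f) =>
        { s with L := Function.update s.L t (some (v, ⟨l.self, f l (s.G g)⟩)) }
    | .simple (.write g f) =>
        { s with L := Function.update s.L t (some (v, l)), G := Function.update s.G g (f l) }
    | .simple (.assert _) => { s with L := Function.update s.L t (some (v, l)) }
    | .lock m =>
        { s with L := Function.update s.L t (some (v, l)), M := Function.update s.M m (some t) }
    | .unlock m =>
        { s with L := Function.update s.L t (some (v, l)), M := Function.update s.M m none }
    | .create T =>
        { s with L := Function.update (Function.update s.L t (some (v, l))) c
                        (some (P.start T, ⟨c, l.vars⟩)) }
    | .pos _ => { s with L := Function.update s.L t (some (v, l)) }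
    | .neg _ => { s with L := Function.update s.L t (some (v, l)) }

/-- Sequential composition of the effects of a list of statements. -/
def effects {P : LangAtomic.{u}} (t : Tid) (v : P.Node) (c : Tid) (s : State P)
    (as : List (Stmt P.glob P.loc P.Mutex P.Templ)) : State P :=
  as.foldl (Stmt.effect t v c) s

/-- A step: thread `t` takes the edge `(u, a, v)` in configuration `src`. -/
structure Step (P : LangAtomic.{u}) where
  src : State P
  thread : Tid
  u : P.Node
  act : Action P.glob P.loc P.Mutex P.Templ
  v : P.Node

open Classical in
/-- The id of the next thread created by `p` after the steps `i`: `p` followed by the number of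
threads that `p` has created so far. -/
def newTid {P : LangAtomic.{u}} (p : Tid) (i : List (Step P)) : Tid :=
  p ++ [i.countP fun st => decide (st.thread = p ∧ st.act.first.IsCreate)]

/-- `Interleaving P i s`: the steps `i` form a consistent interleaving of `P` ending in `s`. -/
inductive Interleaving (P : LangAtomic.{u}) : List (Step P) → State P → Prop
  | init : Interleaving P [] (State.initial P)
  | extend {i : List (Step P)} {s : State P} (t : Tid) (u v : P.Node)
      (a : Action P.glob P.loc P.Mutex P.Templ) (l : LState P.loc)
      (consistent : Interleaving P i s)
      (edge : P.edge u v = some a)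
      (loc : s.L t = some (u, l))
      (admissible : a.first.Admissible t l s.M) :
      Interleaving P (i ++ [⟨s, t, u, a, v⟩]) (effects t v (newTid l.self i) s a.stmts)

/-- An assertion is violated in the sequence of steps `i`: some step executes an action
`a₁; …; aₙ` in which some `aₖ` is an assertion that is false after `a₁; …; aₖ₋₁`. -/
def ViolatedIn {P : LangAtomic.{u}} (i : List (Step P)) : Prop :=
  ∃ (i₁ i₂ : List (Step P)) (st : Step P), i = i₁ ++ st :: i₂ ∧
    ∃ (as bs : List (Stmt P.glob P.loc P.Mutex P.Templ)) (p : LState P.loc → Bool),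
      st.act.stmts = as ++ .simple (.assert p) :: bs ∧
      ∃ (n : P.Node) (l : LState P.loc),
        (effects st.thread st.v (newTid st.thread i₁) st.src as).L st.thread = some (n, l) ∧
        p l = false

/-- Safety with respect to the interleaving semantics. -/
def SafeInterleaving (P : LangAtomic.{u}) : Prop :=
  ∀ i s, Interleaving P i s → ¬ ViolatedIn i

end Interleavings

/-! ### Local trace semantics -/

section Traces

/-- An event `(t, n)` stands for the local configuration of thread `t` after `n` steps of `t`. -/
abbrev Event : Type := Tid × ℕ

/-- A candidate for a global trace. `conf t n = some (u, l)` says that the trace contains the local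
configuration `(n, u, l)` of thread `t`. The step between two consecutive configurations is the
unique edge between their nodes. -/
structure RawTrace (P : Lang.{u}) where
  conf : Tid → ℕ → Option (P.Node × LState P.loc)
  createOrd : Event → Event → Prop
  lockOrd : P.Mutex → Event → Event → Prop

namespace RawTrace

variable {P : Lang.{u}} (τ : RawTrace P)

/-- The event occurs in the trace. -/
def Mem (e : Event) : Prop := (τ.conf e.1 e.2).isSome

/-- Step number `k` of thread `t` leads from local state `l` to `l'` along an edge labelled `a`. -/
def IsStep (t : Tid) (k : ℕ) (l : LState P.loc) (a : Stmt P.glob P.loc P.Mutex P.Templ)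
    (l' : LState P.loc) : Prop :=
  ∃ u v, τ.conf t k = some (u, l) ∧ τ.conf t (k + 1) = some (v, l') ∧ P.edge u v = some a

/-- Step number `k` of thread `t` performs the action `a`. -/
def Performs (t : Tid) (k : ℕ) (a : Stmt P.glob P.loc P.Mutex P.Templ) : Prop :=
  ∃ l l', τ.IsStep t k l a l'

/-- Program order (between consecutive configurations of a thread). -/
def ProgOrd (e e' : Event) : Prop := τ.Mem e ∧ τ.Mem e' ∧ e' = (e.1, e.2 + 1)

/-- Causality order: the reflexive transitive closure of program order, create order and the lock
orders of all mutexes. -/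
def Le : Event → Event → Prop :=
  Relation.ReflTransGen fun e e' => τ.ProgOrd e e' ∨ τ.createOrd e e' ∨ ∃ m, τ.lockOrd m e e'

open Classical in
/-- The number of threads that thread `t` has created in its first `k` steps. -/
def numCreates (t : Tid) (k : ℕ) : ℕ :=
  ((Finset.range k).filter fun j => ∃ T, τ.Performs t j (.create T)).card

/-- `e` is the configuration reached by a write of the value `x` to the global `g`. -/
def IsWrite (g : P.glob.Name) (x : P.glob.Ty g) (e : Event) : Prop :=
  ∃ t k l l' f, e = (t, k + 1) ∧ τ.IsStep t k l (.simple (.write g f)) l' ∧ x = f l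

/-- `x` is the value of `g` as seen at `e`: the value of the last write to `g` before `e` in the
causality order, or the initial value if there is no such write. -/
def ReadsValue (g : P.glob.Name) (e : Event) (x : P.glob.Ty g) : Prop :=
  (∃ w, τ.IsWrite g x w ∧ τ.Le w e ∧ ∀ y w', τ.IsWrite g y w' → τ.Le w' e → τ.Le w' w) ∨
  ((∀ y w, τ.IsWrite g y w → ¬ τ.Le w e) ∧ x = P.glob.init g)

/-- The local effect of step number `k` of thread `t`, together with the condition under which a
guard may be passed. -/
def LocalEffect (t : Tid) (k : ℕ) (l : LState P.loc) (a : Stmt P.glob P.loc P.Mutex P.Templ)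
    (l' : LState P.loc) : Prop :=
  match a with
  | .simple (.update f) => l' = ⟨l.self, f l⟩
  | .simple (.read g f) => ∃ x, τ.ReadsValue g (t, k) x ∧ l' = ⟨l.self, f l x⟩
  | .pos c => c l = true ∧ l' = l
  | .neg c => c l = false ∧ l' = l
  | _ => l' = l

/-- After `k` steps the thread `t` holds the mutex `m`: it has locked `m` and not unlocked it since. -/
def Holds (t : Tid) (k : ℕ) (m : P.Mutex) : Prop :=
  ∃ j < k, τ.Performs t j (.lock m) ∧ ∀ i, j < i → i < k → ¬ τ.Performs t i (.unlock m)

/-- Consistent global traces. -/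
structure IsGlobalTrace : Prop where
  finite : {e | τ.Mem e}.Finite
  /-- The initial thread starts in the initial configuration. -/
  init : τ.conf [] 0 = some (P.start P.main, P.initLoc)
  /-- Each thread runs along the edges of its control-flow graph. -/
  path : ∀ t k, τ.Mem (t, k + 1) → ∃ l a l', τ.IsStep t k l a l'
  effect : ∀ t k l a l', τ.IsStep t k l a l' → τ.LocalEffect t k l a l'
  /-- Causality order: a partial order with the initial configuration as least element. -/
  antisymm : ∀ e e', τ.Le e e' → τ.Le e' e → e = e'
  least : ∀ e, τ.Mem e → τ.Le ([], 0) e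
  /-- The create order leads from a configuration about to perform a create action to the first
  configuration of the created thread. The create step itself need not belong to the trace, but its
  thread cannot take another step instead. -/
  create_spec : ∀ e e', τ.createOrd e e' → ∃ u l T,
    τ.conf e.1 e.2 = some (u, l) ∧
    (τ.Performs e.1 e.2 (.create T) ∨
      (¬ τ.Mem (e.1, e.2 + 1) ∧ ∃ v, P.edge u v = some (.create T))) ∧
    e' = (e.1 ++ [τ.numCreates e.1 e.2], 0) ∧
    τ.conf e'.1 e'.2 = some (P.start T, ⟨e'.1, l.vars⟩)
  /-- Each thread except the initial one is created by exactly one create action. -/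
  created : ∀ t, t ≠ [] → τ.Mem (t, 0) → ∃! e, τ.createOrd e (t, 0)
  /-- Each create action creates at most one thread. -/
  create_unique : ∀ e e' e'', τ.createOrd e e' → τ.createOrd e e'' → e' = e''
  /-- The lock order of `m` leads from the configuration after an `unlock m`, or from the initial
  configuration of the trace, to the configuration after a `lock m`. -/
  lock_spec : ∀ m e e', τ.lockOrd m e e' →
    (e = ([], 0) ∨ ∃ t k, e = (t, k + 1) ∧ τ.Performs t k (.unlock m)) ∧
    ∃ t k, e' = (t, k + 1) ∧ τ.Performs t k (.lock m)
  /-- Each lock operation is preceded by exactly one unlock operation, or is the first one. -/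
  lock_pred : ∀ m t k, τ.Performs t k (.lock m) → ∃! e, τ.lockOrd m e (t, k + 1)
  /-- There is at most one first lock operation, and each unlock operation is followed by at most
  one lock operation. -/
  lock_succ : ∀ m e e' e'', τ.lockOrd m e e' → τ.lockOrd m e e'' → e' = e''
  /-- Only the holder of a mutex can unlock it. -/
  unlock_holds : ∀ t k m, τ.Performs t k (.unlock m) → τ.Holds t k m

/-- Local traces: global traces with a unique maximal element. -/
def IsLocalTrace : Prop :=
  τ.IsGlobalTrace ∧ ∃! e, τ.Mem e ∧ ∀ e', τ.Mem e' → τ.Le e e' → e' = e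

/-- Some assertion evaluates to false in the trace. -/
def Violated : Prop :=
  ∃ t k l l' p, τ.IsStep t k l (.simple (.assert p)) l' ∧ p l = false

end RawTrace

/-- Safety with respect to the local trace semantics. -/
def SafeLocalTraces (P : Lang.{u}) : Prop :=
  ∀ τ : RawTrace P, τ.IsLocalTrace → ¬ τ.Violated

end Traces

/-! ### Ghost witnesses and witness-instrumented programs -/

section Witnesses

/-- A boolean expression over local variables and the finitely many globals `reads`. -/
structure Invariant (G X : Decls.{u}) where
  reads : List G.Name
  holds : LState X → (∀ g : {g // g ∈ reads}, G.Ty g) → Bool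

/-- Ghost statements. They see all variables but change only ghost variables (`G'` ghost globals,
`X'` ghost locals): writes of ghost locals, reads of (program or ghost) globals into ghost locals,
and writes of ghost globals. -/
inductive GhostStmt (G X G' X' : Decls.{u}) : Type u
  | update (f : LState (X.sum X') → X'.Val)
  | read (g : (G.sum G').Name) (f : LState (X.sum X') → (G.sum G').Ty g → X'.Val)
  | write (g : G'.Name) (f : LState (X.sum X') → G'.Ty g)

/-- Ghost witnesses `(𝒟', X', 𝕌, 𝕀)` for `P`. The partial functions are `Option`-valued; `upd u v`
is the ghost update of the edge from `u` to `v` (and is not used if there is no such edge). -/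
structure Witness (P : Lang.{u}) where
  glob : Decls.{u}
  loc : Decls.{u}
  upd : P.Node → P.Node → Option {us : List (GhostStmt P.glob P.loc glob loc) // us ≠ []}
  inv : P.Node → Option (Invariant (P.glob.sum glob) (P.loc.sum loc))

namespace Witness

variable {P : Lang.{u}} (W : Witness P)

/-- Globals of the instrumented program. -/
abbrev allGlob : Decls.{u} := P.glob.sum W.glob

/-- Program and ghost local variables. -/
abbrev userLoc : Decls.{u} := P.loc.sum W.loc

/-- Local variables of the instrumented program: those of the program, the ghost ones, and for each
global a temporary, which is used only to evaluate invariants, as assertions see only the local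
state. -/
abbrev allLoc : Decls.{u} := W.userLoc.sum W.allGlob

/-- Forget the temporaries. -/
def userState (l : LState W.allLoc) : LState W.userLoc := ⟨l.self, Decls.left l.vars⟩

/-- Forget the temporaries and the ghost variables. -/
def progState (l : LState W.allLoc) : LState P.loc := ⟨l.self, Decls.left (Decls.left l.vars)⟩

/-- Replace the values of the program variables. -/
def setProg (l : LState W.allLoc) (x : P.loc.Val) : W.allLoc.Val :=
  Decls.join (Decls.join x (Decls.right (Decls.left l.vars))) (Decls.right l.vars)

/-- Replace the values of the ghost local variables. -/
def setGhost (l : LState W.allLoc) (y : W.loc.Val) : W.allLoc.Val :=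
  Decls.join (Decls.join (Decls.left (Decls.left l.vars)) y) (Decls.right l.vars)

open Classical in
/-- Replace the value of the temporary for the global `g`. -/
def setTmp (l : LState W.allLoc) (g : W.allGlob.Name) (x : W.allGlob.Ty g) : W.allLoc.Val :=
  Decls.join (Decls.left l.vars) (Function.update (Decls.right (D := W.userLoc) l.vars) g x)

/-- A statement of `P` as a statement of the instrumented program. -/
def progStmt : Stmt P.glob P.loc P.Mutex P.Templ → Stmt W.allGlob W.allLoc P.Mutex P.Templ
  | .simple (.update f) => .simple (.update fun l => W.setProg l (f (W.progState l)))
  | .simple (.read g f) =>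
      .simple (.read (.inl g) fun l x => W.setProg l (f (W.progState l) x))
  | .simple (.write g f) => .simple (.write (.inl g) fun l => f (W.progState l))
  | .simple (.assert p) => .simple (.assert fun l => p (W.progState l))
  | .lock m => .lock m
  | .unlock m => .unlock m
  | .create T => .create T
  | .pos c => .pos fun l => c (W.progState l)
  | .neg c => .neg fun l => c (W.progState l)

/-- A ghost statement as a statement of the instrumented program. -/
def ghostStmt : GhostStmt P.glob P.loc W.glob W.loc → SimpleStmt W.allGlob W.allLoc
  | .update f => .update fun l => W.setGhost l (f (W.userState l))
  | .read g f => .read g fun l x => W.setGhost l (f (W.userState l) x)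
  | .write g f => .write (.inr g) fun l => f (W.userState l)

/-- The atomic block that evaluates an invariant, by reading the globals in it into their
temporaries, and then asserts it. -/
def invAction (i : Invariant W.allGlob W.userLoc) : Action W.allGlob W.allLoc P.Mutex P.Templ :=
  let check : SimpleStmt W.allGlob W.allLoc :=
    .assert fun l => i.holds (W.userState l) fun g => Decls.right (D := W.userLoc) l.vars g
  match i.reads.map fun g => SimpleStmt.read g fun l x => W.setTmp l g x with
  | [] => .atomic (.simple check) []
  | r :: rs => .atomic (.simple r) (rs ++ [check])

/-- The action `a` of the edge from `u` to `v` combined with the ghost update of that edge. -/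
def updAction (u v : P.Node) (a : Stmt P.glob P.loc P.Mutex P.Templ) :
    Action W.allGlob W.allLoc P.Mutex P.Templ :=
  match W.upd u v with
  | none => .base (W.progStmt a)
  | some us => .atomic (W.progStmt a) (us.1.map W.ghostStmt)

/-- The new nodes `(u, v)`: one for each edge from `u` to `v` such that `u` has an invariant. -/
abbrev NewNode : Type u :=
  {e : P.Node × P.Node // (P.edge e.1 e.2).isSome ∧ (W.inv e.1).isSome}

open Classical in
/-- The edges of the instrumented program. If `u` has an invariant, the edge `(u, a, v)` is replaced
by an edge from `u` to `(u, v)` that asserts the invariant and an edge from `(u, v)` to `v` that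
performs `a` with its ghost update; otherwise it is replaced by an edge from `u` to `v` that performs
`a` with its ghost update. -/
def instrEdge : P.Node ⊕ W.NewNode → P.Node ⊕ W.NewNode →
    Option (Action W.allGlob W.allLoc P.Mutex P.Templ)
  | .inl u, .inl v => if (W.inv u).isSome then none else (P.edge u v).map (W.updAction u v)
  | .inl u, .inr e => if e.1.1 = u then (W.inv u).map W.invAction else none
  | .inr e, .inl v => if e.1.2 = v then (P.edge e.1.1 v).map (W.updAction e.1.1 v) else none
  | .inr _, .inr _ => none

/-- The template to which a node of the instrumented program belongs. -/
def instrTmpl : P.Node ⊕ W.NewNode → P.Templ := Sum.elim P.tmpl fun e => P.tmpl e.1.1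

/-- The witness-instrumented program. -/
def instrument : LangAtomic.{u} where
  glob := W.allGlob
  loc := W.allLoc
  Mutex := P.Mutex
  Templ := P.Templ
  Node := P.Node ⊕ W.NewNode
  finite_templ := P.finite_templ
  finite_node := by
    have := P.finite_node
    infer_instance
  main := P.main
  tmpl := W.instrTmpl
  start T := .inl (P.start T)
  edge := W.instrEdge
  tmpl_start := P.tmpl_start
  tmpl_edge := by
    rintro (u | e) (v | e') h
    · refine P.tmpl_edge u v ?_
      simp only [instrEdge] at h
      split_ifs at h <;> simp_all
    · simp only [instrEdge] at h
      split_ifs at h with h1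
      · simp [instrTmpl, h1]
      · simp at h
    · simp only [instrEdge] at h
      split_ifs at h with h1
      · exact P.tmpl_edge e.1.1 v (by simpa using h)
      · simp at h
    · simp [instrEdge] at h
  edge_start := by
    rintro (u | e) T <;> simp [instrEdge, P.edge_start]

end Witness

end Witnesses

/-! ### Encoding atomic blocks as critical sections -/

section Split

/-- The globals accessed by a statement. -/
def Stmt.accessed {G X : Decls.{u}} {M T : Type u} : Stmt G X M T → List G.Name
  | .simple (.read g _) => [g]
  | .simple (.write g _) => [g]
  | _ => []

open Classical in
/-- The globals accessed by an action, without repetitions and in increasing order. -/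
def Action.accessed {G X : Decls.{u}} {M T : Type u} (ord : LinearOrder G.Name)
    (a : Action G X M T) : List G.Name :=
  Finset.sort (a.stmts.flatMap Stmt.accessed).toFinset (· ≤ ·)

/-- A statement over a larger set of mutexes. In `M ⊕ G.Name` the mutex dedicated to the global `g`
is `Sum.inr g`. -/
def Stmt.addMutexes {G X : Decls.{u}} {M T : Type u} :
    Stmt G X M T → Stmt G X (M ⊕ G.Name) T
  | .simple s => .simple s
  | .lock m => .lock (.inl m)
  | .unlock m => .unlock (.inl m)
  | .create t => .create t
  | .pos c => .pos c
  | .neg c => .neg c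

/-- The sequence of statements that encodes an action: lock the mutexes of the accessed globals in
increasing order, execute the action, and unlock them in reverse order. -/
def Action.expand {G X : Decls.{u}} {M T : Type u} (ord : LinearOrder G.Name)
    (a : Action G X M T) : List (Stmt G X (M ⊕ G.Name) T) :=
  (a.accessed ord).map (fun g => .lock (.inr g)) ++ a.stmts.map Stmt.addMutexes ++
    (a.accessed ord).reverse.map (fun g => .unlock (.inr g))

variable (P : LangAtomic.{u}) (ord : LinearOrder P.glob.Name)

/-- The statements that replace the edge from `u` to `v` (none if there is no such edge). -/
def splitStmts (u v : P.Node) : List (Stmt P.glob P.loc (P.Mutex ⊕ P.glob.Name) P.Templ) :=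
  match P.edge u v with
  | none => []
  | some a => a.expand ord

/-- The nodes of the split program: those of `P`, and `n - 1` intermediate nodes for each edge that is
replaced by a path of `n` statements. -/
abbrev SplitNode : Type u :=
  P.Node ⊕ (Σ e : P.Node × P.Node, Fin ((splitStmts P ord e.1 e.2).length - 1))

open Classical in
/-- Each edge from `u` to `v` is replaced by a path from `u` to `v` with the labels `splitStmts`; the
intermediate node with index `k` lies between the statements with indices `k` and `k + 1`. -/
def splitEdge : SplitNode P ord → SplitNode P ord →
    Option (Stmt P.glob P.loc (P.Mutex ⊕ P.glob.Name) P.Templ)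
  | .inl u, .inl v =>
      if (splitStmts P ord u v).length = 1 then (splitStmts P ord u v)[0]? else none
  | .inl u, .inr ⟨e, k⟩ =>
      if e.1 = u ∧ k.1 = 0 then (splitStmts P ord e.1 e.2)[0]? else none
  | .inr ⟨e, k⟩, .inr ⟨e', k'⟩ =>
      if e = e' ∧ k'.1 = k.1 + 1 then (splitStmts P ord e.1 e.2)[k.1 + 1]? else none
  | .inr ⟨e, k⟩, .inl v =>
      if e.2 = v ∧ k.1 + 2 = (splitStmts P ord e.1 e.2).length then
        (splitStmts P ord e.1 e.2)[k.1 + 1]? else none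

theorem isSome_edge_of_splitStmts {u v : P.Node} (h : 0 < (splitStmts P ord u v).length) :
    (P.edge u v).isSome := by
  unfold splitStmts at h
  cases hP : P.edge u v <;> simp_all

/-- The template to which a node of the split program belongs. -/
def splitTmpl : SplitNode P ord → P.Templ := Sum.elim P.tmpl fun x => P.tmpl x.1.1

/-- The program in which every action is encoded as a critical section protected by the mutexes of
the globals that it accesses; `ord` is the order in which these mutexes are locked. -/
def split : Lang.{u} where
  glob := P.glob
  loc := P.loc
  Mutex := P.Mutex ⊕ P.glob.Name
  Templ := P.Templ
  Node := SplitNode P ord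
  finite_templ := P.finite_templ
  finite_node := by
    have := P.finite_node
    infer_instance
  main := P.main
  tmpl := splitTmpl P ord
  start T := .inl (P.start T)
  edge := splitEdge P ord
  tmpl_start := P.tmpl_start
  tmpl_edge := by
    rintro (u | ⟨e, k⟩) (v | ⟨e', k'⟩) h
    · simp only [splitEdge] at h
      split_ifs at h with h1
      · exact P.tmpl_edge u v (isSome_edge_of_splitStmts P ord (by omega))
      · simp at h
    · simp only [splitEdge] at h
      split_ifs at h with h1
      · simp [splitTmpl, h1.1]
      · simp at h
    · simp only [splitEdge] at h
      split_ifs at h with h1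
      · have := P.tmpl_edge e.1 e.2 (isSome_edge_of_splitStmts P ord (by omega))
        simpa [splitTmpl, h1.1] using this
      · simp at h
    · simp only [splitEdge] at h
      split_ifs at h with h1
      · simp [splitTmpl, h1.1]
      · simp at h
  edge_start := by
    have key : ∀ u T, splitStmts P ord u (P.start T) = [] := by
      intro u T
      simp [splitStmts, P.edge_start]
    rintro (u | ⟨⟨u, v⟩, k⟩) T
    · simp [splitEdge, key]
    · by_cases hv : v = P.start T
      · subst hv
        have := k.2
        simp [key] at this
      · simp [splitEdge, hv]

end Split

/-! ### Validity of witnesses -/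

/-- `W` is valid with respect to the interleaving semantics. -/
def Witness.ValidInterleaving {P : Lang.{u}} (W : Witness P) : Prop :=
  SafeInterleaving W.instrument

/-- `W` is valid with respect to the local trace semantics; `ord` is the order in which the mutexes
dedicated to the globals are locked in the encoding of atomic blocks. -/
def Witness.ValidLocalTraces {P : Lang.{u}} (W : Witness P)
    (ord : LinearOrder W.instrument.glob.Name) : Prop :=
  SafeLocalTraces (split W.instrument ord)

end GhostWitness

end

noncomputable section

namespace GhostWitness

/-! ### Basic facts about global traces -/

section TraceBasics

namespace RawTrace

variable {P : Lang.{u}} {τ : RawTrace P}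

/-! The instrumentation plays no role: the equivalence holds for every program `Q` with atomic
blocks and the program `split Q ord` (`safeInterleaving_iff`). Both notions of safety are compared
with a third one, namely that no reachable configuration of the split program, run as an ordinary
machine, is about to violate an assertion (`Machine.Reach`, `Machine.Bad`). A `Machine` also counts
the threads created by each thread, so that the id of a new thread depends on the configuration
alone and not on the history.

Local traces and machine runs agree as soon as every access to a global happens under a mutex
dedicated to it (`safeLocalTraces_iff`); `protected_split` shows that this is so in the split
program. All locks of a mutex lie on a single chain, so of two critical sections of the same mutex
one is closed before the other is opened (`lock_total`). Hence accesses to a protected global are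
causally ordered after all writes that do not depend on them (`le_of_holds`, `write_le`), and the
last write in the causality order is the last write in every linearization. A trace is turned into a
run by consuming its events in an order compatible with causality; the invariant is `Cut`, preserved
by `Cut.step`. Conversely, every step of a run adds a new maximal event to a trace (`extend`,
followed by `spawn` for a create action), which gives `Machine.Reach.exists_endsWith`; the past of a
violating step is then a local trace (`isLocalTrace_below`).

From interleavings to machine runs, each action is executed as an uninterrupted block of locks,
statements and unlocks, which is possible because all dedicated mutexes are free between blocks
(`reach_block`). A violation inside an action is met by stopping in the middle of its block.

From machine runs to interleavings the argument is one of reduction: an action is scheduled as a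
whole at the moment when its first statement is executed. By then the thread holds the mutexes of
all globals accessed by the action, the later statements are never blocked, and other threads can
neither observe nor influence these globals before they are released. So the effect of the later
statements can be anticipated, and `Simulates` relates a configuration to an interleaving that is
ahead of it by these pending statements. If `Q` is safe, then all assertions of the scheduled action
hold in the interleaving, and therefore also when the machine comes to execute them
(`Simulates.first`, `Machine.Reach.not_bad`).

The order of locking is immaterial, since safety concerns finite prefixes only and deadlocks are
harmless; all that is used is that the list of mutexes has no repetitions. -/

theorem IsStep.unique {t : Tid} {k : ℕ} {l₁ l₂ l₁' l₂' : LState P.loc}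
    {a₁ a₂ : Stmt P.glob P.loc P.Mutex P.Templ}
    (h₁ : τ.IsStep t k l₁ a₁ l₁') (h₂ : τ.IsStep t k l₂ a₂ l₂') :
    l₁ = l₂ ∧ a₁ = a₂ ∧ l₁' = l₂' := by
  obtain ⟨u, v, h1, h2, h3⟩ := h₁
  obtain ⟨u', v', h1', h2', h3'⟩ := h₂
  simp only [h1, Option.some.injEq, Prod.mk.injEq] at h1'
  simp only [h2, Option.some.injEq, Prod.mk.injEq] at h2'
  obtain ⟨rfl, rfl⟩ := h1'
  obtain ⟨rfl, rfl⟩ := h2'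
  simp_all

theorem Performs.unique {t : Tid} {k : ℕ} {a₁ a₂ : Stmt P.glob P.loc P.Mutex P.Templ}
    (h₁ : τ.Performs t k a₁) (h₂ : τ.Performs t k a₂) : a₁ = a₂ := by
  obtain ⟨_, _, h₁⟩ := h₁
  obtain ⟨_, _, h₂⟩ := h₂
  exact (h₁.unique h₂).2.1

theorem IsStep.performs {t : Tid} {k : ℕ} {l l' : LState P.loc}
    {a : Stmt P.glob P.loc P.Mutex P.Templ} (h : τ.IsStep t k l a l') : τ.Performs t k a :=
  ⟨l, l', h⟩

theorem Performs.mem {t : Tid} {k : ℕ} {a : Stmt P.glob P.loc P.Mutex P.Templ}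
    (h : τ.Performs t k a) : τ.Mem (t, k) := by
  obtain ⟨_, _, u, v, h, _, _⟩ := h
  simp [Mem, h]

theorem Performs.mem_succ {t : Tid} {k : ℕ} {a : Stmt P.glob P.loc P.Mutex P.Templ}
    (h : τ.Performs t k a) : τ.Mem (t, k + 1) := by
  obtain ⟨_, _, u, v, _, h, _⟩ := h
  simp [Mem, h]

theorem IsWrite.unique {g : P.glob.Name} {x y : P.glob.Ty g} {e : Event}
    (hx : τ.IsWrite g x e) (hy : τ.IsWrite g y e) : x = y := by
  obtain ⟨t, k, l, l', f, rfl, h, rfl⟩ := hx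
  obtain ⟨t', k', l₂, l₂', f', he, h', rfl⟩ := hy
  simp only [Prod.mk.injEq, Nat.add_right_cancel_iff] at he
  obtain ⟨rfl, rfl⟩ := he
  obtain ⟨rfl, h2, -⟩ := h.unique h'
  simp only [Stmt.simple.injEq, SimpleStmt.write.injEq, heq_eq_eq, true_and] at h2
  rw [h2]

/-- The value of the last write to `g` among the events in `S`. -/
def LastValue (τ : RawTrace P) (S : Event → Prop) (g : P.glob.Name) (x : P.glob.Ty g) : Prop :=
  (∃ w, τ.IsWrite g x w ∧ S w ∧ ∀ y w', τ.IsWrite g y w' → S w' → τ.Le w' w) ∨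
  ((∀ y w, τ.IsWrite g y w → ¬ S w) ∧ x = P.glob.init g)

/-- Only the writes in the set matter. Taking as the set the past of an event, a cut, or all events,
this compares the value of a read with the content of the memory. -/
theorem LastValue.congr {S S' : Event → Prop} {g : P.glob.Name} {x : P.glob.Ty g}
    (h : ∀ y w, τ.IsWrite g y w → (S w ↔ S' w)) (hx : τ.LastValue S g x) :
    τ.LastValue S' g x := by
  rcases hx with ⟨w, h1, h2, h3⟩ | ⟨h1, h2⟩
  · exact .inl ⟨w, h1, (h _ _ h1).1 h2, fun y w' h4 h5 => h3 y w' h4 ((h _ _ h4).2 h5)⟩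
  · exact .inr ⟨fun y w h3 h4 => h1 y w h3 ((h _ _ h3).2 h4), h2⟩

theorem readsValue_iff {g : P.glob.Name} {e : Event} {x : P.glob.Ty g} :
    τ.ReadsValue g e x ↔ τ.LastValue (fun w => τ.Le w e) g x := Iff.rfl

/-- The number of events below an event. -/
def rank (τ : RawTrace P) (e : Event) : ℕ := {e' | τ.Mem e' ∧ τ.Le e' e}.ncard

namespace IsGlobalTrace

variable (h : τ.IsGlobalTrace)
include h

/-- Two last writes are below each other, hence equal by antisymmetry. -/
theorem lastValue_unique {S : Event → Prop} {g : P.glob.Name} {x y : P.glob.Ty g}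
    (hx : τ.LastValue S g x) (hy : τ.LastValue S g y) : x = y := by
  rcases hx with ⟨w, h1, h2, h3⟩ | ⟨h1, h2⟩ <;> rcases hy with ⟨w', h1', h2', h3'⟩ | ⟨h1', h2'⟩
  · have := h.antisymm _ _ (h3 _ _ h1' h2') (h3' _ _ h1 h2)
    subst this
    exact h1.unique h1'
  · exact absurd h2 (h1' _ _ h1)
  · exact absurd h2' (h1 _ _ h1')
  · rw [h2, h2']

theorem performs_of_mem {t : Tid} {k : ℕ} (hm : τ.Mem (t, k + 1)) : ∃ a, τ.Performs t k a := by
  obtain ⟨l, a, l', hs⟩ := h.path t k hm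
  exact ⟨a, hs.performs⟩

theorem mem_of_le_index {t : Tid} {j k : ℕ} (hjk : j ≤ k) (hm : τ.Mem (t, k)) :
    τ.Mem (t, j) := by
  induction k, hjk using Nat.le_induction with
  | base => exact hm
  | succ k _ ih =>
    obtain ⟨a, ha⟩ := h.performs_of_mem hm
    exact ih ha.mem

theorem le_of_le_index {t : Tid} {j k : ℕ} (hjk : j ≤ k) (hm : τ.Mem (t, k)) :
    τ.Le (t, j) (t, k) := by
  induction k, hjk using Nat.le_induction with
  | base => exact .refl
  | succ k _ ih =>
    obtain ⟨a, ha⟩ := h.performs_of_mem hm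
    exact (ih ha.mem).tail (.inl ⟨ha.mem, hm, rfl⟩)

theorem mem_init : τ.Mem ([], 0) := by simp [Mem, h.init]

theorem createOrd_mem {e e' : Event} (hc : τ.createOrd e e') : τ.Mem e ∧ τ.Mem e' := by
  obtain ⟨u, l, T, h1, -, -, h2⟩ := h.create_spec e e' hc
  simp [Mem, h1, h2]

theorem createOrd_index {e e' : Event} (hc : τ.createOrd e e') : e'.2 = 0 ∧ e'.1 ≠ [] := by
  obtain ⟨u, l, T, h1, -, rfl, h2⟩ := h.create_spec e e' hc
  simp

theorem lockOrd_mem {m : P.Mutex} {e e' : Event} (hc : τ.lockOrd m e e') :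
    τ.Mem e ∧ τ.Mem e' := by
  obtain ⟨h1, t, k, rfl, h2⟩ := h.lock_spec m e e' hc
  refine ⟨?_, h2.mem_succ⟩
  rcases h1 with rfl | ⟨t', k', rfl, h1⟩
  · exact h.mem_init
  · exact h1.mem_succ

theorem mem_of_le {e e' : Event} (hle : τ.Le e e') (hm : τ.Mem e') : τ.Mem e := by
  induction hle using Relation.ReflTransGen.head_induction_on with
  | refl => exact hm
  | head h1 _ _ =>
    rcases h1 with h1 | h1 | ⟨m, h1⟩
    · exact h1.1
    · exact (h.createOrd_mem h1).1
    · exact (h.lockOrd_mem h1).1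

/-- Strict by antisymmetry, as `e'` itself is not below `e`. This makes `rank` a measure for
inductions along causality. -/
theorem rank_lt {e e' : Event} (hle : τ.Le e e') (hne : e ≠ e') (hm : τ.Mem e') :
    τ.rank e < τ.rank e' := by
  refine Set.ncard_lt_ncard ?_ (h.finite.subset fun x hx => hx.1)
  refine ⟨fun x hx => ⟨hx.1, hx.2.trans hle⟩, fun hss => hne ?_⟩
  exact h.antisymm _ _ hle (hss ⟨hm, Relation.ReflTransGen.refl⟩).2

/-- The only predecessor of the configuration after a step that is not a lock is the configuration
before that step. -/
theorem le_of_le_succ {t : Tid} {k : ℕ} {a : Stmt P.glob P.loc P.Mutex P.Templ}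
    (hp : τ.Performs t k a) (ha : ∀ m, a ≠ .lock m) {e : Event} (hle : τ.Le e (t, k + 1))
    (hne : e ≠ (t, k + 1)) : τ.Le e (t, k) := by
  rcases Relation.ReflTransGen.cases_tail hle with h1 | ⟨e', h1, h2⟩
  · exact absurd h1.symm hne
  · rcases h2 with h2 | h2 | ⟨m, h2⟩
    · have h3 := h2.2.2
      simp only [Prod.mk.injEq, Nat.add_right_cancel_iff] at h3
      have : e' = (t, k) := Prod.ext h3.1.symm h3.2.symm
      rwa [this] at h1
    · simpa using (h.createOrd_index h2).1
    · obtain ⟨-, t', k', h3, h4⟩ := h.lock_spec _ _ _ h2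
      simp only [Prod.mk.injEq, Nat.add_right_cancel_iff] at h3
      obtain ⟨rfl, rfl⟩ := h3
      exact absurd (hp.unique h4) (ha m)

end IsGlobalTrace

/-! ### Mutual exclusion -/

/-- The `lock m` with target `e'` is the next one after the `lock m` with target `e`: it succeeds the
unlock that belongs to the latter. -/
def NextLock (τ : RawTrace P) (m : P.Mutex) (e e' : Event) : Prop :=
  ∃ t j k, e = (t, j + 1) ∧ j < k ∧ τ.Performs t k (.unlock m) ∧
    (∀ i, j < i → i < k → ¬ τ.Performs t i (.unlock m)) ∧ τ.lockOrd m (t, k + 1) e'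

/-- The unlock that belongs to a lock is the first one after it, and an unlock has at most one
successor in the lock order. -/
theorem NextLock.rightUnique (h : τ.IsGlobalTrace) {m : P.Mutex} :
    Relator.RightUnique (τ.NextLock m) := by
  rintro e e₁ e₂ ⟨t, j, k, rfl, hjk, hp, hn, hl⟩ ⟨t', j', k', he, hjk', hp', hn', hl'⟩
  simp only [Prod.mk.injEq, Nat.add_right_cancel_iff] at he
  obtain ⟨rfl, rfl⟩ := he
  have : k = k' := by
    rcases lt_trichotomy k k' with hlt | heq | hlt
    · exact absurd hp (hn' k hjk hlt)
    · exact heq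
    · exact absurd hp' (hn k' hjk' hlt)
  subst this
  exact h.lock_succ _ _ _ _ hl hl'

theorem NextLock.le {m : P.Mutex} {t : Tid} {j : ℕ} {e : Event}
    (hn : τ.NextLock m (t, j + 1) e) :
    ∃ k, j < k ∧ τ.Performs t k (.unlock m) ∧ τ.Le (t, k + 1) e := by
  obtain ⟨t', j', k, he, hjk, hp, -, hl⟩ := hn
  simp only [Prod.mk.injEq, Nat.add_right_cancel_iff] at he
  obtain ⟨rfl, rfl⟩ := he
  exact ⟨k, hjk, hp, .single (.inr (.inr ⟨m, hl⟩))⟩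

namespace IsGlobalTrace

variable (h : τ.IsGlobalTrace)
include h

theorem nextLock_le {m : P.Mutex} {e e' : Event} (hn : τ.NextLock m e e') : τ.Le e e' := by
  obtain ⟨t, j, k, rfl, hjk, hp, -, hl⟩ := hn
  exact (h.le_of_le_index (by omega) hp.mem_succ).tail (.inr (.inr ⟨m, hl⟩))

theorem nextLock_reflTransGen_le {m : P.Mutex} {e e' : Event}
    (hn : Relation.ReflTransGen (τ.NextLock m) e e') : τ.Le e e' := by
  induction hn with
  | refl => exact .refl
  | tail _ h2 ih => exact ih.trans (h.nextLock_le h2)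

/-- Going back from a lock to the unlock preceding it, and from there to the lock which that unlock
closes, decreases `rank`. So the walk ends at the initial configuration, whose only successor is the
first lock of `m`. -/
theorem exists_first_lock {m : P.Mutex} : ∀ n, ∀ {t : Tid} {k : ℕ}, τ.rank (t, k + 1) = n →
    τ.Performs t k (.lock m) →
    ∃ e, τ.lockOrd m ([], 0) e ∧ Relation.ReflTransGen (τ.NextLock m) e (t, k + 1) := by
  intro n
  induction n using Nat.strong_induction_on with
  | _ n ih =>
    intro t k hn hp
    obtain ⟨e, he, -⟩ := h.lock_pred m t k hp
    obtain ⟨rfl | ⟨t', k', rfl, hu⟩, -⟩ := h.lock_spec _ _ _ he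
    · exact ⟨_, he, .refl⟩
    · obtain ⟨j, hj, hlock, hno⟩ := h.unlock_holds _ _ _ hu
      have hnext : τ.NextLock m (t', j + 1) (t, k + 1) := ⟨t', j, k', rfl, hj, hu, hno, he⟩
      have hle : τ.Le (t', k' + 1) (t, k + 1) := .single (.inr (.inr ⟨m, he⟩))
      have hle' : τ.Le (t', j + 1) (t', k') := h.le_of_le_index (by omega) hu.mem
      have hlt : τ.rank (t', j + 1) < n := by
        rw [← hn]
        refine lt_of_lt_of_le (h.rank_lt (hle'.trans (h.le_of_le_index (Nat.le_succ _) hu.mem_succ))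
          ?_ hu.mem_succ) ?_
        · simp; omega
        · by_cases heq : ((t', k' + 1) : Event) = (t, k + 1)
          · rw [heq]
          · exact (h.rank_lt hle heq hp.mem_succ).le
      obtain ⟨r, hr, hch⟩ := ih _ hlt rfl hlock
      exact ⟨r, hr, hch.tail hnext⟩

/-- Of two different locks of the same mutex one is followed by an unlock before the other. -/
theorem lock_total {m : P.Mutex} {t t' : Tid} {j j' : ℕ} (hp : τ.Performs t j (.lock m))
    (hp' : τ.Performs t' j' (.lock m)) :
    (t = t' ∧ j = j') ∨
    (∃ k, j < k ∧ τ.Performs t k (.unlock m) ∧ τ.Le (t, k + 1) (t', j' + 1)) ∨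
    (∃ k, j' < k ∧ τ.Performs t' k (.unlock m) ∧ τ.Le (t', k + 1) (t, j + 1)) := by
  have key : ∀ {t t' : Tid} {j j' : ℕ},
      Relation.ReflTransGen (τ.NextLock m) (t, j + 1) (t', j' + 1) →
      (t = t' ∧ j = j') ∨
      (∃ k, j < k ∧ τ.Performs t k (.unlock m) ∧ τ.Le (t, k + 1) (t', j' + 1)) := by
    intro t t' j j' hr
    rcases Relation.ReflTransGen.cases_head hr with h1 | ⟨e, h1, h2⟩
    · left
      simpa using h1
    · right
      obtain ⟨k, hk, hu, hle⟩ := h1.le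
      exact ⟨k, hk, hu, hle.trans (h.nextLock_reflTransGen_le h2)⟩
  obtain ⟨e, he, hr⟩ := h.exists_first_lock _ rfl hp
  obtain ⟨e', he', hr'⟩ := h.exists_first_lock _ rfl hp'
  -- Both chains start at the same first lock, and `NextLock` is functional, so one of the two locks
  -- lies on the chain that starts at the other.
  obtain rfl := h.lock_succ _ _ _ _ he he'
  rcases Relation.ReflTransGen.total_of_right_unique (NextLock.rightUnique h) hr hr' with h1 | h1
  · rcases key h1 with h2 | h2
    · exact .inl h2
    · exact .inr (.inl h2)
  · rcases key h1 with ⟨rfl, rfl⟩ | h2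
    · exact .inl ⟨rfl, rfl⟩
    · exact .inr (.inr h2)

/-- If `t` holds `m` after `k` steps, then every action performed elsewhere while holding `m` that
does not depend on further steps of `t` happens before. -/
theorem le_of_holds {m : P.Mutex} {t t' : Tid} {k k' : ℕ}
    {b : Stmt P.glob P.loc P.Mutex P.Templ} (hk : τ.Mem (t, k)) (hold : τ.Holds t k m)
    (hold' : τ.Holds t' k' m) (hb : τ.Performs t' k' b)
    (hcl : ∀ i, τ.Le (t, i + 1) (t', k' + 1) → i < k) : τ.Le (t', k' + 1) (t, k) := by
  obtain ⟨j, hj, hl, hno⟩ := hold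
  obtain ⟨j', hj', hl', hno'⟩ := hold'
  rcases h.lock_total hl hl' with ⟨rfl, rfl⟩ | ⟨i, hi, hu, hle⟩ | ⟨i, hi, hu, hle⟩
  -- Same critical section: `hcl`, applied to the action itself, bounds its index.
  · exact h.le_of_le_index (hcl k' .refl) hk
  -- Here `t` would have released `m` before the other lock; by `hcl` this release is among the
  -- first `k` steps, although `t` still holds `m`.
  · have := hcl i (hle.trans (h.le_of_le_index (by omega) hb.mem_succ))
    exact absurd hu (hno i hi this)
  · have h1 : k' ≤ i := by
      by_contra hlt
      exact hno' i hi (by omega) hu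
    exact ((h.le_of_le_index (by omega) hu.mem_succ).trans hle).trans
      (h.le_of_le_index (by omega) hk)

end IsGlobalTrace

end RawTrace

end TraceBasics

/-! ### Machine semantics of programs without atomic blocks -/

section Machines

variable {G X : Decls.{u}} {M T : Type u}

open Classical in
/-- The effect of a statement on the local state and the globals. -/
def Stmt.eval (a : Stmt G X M T) (x : LState X × G.Val) : LState X × G.Val :=
  match a with
  | .simple (.update f) => (⟨x.1.self, f x.1⟩, x.2)
  | .simple (.read g f) => (⟨x.1.self, f x.1 (x.2 g)⟩, x.2)
  | .simple (.write g f) => (x.1, Function.update x.2 g (f x.1))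
  | _ => x

open Classical in
/-- The effect of a statement of thread `t` on the ownership of mutexes. -/
def Stmt.own (a : Stmt G X M T) (t : Tid) (own : M → Option Tid) : M → Option Tid :=
  match a with
  | .lock m => Function.update own m (some t)
  | .unlock m => Function.update own m none
  | _ => own

open Classical in
/-- The effect of a statement of thread `t` on the numbers of threads created by each thread. -/
def Stmt.count (a : Stmt G X M T) (t : Tid) (c : Tid → ℕ) : Tid → ℕ :=
  match a with
  | .create _ => Function.update c t (c t + 1)
  | _ => c

/-- Configurations of a program together with the number of threads created by each thread. -/
@[ext]
structure Machine (P : Lang.{u}) where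
  L : Tid → Option (P.Node × LState P.loc)
  M : P.Mutex → Option Tid
  G : P.glob.Val
  C : Tid → ℕ

namespace Machine

variable {P : Lang.{u}}

/-- The initial configuration. -/
def initial (P : Lang.{u}) : Machine P where
  L t := if t = [] then some (P.start P.main, P.initLoc) else none
  M _ := none
  G := P.glob.init
  C _ := 0

/-- The thread that `t` creates next. -/
def child (σ : Machine P) (t : Tid) : Tid := t ++ [σ.C t]

/-- The effect of a statement on the positions of the threads. -/
def moves (σ : Machine P) (t : Tid) (v : P.Node) (l : LState P.loc)
    (a : Stmt P.glob P.loc P.Mutex P.Templ) : Tid → Option (P.Node × LState P.loc) :=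
  match a with
  | .create T => Function.update (Function.update σ.L t (some (v, l))) (σ.child t)
      (some (P.start T, ⟨σ.child t, l.vars⟩))
  | _ => Function.update σ.L t (some (v, (a.eval (l, σ.G)).1))

/-- Thread `t` with local state `l` performs `a` and moves to `v`. -/
def step (σ : Machine P) (t : Tid) (v : P.Node) (l : LState P.loc)
    (a : Stmt P.glob P.loc P.Mutex P.Templ) : Machine P where
  L := σ.moves t v l a
  M := a.own t σ.M
  G := (a.eval (l, σ.G)).2
  C := a.count t σ.C

/-- Reachable configurations. -/
inductive Reach : Machine P → Prop
  | init : Reach (initial P)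
  | step {σ : Machine P} {t : Tid} {u v : P.Node} {l : LState P.loc}
      {a : Stmt P.glob P.loc P.Mutex P.Templ} (hσ : Reach σ) (hL : σ.L t = some (u, l))
      (hedge : P.edge u v = some a) (hadm : a.Admissible t l σ.M) : Reach (σ.step t v l a)

/-- Some thread is about to perform an assertion that is false. -/
def Bad (σ : Machine P) : Prop :=
  ∃ t u v l p, σ.L t = some (u, l) ∧ P.edge u v = some (.simple (.assert p)) ∧ p l = false

theorem child_ne (σ : Machine P) (t : Tid) : σ.child t ≠ t := by simp [child]

theorem moves_self (σ : Machine P) (t : Tid) (v : P.Node) (l : LState P.loc)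
    (a : Stmt P.glob P.loc P.Mutex P.Templ) :
    σ.moves t v l a t = some (v, (a.eval (l, σ.G)).1) := by
  unfold moves
  split
  · rw [Function.update_of_ne (σ.child_ne t).symm]
    simp [Stmt.eval]
  · simp

theorem moves_create (σ : Machine P) (t : Tid) (v : P.Node) (l : LState P.loc) (T : P.Templ) :
    σ.moves t v l (.create T) (σ.child t) = some (P.start T, ⟨σ.child t, l.vars⟩) := by
  simp [moves]

theorem moves_of_ne (σ : Machine P) {t t' : Tid} (v : P.Node) (l : LState P.loc)
    (a : Stmt P.glob P.loc P.Mutex P.Templ) (hne : t' ≠ t)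
    (hc : (∃ T, a = .create T) → t' ≠ σ.child t) : σ.moves t v l a t' = σ.L t' := by
  unfold moves
  split
  · rw [Function.update_of_ne (hc ⟨_, rfl⟩), Function.update_of_ne hne]
  · rw [Function.update_of_ne hne]

end Machine

/-- In every global trace of `P`, every access to a global `g` happens while holding `μ g`. -/
def Protected (P : Lang.{u}) (μ : P.glob.Name → P.Mutex) : Prop :=
  ∀ τ : RawTrace P, τ.IsGlobalTrace → ∀ t k u l v a g, τ.conf t k = some (u, l) →
    P.edge u v = some a → g ∈ a.accessed → τ.Holds t k (μ g)

end Machines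

/-! ### Extending and restricting global traces -/

section Extensions

/-- If `R'` adds to `R` only edges into an element without outgoing edges, then the reflexive
transitive closures agree on all other elements. -/
theorem reflTransGen_of_new_top {α : Type*} {R R' : α → α → Prop} {n : α}
    (hR : ∀ x y, R' x y → y ≠ n → R x y) (hn : ∀ y, ¬ R' n y) {x y : α}
    (h : Relation.ReflTransGen R' x y) (hy : y ≠ n) : Relation.ReflTransGen R x y := by
  induction h with
  | refl => exact .refl
  | @tail b c _ h2 ih =>
    refine (ih ?_).tail (hR _ _ h2 hy)
    rintro rfl
    exact hn _ h2

namespace RawTrace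

variable {P : Lang.{u}} {τ : RawTrace P}

theorem IsWrite.mem {g : P.glob.Name} {x : P.glob.Ty g} {w : Event} (hw : τ.IsWrite g x w) :
    τ.Mem w := by
  obtain ⟨t', k', l₁, l₂, f, rfl, h1, rfl⟩ := hw
  exact h1.performs.mem_succ

theorem Holds.congr {τ' : RawTrace P} {t : Tid} {k : ℕ} {m : P.Mutex}
    (hp : ∀ j, j < k → ∀ a, τ'.Performs t j a ↔ τ.Performs t j a) :
    τ'.Holds t k m ↔ τ.Holds t k m := by
  constructor
  · rintro ⟨j, hj, h1, h2⟩
    exact ⟨j, hj, (hp j hj _).1 h1, fun i hi hik h3 => h2 i hi hik ((hp i hik _).2 h3)⟩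
  · rintro ⟨j, hj, h1, h2⟩
    exact ⟨j, hj, (hp j hj _).2 h1, fun i hi hik h3 => h2 i hi hik ((hp i hik _).1 h3)⟩

theorem numCreates_congr {τ' : RawTrace P} {t : Tid} {k : ℕ}
    (hp : ∀ j, j < k → ∀ a, τ'.Performs t j a ↔ τ.Performs t j a) :
    τ'.numCreates t k = τ.numCreates t k := by
  classical
  unfold numCreates
  congr 1
  refine Finset.filter_congr fun j hj => ?_
  simp only [Finset.mem_range] at hj
  simp only [hp j hj]

theorem numCreates_succ_of_create {t : Tid} {k : ℕ} {T : P.Templ}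
    (hp : τ.Performs t k (.create T)) : τ.numCreates t (k + 1) = τ.numCreates t k + 1 := by
  classical
  unfold numCreates
  rw [Finset.range_add_one, Finset.filter_insert, if_pos ⟨T, hp⟩,
    Finset.card_insert_of_notMem (by simp)]

theorem numCreates_succ_of_not_create {t : Tid} {k : ℕ}
    (hp : ∀ T, ¬ τ.Performs t k (.create T)) : τ.numCreates t (k + 1) = τ.numCreates t k := by
  classical
  unfold numCreates
  rw [Finset.range_add_one, Finset.filter_insert, if_neg (by simpa using hp)]

theorem numCreates_mono (τ : RawTrace P) (t : Tid) : Monotone (τ.numCreates t) := by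
  classical
  intro j k hjk
  refine Finset.card_le_card (Finset.filter_subset_filter _ ?_)
  simpa using hjk

theorem numCreates_lt {t : Tid} {j k : ℕ} {T : P.Templ} (hp : τ.Performs t j (.create T))
    (hjk : j < k) : τ.numCreates t j < τ.numCreates t k := by
  have := τ.numCreates_mono t (show j + 1 ≤ k by omega)
  rw [numCreates_succ_of_create hp] at this
  omega

/-- A create order edge leads from the configuration at which the create action starts. -/
theorem IsGlobalTrace.createOrd_of_performs (h : τ.IsGlobalTrace) {t : Tid} {k : ℕ} {T : P.Templ}
    (hp : τ.Performs t k (.create T)) (hm : τ.Mem (t ++ [τ.numCreates t k], 0)) :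
    τ.createOrd (t, k) (t ++ [τ.numCreates t k], 0) := by
  obtain ⟨⟨t', k'⟩, he, -⟩ := h.created _ (by simp) hm
  obtain ⟨u, l, T', h1, h2, h3, -⟩ := h.create_spec _ _ he
  simp only [Prod.mk.injEq, List.append_singleton_inj, and_true] at h3
  obtain ⟨rfl, h3⟩ := h3
  have : k' = k := by
    rcases lt_trichotomy k' k with hlt | heq | hlt
    · rcases h2 with h2 | ⟨h2, -⟩
      · have := numCreates_lt h2 hlt
        simp only at this
        omega
      · exact absurd (h.mem_of_le_index (show k' + 1 ≤ k by omega) hp.mem) h2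
    · exact heq
    · have := numCreates_lt hp hlt
      omega
  rwa [this] at he

/-- The trace with a further step of thread `t` from `(t, k)` to the configuration `x`; if the step
locks a mutex, its predecessor in the lock order is `e₀`. -/
def extend (τ : RawTrace P) (t : Tid) (k : ℕ) (x : P.Node × LState P.loc)
    (a : Stmt P.glob P.loc P.Mutex P.Templ) (e₀ : Event) : RawTrace P where
  conf t' k' := if t' = t ∧ k' = k + 1 then some x else τ.conf t' k'
  createOrd := τ.createOrd
  lockOrd m e e' := τ.lockOrd m e e' ∨ (a = .lock m ∧ e = e₀ ∧ e' = (t, k + 1))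

/-- The conditions under which `RawTrace.extend` yields a global trace. -/
structure Extendable (τ : RawTrace P) (t : Tid) (k : ℕ) (u v : P.Node) (l l' : LState P.loc)
    (a : Stmt P.glob P.loc P.Mutex P.Templ) (e₀ : Event) : Prop where
  trace : τ.IsGlobalTrace
  conf : τ.conf t k = some (u, l)
  new : ¬ τ.Mem (t, k + 1)
  edge : P.edge u v = some a
  effect : τ.LocalEffect t k l a l'
  create : ∀ e, τ.createOrd (t, k) e → ∃ T, a = .create T ∧
    τ.conf e.1 e.2 = some (P.start T, ⟨e.1, l.vars⟩)
  lock : ∀ m, a = .lock m →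
    (e₀ = ([], 0) ∨ ∃ t k, e₀ = (t, k + 1) ∧ τ.Performs t k (.unlock m)) ∧
    ∀ e, ¬ τ.lockOrd m e₀ e
  unlock : ∀ m, a = .unlock m → τ.Holds t k m

theorem conf_extend (τ : RawTrace P) {t : Tid} {k : ℕ} (x : P.Node × LState P.loc)
    (a : Stmt P.glob P.loc P.Mutex P.Templ) (e₀ : Event) {e : Event} (he : e ≠ (t, k + 1)) :
    (τ.extend t k x a e₀).conf e.1 e.2 = τ.conf e.1 e.2 := by
  simp only [extend]
  rw [if_neg]
  rintro ⟨h1, h2⟩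
  exact he (Prod.ext h1 h2)

theorem conf_extend_new (τ : RawTrace P) (t : Tid) (k : ℕ) (x : P.Node × LState P.loc)
    (a : Stmt P.glob P.loc P.Mutex P.Templ) (e₀ : Event) :
    (τ.extend t k x a e₀).conf t (k + 1) = some x := by
  simp [extend]

theorem mem_extend {t : Tid} {k : ℕ} {x : P.Node × LState P.loc}
    {a : Stmt P.glob P.loc P.Mutex P.Templ} {e₀ e : Event} :
    (τ.extend t k x a e₀).Mem e ↔ τ.Mem e ∨ e = (t, k + 1) := by
  by_cases he : e = (t, k + 1)
  · subst he
    simp [Mem, conf_extend_new]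
  · simp [Mem, τ.conf_extend x a e₀ he, he]

theorem le_extend {t : Tid} {k : ℕ} {x : P.Node × LState P.loc}
    {a : Stmt P.glob P.loc P.Mutex P.Templ} {e₀ e e' : Event} (hle : τ.Le e e') :
    (τ.extend t k x a e₀).Le e e' := by
  refine Relation.ReflTransGen.mono (fun x y h1 => ?_) _ _ hle
  rcases h1 with h1 | h1 | ⟨m, h1⟩
  · exact .inl ⟨mem_extend.2 (.inl h1.1), mem_extend.2 (.inl h1.2.1), h1.2.2⟩
  · exact .inr (.inl h1)
  · exact .inr (.inr ⟨m, .inl h1⟩)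

/-! ### Appending a step to a global trace -/

namespace Extendable

variable {t : Tid} {k : ℕ} {u v : P.Node} {l l' : LState P.loc}
  {a : Stmt P.glob P.loc P.Mutex P.Templ} {e₀ : Event}
  (h : τ.Extendable t k u v l l' a e₀)
include h

theorem mem_old : τ.Mem (t, k) := by simp [Mem, h.conf]

theorem ne_new {e : Event} (he : τ.Mem e) : e ≠ (t, k + 1) := by
  rintro rfl
  exact h.new he

theorem isStep_new : (τ.extend t k (v, l') a e₀).IsStep t k l a l' :=
  ⟨u, v, by rw [τ.conf_extend (v, l') a e₀ (e := (t, k)) (by simp), h.conf], τ.conf_extend_new t k (v, l') a e₀, h.edge⟩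

theorem isStep_extend {t' : Tid} {k' : ℕ} {l₁ l₂ : LState P.loc}
    {b : Stmt P.glob P.loc P.Mutex P.Templ} :
    (τ.extend t k (v, l') a e₀).IsStep t' k' l₁ b l₂ ↔
      τ.IsStep t' k' l₁ b l₂ ∨ (t' = t ∧ k' = k ∧ l₁ = l ∧ b = a ∧ l₂ = l') := by
  by_cases he : ((t', k') : Event) = (t, k)
  · obtain ⟨rfl, rfl⟩ := Prod.mk.inj he
    constructor
    · intro hs
      obtain ⟨rfl, rfl, rfl⟩ := hs.unique h.isStep_new
      simp
    · rintro (hs | ⟨-, -, rfl, rfl, rfl⟩)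
      · exact absurd hs.performs.mem_succ h.new
      · exact h.isStep_new
  · have h2 : ((t', k' + 1) : Event) ≠ (t, k + 1) := by simpa using he
    have hno : ¬ (t' = t ∧ k' = k ∧ l₁ = l ∧ b = a ∧ l₂ = l') := by
      rintro ⟨rfl, rfl, -⟩
      exact he rfl
    have h3 := τ.conf_extend (v, l') a e₀ h2
    simp only at h3
    simp only [hno, or_false]
    by_cases h1 : ((t', k') : Event) = (t, k + 1)
    · obtain ⟨rfl, rfl⟩ := Prod.mk.inj h1
      constructor
      · rintro ⟨u', v', -, h5, -⟩
        rw [h3] at h5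
        refine absurd (h.trace.mem_of_le_index (Nat.le_succ (k + 1)) ?_) h.new
        simp [Mem, h5]
      · intro hs
        exact absurd hs.performs.mem h.new
    · have h4 := τ.conf_extend (v, l') a e₀ h1
      simp only at h4
      simp [IsStep, h3, h4]

theorem performs_extend {t' : Tid} {k' : ℕ} {b : Stmt P.glob P.loc P.Mutex P.Templ} :
    (τ.extend t k (v, l') a e₀).Performs t' k' b ↔
      τ.Performs t' k' b ∨ (t' = t ∧ k' = k ∧ b = a) := by
  simp only [Performs, h.isStep_extend]
  constructor
  · rintro ⟨l₁, l₂, h1 | ⟨rfl, rfl, rfl, rfl, rfl⟩⟩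
    · exact .inl ⟨_, _, h1⟩
    · simp
  · rintro (⟨l₁, l₂, h1⟩ | ⟨rfl, rfl, rfl⟩)
    · exact ⟨_, _, .inl h1⟩
    · exact ⟨l, l', by simp⟩

theorem performs_extend_of_mem {t' : Tid} {k' : ℕ} (hm : τ.Mem (t', k')) :
    ∀ j, j < k' → ∀ b, (τ.extend t k (v, l') a e₀).Performs t' j b ↔ τ.Performs t' j b := by
  intro j hj b
  rw [h.performs_extend, or_iff_left]
  rintro ⟨rfl, rfl, -⟩
  exact h.new (h.trace.mem_of_le_index hj hm)

theorem le_new : (τ.extend t k (v, l') a e₀).Le (t, k) (t, k + 1) :=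
  .single (.inl ⟨mem_extend.2 (.inl h.mem_old), mem_extend.2 (.inr rfl), rfl⟩)

/-- The new event is maximal, so the causality order between old events does not change. -/
theorem not_edge_new (e : Event) : ¬ ((τ.extend t k (v, l') a e₀).ProgOrd (t, k + 1) e ∨
    (τ.extend t k (v, l') a e₀).createOrd (t, k + 1) e ∨
    ∃ m, (τ.extend t k (v, l') a e₀).lockOrd m (t, k + 1) e) := by
  rintro (h1 | h1 | ⟨m, h1 | ⟨h0, h1, rfl⟩⟩)
  · obtain ⟨h1, h2, rfl⟩ := h1
    rcases mem_extend.1 h2 with h2 | h2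
    · exact h.new (h.trace.mem_of_le_index (Nat.le_succ (k + 1)) h2)
    · simp at h2
  · exact h.new (h.trace.createOrd_mem h1).1
  · exact h.new (h.trace.lockOrd_mem h1).1
  · rcases (h.lock m h0).1 with h2 | ⟨t', k', h2, h3⟩
    · simp [← h1] at h2
    · rw [← h1] at h2
      simp only [Prod.mk.injEq, Nat.add_right_cancel_iff] at h2
      obtain ⟨rfl, rfl⟩ := h2
      exact h.new h3.mem_succ

theorem eq_of_new_le {e : Event} (hle : (τ.extend t k (v, l') a e₀).Le (t, k + 1) e) :
    e = (t, k + 1) := by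
  rcases Relation.ReflTransGen.cases_head hle with h1 | ⟨x, h1, -⟩
  · exact h1.symm
  · exact absurd h1 (h.not_edge_new x)

theorem le_of_le_extend {e e' : Event} (hle : (τ.extend t k (v, l') a e₀).Le e e')
    (he : e' ≠ (t, k + 1)) : τ.Le e e' := by
  refine reflTransGen_of_new_top ?_ h.not_edge_new hle he
  rintro x y (h1 | h1 | ⟨m, h1⟩) hy
  · have h2 := (mem_extend.1 h1.2.1).resolve_right hy
    refine .inl ⟨(mem_extend.1 h1.1).resolve_right ?_, h2, h1.2.2⟩
    rintro rfl
    rw [h1.2.2] at h2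
    exact h.new (h.trace.mem_of_le_index (Nat.le_succ (k + 1)) h2)
  · exact .inr (.inl h1)
  · exact .inr (.inr ⟨m, h1.resolve_right fun h2 => hy h2.2.2⟩)

theorem isWrite_extend {g : P.glob.Name} {x : P.glob.Ty g} {w : Event} :
    (τ.extend t k (v, l') a e₀).IsWrite g x w ↔ τ.IsWrite g x w ∨
      (w = (t, k + 1) ∧ ∃ f, a = .simple (.write g f) ∧ x = f l) := by
  simp only [IsWrite, h.isStep_extend]
  constructor
  · rintro ⟨t', k', l₁, l₂, f, rfl, h1 | ⟨rfl, rfl, rfl, rfl, rfl⟩, rfl⟩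
    · exact .inl ⟨_, _, _, _, _, rfl, h1, rfl⟩
    · exact .inr ⟨rfl, f, rfl, rfl⟩
  · rintro (⟨t', k', l₁, l₂, f, rfl, h1, rfl⟩ | ⟨rfl, f, rfl, rfl⟩)
    · exact ⟨_, _, _, _, _, rfl, .inl h1, rfl⟩
    · exact ⟨t, k, l, l', f, rfl, .inr ⟨rfl, rfl, rfl, rfl, rfl⟩, rfl⟩

/-- Sets of old events have the same last writes in the extended trace. -/
theorem lastValue_extend {S : Event → Prop} {g : P.glob.Name} {x : P.glob.Ty g}
    (hS : ¬ S (t, k + 1)) (hx : τ.LastValue S g x) :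
    (τ.extend t k (v, l') a e₀).LastValue S g x := by
  have key : ∀ y w, (τ.extend t k (v, l') a e₀).IsWrite g y w → S w → τ.IsWrite g y w := by
    intro y w hw hSw
    refine (h.isWrite_extend.1 hw).resolve_right ?_
    rintro ⟨rfl, -⟩
    exact hS hSw
  rcases hx with ⟨w, h1, h2, h3⟩ | ⟨h1, h2⟩
  · exact .inl ⟨w, h.isWrite_extend.2 (.inl h1), h2,
      fun y w' h4 h5 => le_extend (h3 y w' (key _ _ h4 h5) h5)⟩
  · exact .inr ⟨fun y w h4 h5 => h1 y w (key _ _ h4 h5) h5, h2⟩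

/-- The value of an old read stays the same, because the new event is not below any old one. -/
theorem localEffect_extend {t' : Tid} {k' : ℕ} {l₁ l₂ : LState P.loc}
    {b : Stmt P.glob P.loc P.Mutex P.Templ} (hm : τ.Mem (t', k'))
    (hb : τ.LocalEffect t' k' l₁ b l₂) :
    (τ.extend t k (v, l') a e₀).LocalEffect t' k' l₁ b l₂ := by
  unfold LocalEffect at hb ⊢
  split at hb <;> try exact hb
  obtain ⟨x, hx, rfl⟩ := hb
  refine ⟨x, ?_, rfl⟩
  rw [readsValue_iff] at hx ⊢
  refine LastValue.congr (S := fun w => τ.Le w (t', k')) ?_ (h.lastValue_extend ?_ hx)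
  · intro y w hw
    exact ⟨le_extend, fun h1 => h.le_of_le_extend h1 (h.ne_new hm)⟩
  · intro hle
    exact h.new (h.trace.mem_of_le hle hm)

theorem isGlobalTrace : (τ.extend t k (v, l') a e₀).IsGlobalTrace where
  finite := (h.trace.finite.insert (t, k + 1)).subset fun e he => by
    rcases mem_extend.1 he with h1 | h1
    · exact .inr h1
    · exact .inl h1
  init := by
    rw [← h.trace.init]
    exact τ.conf_extend (v, l') a e₀ (e := ([], 0)) (by simp)
  path := by
    intro t' k' hm
    rcases mem_extend.1 hm with h1 | h1
    · obtain ⟨l₁, b, l₂, hs⟩ := h.trace.path _ _ h1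
      exact ⟨l₁, b, l₂, h.isStep_extend.2 (.inl hs)⟩
    · simp only [Prod.mk.injEq, Nat.add_right_cancel_iff] at h1
      obtain ⟨rfl, rfl⟩ := h1
      exact ⟨_, _, _, h.isStep_new⟩
  effect := by
    intro t' k' l₁ b l₂ hs
    rcases h.isStep_extend.1 hs with h1 | ⟨rfl, rfl, rfl, rfl, rfl⟩
    · exact h.localEffect_extend h1.performs.mem (h.trace.effect _ _ _ _ _ h1)
    · exact h.localEffect_extend h.mem_old h.effect
  antisymm := by
    intro e e' h1 h2
    by_cases he : e = (t, k + 1)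
    · subst he
      exact (h.eq_of_new_le h1).symm
    · by_cases he' : e' = (t, k + 1)
      · subst he'
        exact absurd (h.eq_of_new_le h2) he
      · exact h.trace.antisymm _ _ (h.le_of_le_extend h1 he') (h.le_of_le_extend h2 he)
  least := by
    intro e he
    rcases mem_extend.1 he with h1 | rfl
    · exact le_extend (h.trace.least _ h1)
    · exact (le_extend (h.trace.least _ h.mem_old)).trans h.le_new
  create_spec := by
    intro e e' hc
    have hm := h.trace.createOrd_mem hc
    obtain ⟨u', l₁, T, h1, h2, h3, h4⟩ := h.trace.create_spec _ _ hc
    have hnum : e' = (e.1 ++ [(τ.extend t k (v, l') a e₀).numCreates e.1 e.2], 0) := by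
      rw [numCreates_congr (h.performs_extend_of_mem (k' := e.2) hm.1), h3]
    -- The new step may be the create step that was still missing for an existing create edge; this
    -- is what the field `create` of `Extendable` is for.
    by_cases he : e = (t, k)
    · subst he
      obtain ⟨T', ha, h5⟩ := h.create _ hc
      refine ⟨u, l, T', ?_, .inl (ha ▸ h.isStep_new.performs), hnum, ?_⟩
      · rw [τ.conf_extend (v, l') a e₀ (h.ne_new hm.1), h.conf]
      · rw [τ.conf_extend (v, l') a e₀ (h.ne_new hm.2), h5]
    · refine ⟨u', l₁, T, ?_, ?_, hnum, ?_⟩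
      · rw [τ.conf_extend (v, l') a e₀ (h.ne_new hm.1), h1]
      · rcases h2 with h2 | ⟨h2, v', h5⟩
        · exact .inl (h.performs_extend.2 (.inl h2))
        · refine .inr ⟨fun h6 => ?_, v', h5⟩
          rcases mem_extend.1 h6 with h6 | h6
          · exact h2 h6
          · simp only [Prod.mk.injEq, Nat.add_right_cancel_iff] at h6
            exact he (Prod.ext h6.1 h6.2)
      · rw [τ.conf_extend (v, l') a e₀ (h.ne_new hm.2), h4]
  created := by
    intro t' ht' hm
    refine h.trace.created t' ht' ((mem_extend.1 hm).resolve_right (by simp))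
  create_unique := h.trace.create_unique
  lock_spec := by
    rintro m e e' (h1 | ⟨rfl, rfl, rfl⟩)
    · obtain ⟨h2, t', k', h3, h4⟩ := h.trace.lock_spec _ _ _ h1
      refine ⟨h2.imp_right ?_, t', k', h3, h.performs_extend.2 (.inl h4)⟩
      rintro ⟨t₁, k₁, h5, h6⟩
      exact ⟨t₁, k₁, h5, h.performs_extend.2 (.inl h6)⟩
    · refine ⟨(h.lock m rfl).1.imp_right ?_, t, k, rfl, h.isStep_new.performs⟩
      rintro ⟨t₁, k₁, h5, h6⟩
      exact ⟨t₁, k₁, h5, h.performs_extend.2 (.inl h6)⟩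
  lock_pred := by
    intro m t' k' hp
    rcases h.performs_extend.1 hp with h1 | ⟨rfl, rfl, rfl⟩
    · obtain ⟨e, he, hu⟩ := h.trace.lock_pred _ _ _ h1
      refine ⟨e, .inl he, ?_⟩
      rintro e' (h2 | ⟨-, -, h2⟩)
      · exact hu _ h2
      · exact absurd h2 (h.ne_new h1.mem_succ)
    · refine ⟨e₀, .inr ⟨rfl, rfl, rfl⟩, ?_⟩
      rintro e' (h2 | ⟨-, rfl, -⟩)
      · exact absurd (h.trace.lockOrd_mem h2).2 h.new
      · rfl
  lock_succ := by
    rintro m e e' e'' (h1 | ⟨h1, rfl, rfl⟩) (h2 | ⟨h2, h3, rfl⟩)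
    · exact h.trace.lock_succ _ _ _ _ h1 h2
    · exact absurd (h3 ▸ h1) ((h.lock m h2).2 _)
    · exact absurd h2 ((h.lock m h1).2 _)
    · rfl
  unlock_holds := by
    intro t' k' m hp
    have key : τ.Mem (t', k') → τ.Holds t' k' m →
        (τ.extend t k (v, l') a e₀).Holds t' k' m := fun hm =>
      (Holds.congr (h.performs_extend_of_mem hm)).2
    rcases h.performs_extend.1 hp with h1 | ⟨rfl, rfl, rfl⟩
    · exact key h1.mem (h.trace.unlock_holds _ _ _ h1)
    · exact key h.mem_old (h.unlock m rfl)

end Extendable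

/-- The trace with a further thread, created by step number `k` of `p`, with initial configuration
`x`. -/
def spawn (τ : RawTrace P) (p : Tid) (k : ℕ) (x : P.Node × LState P.loc) : RawTrace P where
  conf t' k' := if t' = p ++ [τ.numCreates p k] ∧ k' = 0 then some x else τ.conf t' k'
  createOrd e e' := τ.createOrd e e' ∨ (e = (p, k) ∧ e' = (p ++ [τ.numCreates p k], 0))
  lockOrd := τ.lockOrd

/-- The conditions under which `RawTrace.spawn` yields a global trace. -/
structure Spawnable (τ : RawTrace P) (p : Tid) (k : ℕ) (u : P.Node) (l : LState P.loc)
    (T : P.Templ) : Prop where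
  trace : τ.IsGlobalTrace
  conf : τ.conf p k = some (u, l)
  performs : τ.Performs p k (.create T)
  new : ¬ τ.Mem (p ++ [τ.numCreates p k], 0)

theorem conf_spawn (τ : RawTrace P) {p : Tid} {k : ℕ} (x : P.Node × LState P.loc) {e : Event}
    (he : e ≠ (p ++ [τ.numCreates p k], 0)) : (τ.spawn p k x).conf e.1 e.2 = τ.conf e.1 e.2 := by
  simp only [spawn]
  rw [if_neg]
  rintro ⟨h1, h2⟩
  exact he (Prod.ext h1 h2)

theorem conf_spawn_new (τ : RawTrace P) (p : Tid) (k : ℕ) (x : P.Node × LState P.loc) :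
    (τ.spawn p k x).conf (p ++ [τ.numCreates p k]) 0 = some x := by
  simp [spawn]

theorem mem_spawn {p : Tid} {k : ℕ} {x : P.Node × LState P.loc} {e : Event} :
    (τ.spawn p k x).Mem e ↔ τ.Mem e ∨ e = (p ++ [τ.numCreates p k], 0) := by
  by_cases he : e = (p ++ [τ.numCreates p k], 0)
  · subst he
    simp [Mem, conf_spawn_new]
  · simp [Mem, τ.conf_spawn x he, he]

theorem le_spawn {p : Tid} {k : ℕ} {x : P.Node × LState P.loc} {e e' : Event} (hle : τ.Le e e') :
    (τ.spawn p k x).Le e e' := by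
  refine Relation.ReflTransGen.mono (fun y z h1 => ?_) _ _ hle
  rcases h1 with h1 | h1 | ⟨m, h1⟩
  · exact .inl ⟨mem_spawn.2 (.inl h1.1), mem_spawn.2 (.inl h1.2.1), h1.2.2⟩
  · exact .inr (.inl (.inl h1))
  · exact .inr (.inr ⟨m, h1⟩)

/-! ### Adding the first configuration of a created thread -/

namespace Spawnable

variable {p : Tid} {k : ℕ} {u : P.Node} {l : LState P.loc} {T : P.Templ}
  {x : P.Node × LState P.loc} (h : τ.Spawnable p k u l T)
include h

theorem ne_new {e : Event} (he : τ.Mem e) : e ≠ (p ++ [τ.numCreates p k], 0) := by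
  rintro rfl
  exact h.new he

theorem isStep_spawn {t : Tid} {j : ℕ} {l₁ l₂ : LState P.loc}
    {b : Stmt P.glob P.loc P.Mutex P.Templ} :
    (τ.spawn p k x).IsStep t j l₁ b l₂ ↔ τ.IsStep t j l₁ b l₂ := by
  have h2 := τ.conf_spawn (p := p) (k := k) x (e := (t, j + 1)) (by simp)
  simp only at h2
  by_cases h1 : ((t, j) : Event) = (p ++ [τ.numCreates p k], 0)
  · have h3 : ¬ τ.Mem (t, j + 1) := fun hm =>
      h.new (h1 ▸ h.trace.mem_of_le_index (Nat.le_succ j) hm)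
    constructor
    · rintro ⟨u', v', -, h5, -⟩
      rw [h2] at h5
      exact absurd (by simp [Mem, h5]) h3
    · intro hs
      exact absurd hs.performs.mem_succ h3
  · have h3 := τ.conf_spawn x h1
    simp only at h3
    simp [IsStep, h2, h3]

theorem performs_spawn {t : Tid} {j : ℕ} {b : Stmt P.glob P.loc P.Mutex P.Templ} :
    (τ.spawn p k x).Performs t j b ↔ τ.Performs t j b := by
  simp only [Performs, h.isStep_spawn]

theorem holds_spawn {t : Tid} {j : ℕ} {m : P.Mutex} :
    (τ.spawn p k x).Holds t j m ↔ τ.Holds t j m :=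
  Holds.congr fun _ _ _ => h.performs_spawn

theorem numCreates_spawn (t : Tid) (j : ℕ) :
    (τ.spawn p k x).numCreates t j = τ.numCreates t j :=
  numCreates_congr fun _ _ _ => h.performs_spawn

theorem isWrite_spawn {g : P.glob.Name} {y : P.glob.Ty g} {w : Event} :
    (τ.spawn p k x).IsWrite g y w ↔ τ.IsWrite g y w := by
  simp only [IsWrite, h.isStep_spawn]

theorem not_edge_new (e : Event) :
    ¬ ((τ.spawn p k x).ProgOrd (p ++ [τ.numCreates p k], 0) e ∨
      (τ.spawn p k x).createOrd (p ++ [τ.numCreates p k], 0) e ∨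
      ∃ m, (τ.spawn p k x).lockOrd m (p ++ [τ.numCreates p k], 0) e) := by
  rintro (h1 | (h1 | ⟨h1, rfl⟩) | ⟨m, h1⟩)
  · obtain ⟨h1, h2, rfl⟩ := h1
    rcases mem_spawn.1 h2 with h2 | h2
    · exact h.new (h.trace.mem_of_le_index (Nat.le_succ 0) h2)
    · simp at h2
  · exact h.new (h.trace.createOrd_mem h1).1
  · simp at h1
  · exact h.new (h.trace.lockOrd_mem h1).1

theorem eq_of_new_le {e : Event} (hle : (τ.spawn p k x).Le (p ++ [τ.numCreates p k], 0) e) :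
    e = (p ++ [τ.numCreates p k], 0) := by
  rcases Relation.ReflTransGen.cases_head hle with h1 | ⟨y, h1, -⟩
  · exact h1.symm
  · exact absurd h1 (h.not_edge_new y)

theorem le_of_le_spawn {e e' : Event} (hle : (τ.spawn p k x).Le e e')
    (he : e' ≠ (p ++ [τ.numCreates p k], 0)) : τ.Le e e' := by
  refine reflTransGen_of_new_top ?_ h.not_edge_new hle he
  rintro y z (h1 | h1 | ⟨m, h1⟩) hz
  · have h2 := (mem_spawn.1 h1.2.1).resolve_right hz
    refine .inl ⟨?_, h2, h1.2.2⟩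
    rw [h1.2.2] at h2
    exact h.trace.mem_of_le_index (Nat.le_succ _) h2
  · exact .inr (.inl (h1.resolve_right fun h2 => hz h2.2))
  · exact .inr (.inr ⟨m, h1⟩)

theorem lastValue_spawn {S : Event → Prop} {g : P.glob.Name} {y : P.glob.Ty g}
    (hy : τ.LastValue S g y) : (τ.spawn p k x).LastValue S g y := by
  rcases hy with ⟨w, h1, h2, h3⟩ | ⟨h1, h2⟩
  · exact .inl ⟨w, h.isWrite_spawn.2 h1, h2,
      fun z w' h4 h5 => le_spawn (h3 z w' (h.isWrite_spawn.1 h4) h5)⟩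
  · exact .inr ⟨fun z w h4 h5 => h1 z w (h.isWrite_spawn.1 h4) h5, h2⟩

theorem localEffect_spawn {t : Tid} {j : ℕ} {l₁ l₂ : LState P.loc}
    {b : Stmt P.glob P.loc P.Mutex P.Templ} (hm : τ.Mem (t, j))
    (hb : τ.LocalEffect t j l₁ b l₂) : (τ.spawn p k x).LocalEffect t j l₁ b l₂ := by
  unfold LocalEffect at hb ⊢
  split at hb <;> try exact hb
  obtain ⟨y, hy, rfl⟩ := hb
  refine ⟨y, ?_, rfl⟩
  rw [readsValue_iff] at hy ⊢
  refine LastValue.congr (S := fun w => τ.Le w (t, j)) ?_ (h.lastValue_spawn hy)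
  exact fun y w hw => ⟨le_spawn, fun h1 => h.le_of_le_spawn h1 (h.ne_new hm)⟩

/-- The id of the created thread is determined by its creator and the position, so an edge from `(p,
k)` would lead to the configuration that is new. -/
theorem createOrd_ne {e : Event} : ¬ τ.createOrd (p, k) e := by
  intro hc
  obtain ⟨u', l', T', -, -, rfl, -⟩ := h.trace.create_spec _ _ hc
  exact h.new (h.trace.createOrd_mem hc).2

theorem isGlobalTrace :
    (τ.spawn p k (P.start T, ⟨p ++ [τ.numCreates p k], l.vars⟩)).IsGlobalTrace where
  finite := (h.trace.finite.insert (p ++ [τ.numCreates p k], 0)).subset fun e he => by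
    rcases mem_spawn.1 he with h1 | h1
    · exact .inr h1
    · exact .inl h1
  init := by
    rw [← h.trace.init]
    exact τ.conf_spawn (e := ([], 0)) _ (by simp)
  path := by
    intro t j hm
    obtain ⟨l₁, b, l₂, hs⟩ := h.trace.path t j ((mem_spawn.1 hm).resolve_right (by simp))
    exact ⟨l₁, b, l₂, h.isStep_spawn.2 hs⟩
  effect := by
    intro t j l₁ b l₂ hs
    have h1 := h.isStep_spawn.1 hs
    exact h.localEffect_spawn h1.performs.mem (h.trace.effect _ _ _ _ _ h1)
  antisymm := by
    intro e e' h1 h2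
    by_cases he : e = (p ++ [τ.numCreates p k], 0)
    · subst he
      exact (h.eq_of_new_le h1).symm
    · by_cases he' : e' = (p ++ [τ.numCreates p k], 0)
      · subst he'
        exact absurd (h.eq_of_new_le h2) he
      · exact h.trace.antisymm _ _ (h.le_of_le_spawn h1 he') (h.le_of_le_spawn h2 he)
  least := by
    intro e he
    rcases mem_spawn.1 he with h1 | rfl
    · exact le_spawn (h.trace.least _ h1)
    · exact (le_spawn (h.trace.least _ h.performs.mem)).tail (.inr (.inl (.inr ⟨rfl, rfl⟩)))
  create_spec := by
    rintro e e' (hc | ⟨rfl, rfl⟩)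
    · have hm := h.trace.createOrd_mem hc
      obtain ⟨u', l₁, T', h1, h2, h3, h4⟩ := h.trace.create_spec _ _ hc
      refine ⟨u', l₁, T', ?_, ?_, ?_, ?_⟩
      · rw [τ.conf_spawn _ (h.ne_new hm.1), h1]
      · refine h2.imp h.performs_spawn.2 (And.imp_left fun h5 h6 => ?_)
        exact h5 ((mem_spawn.1 h6).resolve_right (by simp))
      · rw [h.numCreates_spawn, h3]
      · rw [τ.conf_spawn _ (h.ne_new hm.2), h4]
    · refine ⟨u, l, T, ?_, .inl (h.performs_spawn.2 h.performs), ?_, ?_⟩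
      · rw [τ.conf_spawn _ (h.ne_new h.performs.mem), h.conf]
      · rw [h.numCreates_spawn]
      · exact τ.conf_spawn_new _ _ _
  created := by
    intro t ht hm
    rcases mem_spawn.1 hm with h1 | h1
    · obtain ⟨e, he, hu⟩ := h.trace.created t ht h1
      refine ⟨e, .inl he, ?_⟩
      rintro e' (h2 | ⟨-, h2⟩)
      · exact hu _ h2
      · exact absurd h2 (h.ne_new h1)
    · refine ⟨(p, k), .inr ⟨rfl, h1⟩, ?_⟩
      rintro e' (h2 | ⟨h2, -⟩)
      · exact absurd (h1 ▸ (h.trace.createOrd_mem h2).2) h.new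
      · exact h2
  create_unique := by
    rintro e e' e'' (h1 | ⟨rfl, rfl⟩) (h2 | ⟨h2, rfl⟩)
    · exact h.trace.create_unique _ _ _ h1 h2
    · exact absurd (h2 ▸ h1) h.createOrd_ne
    · exact absurd h2 h.createOrd_ne
    · rfl
  lock_spec := by
    simp only [h.performs_spawn]
    exact h.trace.lock_spec
  lock_pred := by
    simp only [h.performs_spawn]
    exact h.trace.lock_pred
  lock_succ := h.trace.lock_succ
  unlock_holds := by
    simp only [h.performs_spawn, h.holds_spawn]
    exact h.trace.unlock_holds

end Spawnable

open Classical in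
/-- The part of a trace below an event. -/
def below (τ : RawTrace P) (e₀ : Event) : RawTrace P where
  conf t k := if τ.Le (t, k) e₀ then τ.conf t k else none
  createOrd e e' := τ.createOrd e e' ∧ τ.Le e' e₀
  lockOrd m e e' := τ.lockOrd m e e' ∧ τ.Le e' e₀

/-! ### Restriction of a trace to the past of an event -/

section Below

variable {e₀ : Event}

theorem conf_below {e : Event} (he : τ.Le e e₀) : (τ.below e₀).conf e.1 e.2 = τ.conf e.1 e.2 :=
  if_pos he

theorem mem_below {e : Event} : (τ.below e₀).Mem e ↔ τ.Mem e ∧ τ.Le e e₀ := by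
  by_cases he : τ.Le e e₀
  · simp [Mem, conf_below he, he]
  · simp [Mem, below, he]

theorem isStep_below (h : τ.IsGlobalTrace) {t : Tid} {k : ℕ} {l l' : LState P.loc}
    {a : Stmt P.glob P.loc P.Mutex P.Templ} :
    (τ.below e₀).IsStep t k l a l' ↔ τ.IsStep t k l a l' ∧ τ.Le (t, k + 1) e₀ := by
  constructor
  · intro hs
    obtain ⟨-, h1⟩ := mem_below.1 hs.performs.mem_succ
    obtain ⟨-, h2⟩ := mem_below.1 hs.performs.mem
    obtain ⟨u, v, h3, h4, h5⟩ := hs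
    exact ⟨⟨u, v, conf_below h2 ▸ h3, conf_below h1 ▸ h4, h5⟩, h1⟩
  · rintro ⟨hs, h1⟩
    have h2 := (h.le_of_le_index (Nat.le_succ k) hs.performs.mem_succ).trans h1
    obtain ⟨u, v, h3, h4, h5⟩ := hs
    exact ⟨u, v, (conf_below h2).trans h3, (conf_below h1).trans h4, h5⟩

theorem performs_below (h : τ.IsGlobalTrace) {t : Tid} {k : ℕ}
    {a : Stmt P.glob P.loc P.Mutex P.Templ} :
    (τ.below e₀).Performs t k a ↔ τ.Performs t k a ∧ τ.Le (t, k + 1) e₀ := by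
  simp [Performs, isStep_below h]

theorem performs_below_of_mem (h : τ.IsGlobalTrace) {t : Tid} {k : ℕ}
    (hm : τ.Mem (t, k)) (hle : τ.Le (t, k) e₀) :
    ∀ j, j < k → ∀ a, (τ.below e₀).Performs t j a ↔ τ.Performs t j a := by
  intro j hj a
  rw [performs_below h, and_iff_left]
  exact (h.le_of_le_index hj hm).trans hle

theorem le_of_le_below {e e' : Event} (hle : (τ.below e₀).Le e e') : τ.Le e e' := by
  refine Relation.ReflTransGen.mono (fun y z h1 => ?_) _ _ hle
  rcases h1 with h1 | h1 | ⟨m, h1⟩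
  · exact .inl ⟨(mem_below.1 h1.1).1, (mem_below.1 h1.2.1).1, h1.2.2⟩
  · exact .inr (.inl h1.1)
  · exact .inr (.inr ⟨m, h1.1⟩)

theorem le_below {e e' : Event} (hle : τ.Le e e') (he : τ.Le e' e₀) : (τ.below e₀).Le e e' := by
  induction hle with
  | refl => exact .refl
  | @tail y z _ h2 ih =>
    have hy : τ.Le y e₀ := .head h2 he
    refine (ih hy).tail ?_
    rcases h2 with h1 | h1 | ⟨m, h1⟩
    · exact .inl ⟨mem_below.2 ⟨h1.1, hy⟩, mem_below.2 ⟨h1.2.1, he⟩, h1.2.2⟩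
    · exact .inr (.inl ⟨h1, he⟩)
    · exact .inr (.inr ⟨m, h1, he⟩)

theorem isWrite_below (h : τ.IsGlobalTrace) {g : P.glob.Name} {x : P.glob.Ty g} {w : Event} :
    (τ.below e₀).IsWrite g x w ↔ τ.IsWrite g x w ∧ τ.Le w e₀ := by
  simp only [IsWrite, isStep_below h]
  constructor
  · rintro ⟨t, k, l, l', f, rfl, ⟨h1, h2⟩, rfl⟩
    exact ⟨⟨t, k, l, l', f, rfl, h1, rfl⟩, h2⟩
  · rintro ⟨⟨t, k, l, l', f, rfl, h1, rfl⟩, h2⟩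
    exact ⟨t, k, l, l', f, rfl, ⟨h1, h2⟩, rfl⟩

theorem localEffect_below (h : τ.IsGlobalTrace) {t : Tid} {k : ℕ} {l l' : LState P.loc}
    {a : Stmt P.glob P.loc P.Mutex P.Templ} (he : τ.Le (t, k) e₀)
    (ha : τ.LocalEffect t k l a l') : (τ.below e₀).LocalEffect t k l a l' := by
  unfold LocalEffect at ha ⊢
  split at ha <;> try exact ha
  obtain ⟨y, hy, rfl⟩ := ha
  refine ⟨y, ?_, rfl⟩
  rcases hy with ⟨w, h1, h2, h3⟩ | ⟨h1, h2⟩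
  · refine .inl ⟨w, (isWrite_below h).2 ⟨h1, h2.trans he⟩, le_below h2 he, fun z w' h4 h5 => ?_⟩
    exact le_below (h3 z w' ((isWrite_below h).1 h4).1 (le_of_le_below h5)) (h2.trans he)
  · exact .inr ⟨fun z w h4 h5 => h1 z w ((isWrite_below h).1 h4).1 (le_of_le_below h5), h2⟩

/-- Downward closure preserves every clause that speaks about predecessors. Only create actions need
care, since their step is not a predecessor of the thread that they create. -/
theorem IsGlobalTrace.below (h : τ.IsGlobalTrace) (hm₀ : τ.Mem e₀) :
    (τ.below e₀).IsGlobalTrace where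
  finite := h.finite.subset fun e he => (mem_below.1 he).1
  init := (conf_below (e := ([], 0)) (h.least _ hm₀)).trans h.init
  path := by
    intro t k hm
    obtain ⟨h1, h2⟩ := mem_below.1 hm
    obtain ⟨l, a, l', hs⟩ := h.path t k h1
    exact ⟨l, a, l', (isStep_below h).2 ⟨hs, h2⟩⟩
  effect := by
    intro t k l a l' hs
    exact localEffect_below h (mem_below.1 hs.performs.mem).2
      (h.effect _ _ _ _ _ ((isStep_below h).1 hs).1)
  antisymm := fun e e' h1 h2 => h.antisymm _ _ (le_of_le_below h1) (le_of_le_below h2)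
  least := by
    intro e he
    obtain ⟨h1, h2⟩ := mem_below.1 he
    exact le_below (h.least _ h1) h2
  create_spec := by
    rintro e e' ⟨hc, hle⟩
    obtain ⟨u, l, T, h1, h2, h3, h4⟩ := h.create_spec _ _ hc
    have he : τ.Le e e₀ := .head (.inr (.inl hc)) hle
    refine ⟨u, l, T, (conf_below he).trans h1, ?_, ?_, (conf_below hle).trans h4⟩
    · by_cases h5 : (τ.below e₀).Mem (e.1, e.2 + 1)
      · obtain ⟨h6, h7⟩ := mem_below.1 h5
        exact .inl ((performs_below h).2 ⟨h2.resolve_right fun h8 => h8.1 h6, h7⟩)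
      -- The create step has been cut off while its thread has been kept. The second alternative of
      -- `create_spec` allows exactly this.
      · refine .inr ⟨h5, ?_⟩
        rcases h2 with ⟨l₁, l₂, u', v, h6, h7, h8⟩ | h2
        · rw [h1] at h6
          simp only [Option.some.injEq, Prod.mk.injEq] at h6
          rw [h6.1]
          exact ⟨v, h8⟩
        · exact h2.2
    · rw [numCreates_congr (performs_below_of_mem h (h.createOrd_mem hc).1 he), h3]
  created := by
    intro t ht hm
    obtain ⟨h1, h2⟩ := mem_below.1 hm
    obtain ⟨e, he, hu⟩ := h.created t ht h1
    exact ⟨e, ⟨he, h2⟩, fun e' he' => hu _ he'.1⟩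
  create_unique := fun e e' e'' h1 h2 => h.create_unique _ _ _ h1.1 h2.1
  lock_spec := by
    rintro m e e' ⟨hl, hle⟩
    have he : τ.Le e e₀ := .head (.inr (.inr ⟨m, hl⟩)) hle
    obtain ⟨h1, t', k', rfl, h2⟩ := h.lock_spec _ _ _ hl
    refine ⟨h1.imp_right ?_, t', k', rfl, (performs_below h).2 ⟨h2, hle⟩⟩
    rintro ⟨t, k, rfl, h3⟩
    exact ⟨t, k, rfl, (performs_below h).2 ⟨h3, he⟩⟩
  lock_pred := by
    intro m t k hp
    obtain ⟨h1, h2⟩ := (performs_below h).1 hp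
    obtain ⟨e, he, hu⟩ := h.lock_pred _ _ _ h1
    exact ⟨e, ⟨he, h2⟩, fun e' he' => hu _ he'.1⟩
  lock_succ := fun m e e' e'' h1 h2 => h.lock_succ _ _ _ _ h1.1 h2.1
  unlock_holds := by
    intro t k m hp
    obtain ⟨h1, -⟩ := (performs_below h).1 hp
    exact (Holds.congr (performs_below_of_mem h h1.mem (mem_below.1 hp.mem).2)).2
      (h.unlock_holds _ _ _ h1)

theorem IsGlobalTrace.isLocalTrace_below (h : τ.IsGlobalTrace) (hm₀ : τ.Mem e₀) :
    (τ.below e₀).IsLocalTrace := by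
  refine ⟨h.below hm₀, e₀, ⟨mem_below.2 ⟨hm₀, .refl⟩, fun e he hle => ?_⟩, fun e he => ?_⟩
  · exact h.antisymm _ _ (mem_below.1 he).2 (le_of_le_below hle)
  · obtain ⟨h1, h2⟩ := mem_below.1 he.1
    exact (he.2 e₀ (mem_below.2 ⟨hm₀, .refl⟩) (le_below h2 .refl)).symm

end Below

end RawTrace

end Extensions

/-! ### Local traces and reachable configurations -/

section TracesVsMachines

section Statements

variable {G X : Decls.{u}} {M T : Type u}

theorem Stmt.eval_snd (a : Stmt G X M T) (l : LState X) (x : G.Val) (g : G.Name) :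
    (∃ f, a = .simple (.write g f) ∧ (a.eval (l, x)).2 g = f l) ∨
      ((∀ f, a ≠ .simple (.write g f)) ∧ (a.eval (l, x)).2 g = x g) := by
  rcases a with (_ | _ | ⟨g', f⟩ | _) | _ | _ | _ | _ | _ <;> try exact .inr ⟨by simp, rfl⟩
  by_cases hg : g = g'
  · subst hg
    exact .inl ⟨f, rfl, by simp [Stmt.eval]⟩
  · refine .inr ⟨fun f' hf => hg ?_, by simp [Stmt.eval, hg]⟩
    simp only [Stmt.simple.injEq, SimpleStmt.write.injEq] at hf
    exact hf.1.symm

/-- An ownership function that agrees with a holding relation does so after every admissible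
statement. -/
theorem Stmt.own_eq_some_iff {a : Stmt G X M T} {t : Tid} {l : LState X} {own : M → Option Tid}
    {H H' : Tid → M → Prop} (hown : ∀ m t', own m = some t' ↔ H t' m)
    (hadm : a.Admissible t l own)
    (hself : ∀ m, H' t m ↔ a = .lock m ∨ (H t m ∧ a ≠ .unlock m))
    (hother : ∀ t' m, t' ≠ t → (H' t' m ↔ H t' m)) (m : M) (t' : Tid) :
    a.own t own m = some t' ↔ H' t' m := by
  classical
  have key : (∀ m', a ≠ .lock m') → (∀ m', a ≠ .unlock m') →
      (own m = some t' ↔ H' t' m) := by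
    intro h1 h2
    by_cases ht : t' = t
    · subst ht
      simp [hself, h1, h2, hown]
    · rw [hother _ _ ht, hown]
  cases a with
  | lock m' =>
    simp only [Stmt.Admissible] at hadm
    simp only [Stmt.own]
    by_cases hm : m = m'
    · subst hm
      by_cases ht : t' = t
      · subst ht
        simp [hself]
      · rw [hother _ _ ht, ← hown]
        simp [hadm, Ne.symm ht]
    · rw [Function.update_of_ne hm, hown]
      by_cases ht : t' = t
      · subst ht
        simp [hself, Ne.symm hm]
      · rw [hother _ _ ht]
  | unlock m' =>
    simp only [Stmt.Admissible] at hadm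
    simp only [Stmt.own]
    by_cases hm : m = m'
    · subst hm
      by_cases ht : t' = t
      · subst ht
        simp [hself]
      · rw [hother _ _ ht, ← hown]
        simp [hadm, Ne.symm ht]
    · rw [Function.update_of_ne hm, hown]
      by_cases ht : t' = t
      · subst ht
        simp [hself, Ne.symm hm]
      · rw [hother _ _ ht]
  | simple s => exact key (by simp) (by simp)
  | create T => exact key (by simp) (by simp)
  | pos c => exact key (by simp) (by simp)
  | neg c => exact key (by simp) (by simp)

end Statements

namespace RawTrace

variable {P : Lang.{u}} {τ : RawTrace P}

/-- This is the recursion that `Stmt.own` obeys, in the form required by `Stmt.own_eq_some_iff`. -/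
theorem holds_succ_iff {t : Tid} {k : ℕ} {a : Stmt P.glob P.loc P.Mutex P.Templ} {m : P.Mutex}
    (hp : τ.Performs t k a) :
    τ.Holds t (k + 1) m ↔ a = .lock m ∨ (τ.Holds t k m ∧ a ≠ .unlock m) := by
  constructor
  · rintro ⟨j, hj, h1, h2⟩
    rcases (Nat.lt_succ_iff_lt_or_eq.1 hj) with hlt | rfl
    · refine .inr ⟨⟨j, hlt, h1, fun i hi hik => h2 i hi (by omega)⟩, ?_⟩
      rintro rfl
      exact h2 k hlt (by omega) hp
    · exact .inl (hp.unique h1)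
  · rintro (rfl | ⟨⟨j, hj, h1, h2⟩, h3⟩)
    · exact ⟨k, by omega, hp, fun i hi hik => by omega⟩
    · refine ⟨j, by omega, h1, fun i hi hik h4 => ?_⟩
      rcases (Nat.lt_succ_iff_lt_or_eq.1 hik) with hlt | rfl
      · exact h2 i hi hlt h4
      · exact h3 (hp.unique h4)

theorem not_holds_zero {t : Tid} {m : P.Mutex} : ¬ τ.Holds t 0 m := by
  rintro ⟨j, hj, -⟩
  omega

theorem numCreates_zero (t : Tid) : τ.numCreates t 0 = 0 := by
  simp [numCreates]

theorem count_eq_numCreates {t : Tid} {k : ℕ} {a : Stmt P.glob P.loc P.Mutex P.Templ}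
    {C : Tid → ℕ} (hp : τ.Performs t k a) (hC : C t = τ.numCreates t k) :
    a.count t C t = τ.numCreates t (k + 1) := by
  by_cases ha : ∃ T, a = .create T
  · obtain ⟨T, rfl⟩ := ha
    simp [Stmt.count, numCreates_succ_of_create hp, hC]
  · rw [numCreates_succ_of_not_create fun T h => ha ⟨T, hp.unique h⟩, ← hC]
    unfold Stmt.count
    split
    · exact absurd ⟨_, rfl⟩ ha
    · rfl

theorem _root_.GhostWitness.Stmt.count_of_ne {G X : Decls.{u}} {M T : Type u} {t t' : Tid}
    (a : Stmt G X M T) (C : Tid → ℕ) (ht : t' ≠ t) : a.count t C t' = C t' := by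
  unfold Stmt.count
  split
  · rw [Function.update_of_ne ht]
  · rfl

/-- The local effect of a step is determined by the values of the accessed globals. -/
theorem LocalEffect.eq_eval {t : Tid} {k : ℕ} {l l' : LState P.loc}
    {a : Stmt P.glob P.loc P.Mutex P.Templ} {x : P.glob.Val} (h : τ.LocalEffect t k l a l')
    (hx : ∀ g y, g ∈ a.accessed → τ.ReadsValue g (t, k) y → y = x g) :
    l' = (a.eval (l, x)).1 := by
  rcases a with (_ | ⟨g, f⟩ | _ | _) | _ | _ | _ | _ | _ <;>
    simp only [LocalEffect] at h <;> try exact h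
  · obtain ⟨y, hy, rfl⟩ := h
    rw [hx g y (by simp [Stmt.accessed]) hy]
    rfl
  · exact h.2
  · exact h.2

theorem localEffect_eval {t : Tid} {k : ℕ} {l : LState P.loc} {own : P.Mutex → Option Tid}
    {a : Stmt P.glob P.loc P.Mutex P.Templ} {x : P.glob.Val} (ha : a.Admissible t l own)
    (hx : ∀ g, g ∈ a.accessed → τ.ReadsValue g (t, k) (x g)) :
    τ.LocalEffect t k l a (a.eval (l, x)).1 := by
  rcases a with (_ | ⟨g, f⟩ | _ | _) | _ | _ | _ | _ | _ <;> try exact rfl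
  · exact ⟨_, hx g (by simp [Stmt.accessed]), rfl⟩
  · exact ⟨ha, rfl⟩
  · exact ⟨ha, rfl⟩

/-- Writes before which `t` does not perform a step after the `k`-th are ordered before an access to
the same global by step number `k` of `t`. -/
theorem IsGlobalTrace.write_le (h : τ.IsGlobalTrace) {μ : P.glob.Name → P.Mutex}
    (hμ : Protected P μ) {t : Tid} {k : ℕ} {u v : P.Node} {l : LState P.loc}
    {a : Stmt P.glob P.loc P.Mutex P.Templ} (hconf : τ.conf t k = some (u, l))
    (hedge : P.edge u v = some a) {g : P.glob.Name} (hg : g ∈ a.accessed) {x : P.glob.Ty g}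
    {w : Event} (hw : τ.IsWrite g x w) (hcl : ∀ i, τ.Le (t, i + 1) w → i < k) :
    τ.Le w (t, k) := by
  obtain ⟨t', k', l₁, l₂, f, rfl, hs, rfl⟩ := hw
  have hs' := hs
  obtain ⟨u', v', h1, h2, h3⟩ := hs'
  exact h.le_of_holds (by simp [Mem, hconf]) (hμ τ h _ _ _ _ _ _ g hconf hedge hg)
    (hμ τ h _ _ _ _ _ _ g h1 h3 (by simp [Stmt.accessed])) hs.performs hcl

/-- All create actions from which the create order leads are performed. -/
def Complete (τ : RawTrace P) : Prop :=
  ∀ e e', τ.createOrd e e' → ∃ T, τ.Performs e.1 e.2 (.create T)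

/-- Create steps are never blocked, so the missing ones can be appended one at a time; the induction
is on their number. In a machine run a thread exists only after its create step, so a trace must
have all of these steps before it can be linearized. -/
theorem IsGlobalTrace.exists_complete : ∀ n, ∀ {τ : RawTrace P}, τ.IsGlobalTrace →
    {e : Event | (∃ e', τ.createOrd e e') ∧ ¬ τ.Mem (e.1, e.2 + 1)}.ncard = n →
    ∃ τ' : RawTrace P, τ'.IsGlobalTrace ∧ τ'.Complete ∧
      ∀ t k l a l', τ.IsStep t k l a l' → τ'.IsStep t k l a l' := by
  intro n
  induction n with
  | zero =>
    intro τ h hn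
    refine ⟨τ, h, fun e e' hc => ?_, fun _ _ _ _ _ hs => hs⟩
    rw [Set.ncard_eq_zero (h.finite.subset fun e he => ?_)] at hn
    · obtain ⟨u, l, T, -, h1 | h1, -⟩ := h.create_spec _ _ hc
      · exact ⟨T, h1⟩
      · exact absurd (show e ∈ (∅ : Set Event) from hn ▸ ⟨⟨e', hc⟩, h1.1⟩) (by simp)
    · obtain ⟨e', he'⟩ := he.1
      exact (h.createOrd_mem he').1
  | succ n ih =>
    intro τ h hn
    have hfin : {e : Event | (∃ e', τ.createOrd e e') ∧ ¬ τ.Mem (e.1, e.2 + 1)}.Finite :=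
      h.finite.subset fun e he => by
        obtain ⟨e', he'⟩ := he.1
        exact (h.createOrd_mem he').1
    obtain ⟨⟨t, k⟩, ⟨e', hc⟩, hm⟩ := Set.nonempty_of_ncard_ne_zero
      (s := {e : Event | (∃ e', τ.createOrd e e') ∧ ¬ τ.Mem (e.1, e.2 + 1)}) (by omega)
    obtain ⟨u, l, T, h1, h2, h3, h4⟩ := h.create_spec _ _ hc
    obtain ⟨-, v, h5⟩ := h2.resolve_left fun h6 => hm h6.mem_succ
    -- The lock predecessor `([], 0)` is a dummy, as the step is not a lock.
    have hext : τ.Extendable t k u v l l (.create T) ([], 0) :=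
      { trace := h
        conf := h1
        new := hm
        edge := h5
        effect := rfl
        create := fun e he => by
          obtain rfl := h.create_unique _ _ _ he hc
          exact ⟨T, rfl, h4⟩
        lock := by simp
        unlock := by simp }
    have hset : {e : Event | (∃ e', (τ.extend t k (v, l) (.create T) ([], 0)).createOrd e e') ∧
        ¬ (τ.extend t k (v, l) (.create T) ([], 0)).Mem (e.1, e.2 + 1)} =
        {e : Event | (∃ e', τ.createOrd e e') ∧ ¬ τ.Mem (e.1, e.2 + 1)} \ {(t, k)} := by
      ext ⟨t', k'⟩
      simp only [mem_extend, Set.mem_sdiff, Set.mem_ofPred_eq, Set.mem_singleton_iff, not_or,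
        Prod.mk.injEq, Nat.add_right_cancel_iff]
      exact and_assoc.symm
    have hcard := Set.ncard_sdiff_singleton_add_one
      (show (t, k) ∈ {e : Event | (∃ e', τ.createOrd e e') ∧ ¬ τ.Mem (e.1, e.2 + 1)} from
        ⟨⟨e', hc⟩, hm⟩) hfin
    obtain ⟨τ', h6, h7, h8⟩ := ih hext.isGlobalTrace (by rw [hset]; omega)
    exact ⟨τ', h6, h7, fun _ _ _ _ _ hs => h8 _ _ _ _ _ (hext.isStep_extend.2 (.inl hs))⟩

/-- After `c t'` steps of each thread `t'`, the thread `t` has been created. -/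
def Live (τ : RawTrace P) (c : Tid → ℕ) (t : Tid) : Prop :=
  t = [] ∨ ∃ p k, τ.createOrd (p, k) (t, 0) ∧ k < c p

/-- The event has happened after `c t` steps of each thread `t`. -/
def Done (τ : RawTrace P) (c : Tid → ℕ) (e : Event) : Prop := e.2 ≤ c e.1 ∧ τ.Live c e.1

/-- `σ` is the configuration after `c t` steps of each thread `t`. -/
structure Cut (τ : RawTrace P) (c : Tid → ℕ) (σ : Machine P) : Prop where
  mem : ∀ e, τ.Done c e → τ.Mem e
  closed : ∀ e e', τ.Done c e' → τ.Le e e' → τ.Done c e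
  live : ∀ t, c t ≠ 0 → τ.Live c t
  loc : ∀ t, τ.Live c t → σ.L t = τ.conf t (c t)
  mutex : ∀ m t, σ.M m = some t ↔ τ.Holds t (c t) m
  glob : ∀ g, τ.LastValue (τ.Done c) g (σ.G g)
  count : ∀ t, σ.C t = τ.numCreates t (c t)

theorem IsGlobalTrace.cut_initial (h : τ.IsGlobalTrace) : τ.Cut (fun _ => 0) (.initial P) := by
  have hlive : ∀ t, τ.Live (fun _ => 0) t ↔ t = [] := by simp [Live]
  have hdone : ∀ e, τ.Done (fun _ => 0) e ↔ e = ([], 0) := by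
    rintro ⟨t, k⟩
    simp [Done, hlive, and_comm]
  refine ⟨?_, ?_, ?_, ?_, ?_, ?_, ?_⟩
  · intro e he
    rw [(hdone e).1 he]
    exact h.mem_init
  · intro e e' he' hle
    rw [hdone] at he' ⊢
    subst he'
    exact h.antisymm _ _ hle (h.least _ (h.mem_of_le hle h.mem_init))
  · simp
  · intro t ht
    obtain rfl := (hlive t).1 ht
    simp [h.init, Machine.initial]
  · intro m t
    simp [Machine.initial, not_holds_zero]
  · intro g
    refine .inr ⟨fun y w hw hd => ?_, rfl⟩
    rw [hdone] at hd
    subst hd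
    obtain ⟨t, k, l, l', f, he, -⟩ := hw
    simp at he
  · intro t
    simp [Machine.initial, numCreates_zero]

/-- A cut that does not contain all events can be extended by a step. -/
theorem Cut.exists_next {c : Tid → ℕ} {σ : Machine P} (hc : τ.Cut c σ) (h : τ.IsGlobalTrace)
    (hcompl : τ.Complete) : ∀ n, ∀ {e : Event}, τ.rank e = n → τ.Mem e → ¬ τ.Done c e →
    ∃ t, τ.Live c t ∧ τ.Mem (t, c t + 1) ∧
      ∀ e, τ.Le e (t, c t + 1) → e = (t, c t + 1) ∨ τ.Done c e := by
  intro n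
  induction n using Nat.strong_induction_on with
  | _ n ih =>
    intro e hn hm hd
    -- Either the event is causally minimal among those that are not done, or one of smaller rank is
    -- considered instead.
    by_cases hmin : ∀ e', τ.Le e' e → e' = e ∨ τ.Done c e'
    · obtain ⟨t, k⟩ := e
      cases k with
      | succ k =>
        obtain ⟨h1, h2⟩ := (hmin (t, k) (h.le_of_le_index (Nat.le_succ k) hm)).resolve_left
          (by simp)
        have : c t = k := by
          by_contra hne
          simp only at h1
          exact hd ⟨by simp only; omega, h2⟩
        subst this
        exact ⟨t, h2, hm, hmin⟩
      -- The minimal event is the start of a thread. Its creator then waits right before the create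
      -- step, which belongs to the trace by completeness. This step is not a lock, so whatever
      -- precedes it precedes a done event.
      | zero =>
        have ht : t ≠ [] := by
          rintro rfl
          exact hd ⟨by simp, .inl rfl⟩
        obtain ⟨⟨p, k⟩, hcr, -⟩ := h.created t ht hm
        have hne : ((p, k) : Event) ≠ (t, 0) := by
          intro heq
          obtain ⟨u, l, T, -, -, h3, -⟩ := h.create_spec _ _ hcr
          rw [heq] at h3
          simp at h3
        have hle : τ.Le (p, k) (t, 0) := .single (.inr (.inl hcr))
        have hdone := (hmin _ hle).resolve_left hne
        obtain ⟨h1, h2⟩ := hdone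
        have : c p = k := by
          by_contra hne
          simp only at h1
          exact hd ⟨by simp, .inr ⟨p, k, hcr, by omega⟩⟩
        subst this
        obtain ⟨T, hp⟩ := hcompl _ _ hcr
        refine ⟨p, h2, hp.mem_succ, fun e' he' => ?_⟩
        by_cases heq : e' = (p, c p + 1)
        · exact .inl heq
        · right
          have h3 := h.le_of_le_succ hp (by simp) he' heq
          exact hc.closed _ _ ⟨h1, h2⟩ h3
    · push Not at hmin
      obtain ⟨e', h1, h2, h3⟩ := hmin
      exact ih _ (hn ▸ h.rank_lt h1 h2 hm) rfl (h.mem_of_le h1 hm) h3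

/-! ### Advancing a cut by one step -/

section Advance

variable {c : Tid → ℕ} {σ : Machine P} {t : Tid}

theorem live_update {t' : Tid} : τ.Live (Function.update c t (c t + 1)) t' ↔
    τ.Live c t' ∨ τ.createOrd (t, c t) (t', 0) := by
  unfold Live
  constructor
  · rintro (h1 | ⟨p, k, h1, h2⟩)
    · exact .inl (.inl h1)
    · by_cases hp : p = t
      · subst hp
        simp only [Function.update_self] at h2
        rcases Nat.lt_succ_iff_lt_or_eq.1 h2 with h2 | rfl
        · exact .inl (.inr ⟨p, k, h1, h2⟩)
        · exact .inr h1
      · rw [Function.update_of_ne hp] at h2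
        exact .inl (.inr ⟨p, k, h1, h2⟩)
  · rintro ((h1 | ⟨p, k, h1, h2⟩) | h1)
    · exact .inl h1
    · refine .inr ⟨p, k, h1, ?_⟩
      by_cases hp : p = t
      · subst hp
        simp only [Function.update_self]
        omega
      · rwa [Function.update_of_ne hp]
    · exact .inr ⟨t, c t, h1, by simp⟩

/-- Besides the configuration after the step, only the start of a thread created by the step can be
added. A create edge leaves the configuration before the create step, yet its target counts as done
only after that step. -/
theorem Cut.done_update (hc : τ.Cut c σ) (h : τ.IsGlobalTrace) (ht : τ.Live c t) {e : Event} :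
    τ.Done (Function.update c t (c t + 1)) e ↔
      τ.Done c e ∨ e = (t, c t + 1) ∨ τ.createOrd (t, c t) e := by
  obtain ⟨t', n⟩ := e
  simp only [Done, live_update]
  constructor
  · rintro ⟨h1, h2⟩
    by_cases htt : t' = t
    · subst htt
      simp only [Function.update_self] at h1
      rcases Nat.le_succ_iff.1 h1 with h1 | rfl
      · exact .inl ⟨h1, ht⟩
      · exact .inr (.inl rfl)
    · rw [Function.update_of_ne htt] at h1
      by_cases hl : τ.Live c t'
      · exact .inl ⟨h1, hl⟩
      · have h3 : c t' = 0 := by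
          by_contra h4
          exact hl (hc.live _ h4)
        obtain rfl : n = 0 := by omega
        exact .inr (.inr (h2.resolve_left hl))
  · rintro (⟨h1, h2⟩ | h1 | h1)
    · refine ⟨?_, .inl h2⟩
      by_cases htt : t' = t
      · subst htt
        simp only [Function.update_self]
        omega
      · rwa [Function.update_of_ne htt]
    · obtain ⟨rfl, rfl⟩ := Prod.mk.inj h1
      exact ⟨by simp, .inl ht⟩
    · obtain rfl : n = 0 := (h.createOrd_index h1).1
      exact ⟨by simp, .inr h1⟩

variable {l l' : LState P.loc} {a : Stmt P.glob P.loc P.Mutex P.Templ}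

theorem Cut.write_le (hc : τ.Cut c σ) (h : τ.IsGlobalTrace) {μ : P.glob.Name → P.Mutex}
    (hμ : Protected P μ) (hs : τ.IsStep t (c t) l a l') {g : P.glob.Name} (hg : g ∈ a.accessed)
    {x : P.glob.Ty g} {w : Event} (hw : τ.IsWrite g x w) (hd : τ.Done c w) :
    τ.Le w (t, c t) := by
  obtain ⟨u, v, h1, -, h2⟩ := hs
  exact h.write_le hμ h1 h2 hg hw fun i hi => (hc.closed _ _ hd hi).1

/-- Only a lock needs an argument. If some thread held the mutex, `lock_total` would put the end of
its critical section below the new lock, hence into the cut, or else a later step of `t` below an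
event of the cut. -/
theorem Cut.admissible (hc : τ.Cut c σ) (h : τ.IsGlobalTrace) (hs : τ.IsStep t (c t) l a l')
    (hlow : ∀ e, τ.Le e (t, c t + 1) → e = (t, c t + 1) ∨ τ.Done c e) :
    a.Admissible t l σ.M := by
  have heff := h.effect _ _ _ _ _ hs
  cases a with
  | lock m =>
    simp only [Stmt.Admissible]
    by_contra hne
    obtain ⟨t', ht'⟩ := Option.ne_none_iff_exists'.1 hne
    obtain ⟨j, hj, h1, h2⟩ := (hc.mutex _ _).1 ht'
    rcases h.lock_total h1 hs.performs with ⟨rfl, rfl⟩ | ⟨k, hk, h3, h4⟩ | ⟨k, hk, h3, h4⟩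
    · omega
    · rcases hlow _ h4 with h5 | h5
      · simp only [Prod.mk.injEq, Nat.add_right_cancel_iff] at h5
        obtain ⟨rfl, rfl⟩ := h5
        simpa using h3.unique hs.performs
      · exact h2 k hk h5.1 h3
    · have h5 : τ.Done c (t', j + 1) := ⟨hj, hc.live _ (Nat.ne_zero_of_lt hj)⟩
      have := (hc.closed _ _ h5 h4).1
      simp only at this
      omega
  | unlock m => exact (hc.mutex _ _).2 (h.unlock_holds _ _ _ hs.performs)
  | pos c => exact heff.1
  | neg c => exact heff.1
  | simple s => trivial
  | create T => trivial

/-- For an accessed global the writes in the cut are exactly those below `(t, c t)`, by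
`Cut.write_le` and closedness. So the value read in the trace is the one in the memory. -/
theorem Cut.eq_eval (hc : τ.Cut c σ) (h : τ.IsGlobalTrace) {μ : P.glob.Name → P.Mutex}
    (hμ : Protected P μ) (ht : τ.Live c t) (hs : τ.IsStep t (c t) l a l') :
    l' = (a.eval (l, σ.G)).1 := by
  refine (h.effect _ _ _ _ _ hs).eq_eval fun g y hg hy => ?_
  refine h.lastValue_unique hy ((hc.glob g).congr fun z w hw => ⟨hc.write_le h hμ hs hg hw, ?_⟩)
  exact hc.closed _ _ ⟨le_rfl, ht⟩

theorem Cut.step (hc : τ.Cut c σ) (h : τ.IsGlobalTrace)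
    {μ : P.glob.Name → P.Mutex} (hμ : Protected P μ) (ht : τ.Live c t) {u v : P.Node}
    (hu : τ.conf t (c t) = some (u, l)) (hv : τ.conf t (c t + 1) = some (v, l'))
    (hedge : P.edge u v = some a)
    (hlow : ∀ e, τ.Le e (t, c t + 1) → e = (t, c t + 1) ∨ τ.Done c e) :
    τ.Cut (Function.update c t (c t + 1)) (σ.step t v l a) := by
  have hs : τ.IsStep t (c t) l a l' := ⟨u, v, hu, hv, hedge⟩
  have hp := hs.performs
  have hadm := hc.admissible h hs hlow
  have hl' := hc.eq_eval h hμ ht hs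
  -- The id of the child is not in use. The create edge of a thread with this id starts at `(t, c
  -- t)`, whereas liveness would make it start at a step that has already been taken.
  have hchild : ∀ t', (∃ T, a = .create T) → t' = σ.child t → ¬ τ.Live c t' := by
    rintro t' ⟨T, rfl⟩ rfl hlive
    have h1 : τ.Mem (σ.child t, 0) := hc.mem _ ⟨by simp, hlive⟩
    rw [Machine.child, hc.count] at h1 hlive
    have h2 := h.createOrd_of_performs hp h1
    rcases hlive with h3 | ⟨p, k, h3, h4⟩
    · simp at h3
    · obtain ⟨rfl, rfl⟩ := Prod.mk.inj ((h.created _ (by simp) h1).unique h2 h3)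
      omega
  refine ⟨?_, ?_, ?_, ?_, ?_, ?_, ?_⟩
  · intro e he
    rcases (hc.done_update h ht).1 he with h1 | rfl | h1
    · exact hc.mem _ h1
    · exact hp.mem_succ
    · exact (h.createOrd_mem h1).2
  · intro e e' he' hle
    rw [hc.done_update h ht] at he' ⊢
    rcases he' with h1 | rfl | h1
    · exact .inl (hc.closed _ _ h1 hle)
    · rcases hlow _ hle with h1 | h1
      · exact .inr (.inl h1)
      · exact .inl h1
    · obtain ⟨h2, h3⟩ := h.createOrd_index h1
      obtain ⟨t', n⟩ := e'
      simp only at h2 h3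
      subst h2
      -- Neither program order nor lock order leads to a first configuration, and its create edge is
      -- unique; so everything strictly below it is below `(t, c t)`.
      rcases Relation.ReflTransGen.cases_tail hle with rfl | ⟨y, h4, h5⟩
      · exact .inr (.inr h1)
      · left
        rcases h5 with h5 | h5 | ⟨m, h5⟩
        · simpa using h5.2.2
        · rw [(h.created _ h3 (h.createOrd_mem h1).2).unique h5 h1] at h4
          exact hc.closed _ _ ⟨le_rfl, ht⟩ h4
        · obtain ⟨-, t'', k, h6, -⟩ := h.lock_spec _ _ _ h5
          simp at h6
  · intro t' ht'
    rw [live_update]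
    left
    by_cases htt : t' = t
    · exact htt ▸ ht
    · rw [Function.update_of_ne htt] at ht'
      exact hc.live _ ht'
  · intro t' ht'
    simp only [Machine.step]
    by_cases htt : t' = t
    · subst htt
      rw [Machine.moves_self, Function.update_self, hv, hl']
    · rw [Function.update_of_ne htt]
      by_cases hl : τ.Live c t'
      · rw [Machine.moves_of_ne _ _ _ _ htt fun ha heq => hchild _ ha heq hl, hc.loc _ hl]
      · have h0 : c t' = 0 := by
          by_contra h4
          exact hl (hc.live _ h4)
        have hcr := (live_update.1 ht').resolve_left hl
        obtain ⟨u', l₁, T, h1, h2, h3, h4⟩ := h.create_spec _ _ hcr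
        obtain rfl := (h2.resolve_right fun h5 => h5.1 hp.mem_succ).unique hp
        simp only at h1 h3 h4
        rw [hu] at h1
        obtain ⟨rfl, rfl⟩ := Prod.mk.inj (Option.some.inj h1)
        rw [h0, h4]
        obtain rfl : t' = σ.child t := by
          rw [Machine.child, hc.count]
          exact (Prod.mk.inj h3).1
        exact σ.moves_create t v l T
  · refine Stmt.own_eq_some_iff (H := fun t m => τ.Holds t (c t) m) hc.mutex hadm ?_ ?_
    · intro m
      rw [Function.update_self]
      exact holds_succ_iff hp
    · intro t' m htt
      rw [Function.update_of_ne htt]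
  · intro g
    simp only [Machine.step]
    -- The start of a created thread has index `0`, whereas writes are recorded at the configuration
    -- after a step.
    have hidx : ∀ y w, τ.IsWrite g y w → ¬ τ.createOrd (t, c t) w := by
      intro y w hw hcr
      obtain ⟨t₁, k₁, l₁, l₂, f, rfl, -⟩ := hw
      simpa using (h.createOrd_index hcr).1
    rcases a.eval_snd l σ.G g with ⟨f, rfl, h1⟩ | ⟨h1, h2⟩
    · rw [h1]
      refine .inl ⟨(t, c t + 1), ⟨t, c t, l, l', f, rfl, hs, rfl⟩,
        (hc.done_update h ht).2 (.inr (.inl rfl)), fun y w hw hd => ?_⟩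
      rcases (hc.done_update h ht).1 hd with h2 | rfl | h2
      · exact (hc.write_le h hμ hs (by simp [Stmt.accessed]) hw h2).trans
          (h.le_of_le_index (Nat.le_succ _) hp.mem_succ)
      · exact .refl
      · exact absurd h2 (hidx _ _ hw)
    · rw [h2]
      refine (hc.glob g).congr fun y w hw => ?_
      rw [hc.done_update h ht]
      refine ⟨.inl, fun h3 => h3.resolve_right ?_⟩
      rintro (rfl | h3)
      · obtain ⟨t₁, k₁, l₁, l₂, f, h4, h5, -⟩ := hw
        simp only [Prod.mk.injEq, Nat.add_right_cancel_iff] at h4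
        obtain ⟨rfl, rfl⟩ := h4
        exact h1 f (hp.unique h5.performs)
      · exact hidx _ _ hw h3
  · intro t'
    simp only [Machine.step]
    by_cases htt : t' = t
    · subst htt
      rw [Function.update_self]
      exact count_eq_numCreates hp (hc.count _)
    · rw [Function.update_of_ne htt, Stmt.count_of_ne _ _ htt, hc.count]

end Advance

/-- The cut is advanced, with the number of remaining events as measure, until the step to be taken
is the false assertion. That step cannot be passed unnoticed, as a step adds only its own target and
the start of a thread. -/
theorem Cut.exists_bad (h : τ.IsGlobalTrace) (hcompl : τ.Complete)
    {μ : P.glob.Name → P.Mutex} (hμ : Protected P μ) {t₀ : Tid} {k₀ : ℕ} {l₀ l₀' : LState P.loc}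
    {p : LState P.loc → Bool} (hs : τ.IsStep t₀ k₀ l₀ (.simple (.assert p)) l₀')
    (hp : p l₀ = false) : ∀ n, ∀ {c : Tid → ℕ} {σ : Machine P}, τ.Cut c σ → σ.Reach →
    {e | τ.Mem e ∧ ¬ τ.Done c e}.ncard = n → ¬ τ.Done c (t₀, k₀ + 1) →
    ∃ σ' : Machine P, σ'.Reach ∧ σ'.Bad := by
  intro n
  induction n using Nat.strong_induction_on with
  | _ n ih =>
    intro c σ hc hr hn hd
    obtain ⟨t, ht, hm, hlow⟩ := hc.exists_next h hcompl _ rfl hs.performs.mem_succ hd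
    obtain ⟨l, a, l', u, v, h1, h2, h3⟩ := h.path _ _ hm
    have hL : σ.L t = some (u, l) := (hc.loc t ht).trans h1
    have hst : τ.IsStep t (c t) l a l' := ⟨u, v, h1, h2, h3⟩
    have hc' := hc.step h hμ ht h1 h2 h3 hlow
    by_cases heq : ((t₀, k₀) : Event) = (t, c t)
    · obtain ⟨rfl, rfl⟩ := Prod.mk.inj heq
      obtain ⟨rfl, rfl, -⟩ := hst.unique hs
      exact ⟨σ, hr, t₀, u, v, l, p, hL, h3, hp⟩
    · refine ih _ ?_ hc' (hr.step hL h3 (hc.admissible h hst hlow)) rfl ?_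
      · rw [← hn]
        refine Set.ncard_lt_ncard ⟨fun e he => ⟨he.1, fun h4 => he.2 ?_⟩, fun hss => ?_⟩
          (h.finite.subset fun e he => he.1)
        · exact (hc.done_update h ht).2 (.inl h4)
        · refine (hss (show (t, c t + 1) ∈ _ from ⟨hm, fun h4 => ?_⟩)).2
            ((hc.done_update h ht).2 (.inr (.inl rfl)))
          have := h4.1
          simp only at this
          omega
      · rw [hc.done_update h ht]
        rintro (h4 | h4 | h4)
        · exact hd h4
        · simp only [Prod.mk.injEq, Nat.add_right_cancel_iff] at h4
          exact heq (Prod.ext h4.1 h4.2)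
        · simpa using (h.createOrd_index h4).1

/-- A violation in a global trace yields a reachable configuration in which an assertion is about to
be violated. -/
theorem IsGlobalTrace.exists_bad (h : τ.IsGlobalTrace) {μ : P.glob.Name → P.Mutex}
    (hμ : Protected P μ) (hv : τ.Violated) : ∃ σ : Machine P, σ.Reach ∧ σ.Bad := by
  obtain ⟨τ', h', hcompl, hstep⟩ := h.exists_complete _ rfl
  obtain ⟨t, k, l, l', p, hs, hp⟩ := hv
  refine Cut.exists_bad h' hcompl hμ (hstep _ _ _ _ _ hs) hp _ h'.cut_initial .init rfl ?_
  rintro ⟨h1, -⟩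
  simp at h1

end RawTrace

end TracesVsMachines

/-! ### Global traces of reachable configurations -/

section MachinesToTraces

namespace RawTrace

variable {P : Lang.{u}} {τ : RawTrace P}

/-- The trace that consists of the initial configuration of the initial thread. -/
def initial (P : Lang.{u}) : RawTrace P where
  conf t k := if t = [] ∧ k = 0 then some (P.start P.main, P.initLoc) else none
  createOrd _ _ := False
  lockOrd _ _ _ := False

theorem mem_initial {e : Event} : (initial P).Mem e ↔ e = ([], 0) := by
  obtain ⟨t, k⟩ := e
  simp [Mem, initial]

theorem not_isStep_initial {t : Tid} {k : ℕ} {l l' : LState P.loc}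
    {a : Stmt P.glob P.loc P.Mutex P.Templ} : ¬ (initial P).IsStep t k l a l' := fun h => by
  simpa using mem_initial.1 h.performs.mem_succ

theorem not_performs_initial {t : Tid} {k : ℕ} {a : Stmt P.glob P.loc P.Mutex P.Templ} :
    ¬ (initial P).Performs t k a := fun ⟨_, _, h⟩ => not_isStep_initial h

theorem eq_of_le_initial {e e' : Event} (h : (initial P).Le e e') : e = e' := by
  induction h with
  | refl => rfl
  | tail _ h2 ih =>
    rcases h2 with h2 | h2 | ⟨m, h2⟩
    · have h3 := mem_initial.1 h2.2.1
      rw [h2.2.2] at h3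
      simp at h3
    · exact h2.elim
    · exact h2.elim

theorem isGlobalTrace_initial : (initial P).IsGlobalTrace where
  finite := (Set.finite_singleton ([], 0)).subset fun _ he => mem_initial.1 he
  init := by simp [initial]
  path t k hm := by simpa using mem_initial.1 hm
  effect _ _ _ _ _ hs := (not_isStep_initial hs).elim
  antisymm _ _ h _ := eq_of_le_initial h
  least e he := by
    rw [mem_initial.1 he]
    exact .refl
  create_spec _ _ h := h.elim
  created t ht hm := absurd (Prod.mk.inj (mem_initial.1 hm)).1 ht
  create_unique _ _ _ h := h.elim
  lock_spec _ _ _ h := h.elim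
  lock_pred _ _ _ h := (not_performs_initial h).elim
  lock_succ _ _ _ _ h := h.elim
  unlock_holds _ _ _ h := (not_performs_initial h).elim

/-- `M`, `G` and `C` are the components of the configuration reached at the end of the trace, in
which each thread `t` performs `c t` steps. -/
structure EndsWith (τ : RawTrace P) (c : Tid → ℕ) (M : P.Mutex → Option Tid) (G : P.glob.Val)
    (C : Tid → ℕ) : Prop where
  trace : τ.IsGlobalTrace
  le : ∀ t k, τ.Mem (t, k) → k ≤ c t
  mem : ∀ t, c t ≠ 0 → τ.Mem (t, c t)
  mutex : ∀ m t, M m = some t ↔ τ.Holds t (c t) m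
  glob : ∀ g, τ.LastValue τ.Mem g (G g)
  count : ∀ t, C t = τ.numCreates t (c t)

theorem endsWith_initial : (initial P).EndsWith (fun _ => 0) (Machine.initial P).M
    (Machine.initial P).G (Machine.initial P).C where
  trace := isGlobalTrace_initial
  le t k hm := by simpa using (Prod.mk.inj (mem_initial.1 hm)).2.le
  mem t ht := absurd rfl ht
  mutex m t := by simp [Machine.initial, not_holds_zero]
  glob g := by
    refine .inr ⟨fun y w hw _ => ?_, rfl⟩
    obtain ⟨t, k, l, l', f, rfl, hs, -⟩ := hw
    exact not_isStep_initial hs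
  count t := by simp [Machine.initial, numCreates_zero]

/-- A mutex that nobody holds can be locked next. -/
theorem IsGlobalTrace.exists_lock_pred (h : τ.IsGlobalTrace) {m : P.Mutex} {c : Tid → ℕ}
    (hle : ∀ t k, τ.Mem (t, k) → k ≤ c t) (hfree : ∀ t, ¬ τ.Holds t (c t) m) :
    ∃ e₀ : Event, (e₀ = ([], 0) ∨ ∃ t k, e₀ = (t, k + 1) ∧ τ.Performs t k (.unlock m)) ∧
      ∀ e, ¬ τ.lockOrd m e₀ e := by
  by_cases hlock : ∃ e : Event, τ.Performs e.1 e.2 (.lock m)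
  · have hfin : {e : Event | τ.Performs e.1 e.2 (.lock m)}.Finite :=
      h.finite.subset fun e he => Performs.mem he
    -- The lock of maximal rank is the last one. It has been released since the mutex is free, and a
    -- lock succeeding this release would have a larger rank.
    obtain ⟨⟨t, j⟩, hl, hmax⟩ := Set.exists_max_image _ (fun e => τ.rank (e.1, e.2 + 1)) hfin hlock
    simp only [Set.mem_ofPred_eq] at hl hmax
    have hun : ∃ k, j < k ∧ τ.Performs t k (.unlock m) := by
      by_contra hno
      exact hfree t ⟨j, hle _ _ hl.mem_succ, hl, fun i hi _ hu => hno ⟨i, hi, hu⟩⟩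
    obtain ⟨k, hk, hu⟩ := hun
    refine ⟨(t, k + 1), .inr ⟨t, k, rfl, hu⟩, fun e he => ?_⟩
    obtain ⟨-, t', k', rfl, hl'⟩ := h.lock_spec _ _ _ he
    have h1 : τ.Le (t, k + 1) (t', k' + 1) := .single (.inr (.inr ⟨m, he⟩))
    have h2 : τ.Le (t, j + 1) (t, k) := h.le_of_le_index hk hu.mem
    have h3 := h.rank_lt (h.le_of_le_index (j := j + 1) (by omega) hu.mem_succ) (by simp; omega)
      hu.mem_succ
    have h4 := hmax (t', k') hl'
    by_cases heq : ((t, k + 1) : Event) = (t', k' + 1)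
    · rw [← heq] at h4
      omega
    · have := h.rank_lt h1 heq hl'.mem_succ
      simp only at h4
      omega
  · refine ⟨([], 0), .inl rfl, fun e he => ?_⟩
    obtain ⟨-, t', k', -, hl'⟩ := h.lock_spec _ _ _ he
    exact hlock ⟨(t', k'), hl'⟩

/-! ### Following a machine step by a trace -/

section Step

variable {c : Tid → ℕ} {σ : Machine P} {t : Tid} {u v : P.Node} {l : LState P.loc}
  {a : Stmt P.glob P.loc P.Mutex P.Templ}

theorem EndsWith.not_mem_succ (h : τ.EndsWith c σ.M σ.G σ.C) : ¬ τ.Mem (t, c t + 1) := fun hm => by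
  have := h.le _ _ hm
  omega

theorem EndsWith.write_le (h : τ.EndsWith c σ.M σ.G σ.C) {μ : P.glob.Name → P.Mutex}
    (hμ : Protected P μ) (hconf : τ.conf t (c t) = some (u, l)) (hedge : P.edge u v = some a)
    {g : P.glob.Name} (hg : g ∈ a.accessed) {x : P.glob.Ty g} {w : Event}
    (hw : τ.IsWrite g x w) : τ.Le w (t, c t) :=
  h.trace.write_le hμ hconf hedge hg hw fun _ hi => h.le _ _ (h.trace.mem_of_le hi hw.mem)

/-- At the end of the trace every write to an accessed global is in the past of the thread, because
the thread holds the dedicated mutex; hence a read sees the memory. -/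
theorem EndsWith.exists_extendable (h : τ.EndsWith c σ.M σ.G σ.C) {μ : P.glob.Name → P.Mutex}
    (hμ : Protected P μ) (hcompl : τ.Complete) (hconf : τ.conf t (c t) = some (u, l))
    (hedge : P.edge u v = some a) (hadm : a.Admissible t l σ.M) :
    ∃ e₀, τ.Extendable t (c t) u v l (a.eval (l, σ.G)).1 a e₀ := by
  have hlock : ∃ e₀ : Event, ∀ m, a = .lock m →
      (e₀ = ([], 0) ∨ ∃ t k, e₀ = (t, k + 1) ∧ τ.Performs t k (.unlock m)) ∧
      ∀ e, ¬ τ.lockOrd m e₀ e := by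
    by_cases ha : ∃ m, a = .lock m
    · obtain ⟨m, rfl⟩ := ha
      obtain ⟨e₀, he⟩ := h.trace.exists_lock_pred (m := m) h.le fun t' ht' => by
        have h1 := (h.mutex _ _).2 ht'
        rw [show σ.M m = none from hadm] at h1
        simp at h1
      refine ⟨e₀, fun m' hm' => ?_⟩
      obtain rfl : m = m' := by simpa using hm'
      exact he
    · exact ⟨([], 0), fun m hm => absurd ⟨m, hm⟩ ha⟩
  obtain ⟨e₀, he₀⟩ := hlock
  refine ⟨e₀, h.trace, hconf, h.not_mem_succ, hedge, ?_, ?_, he₀, ?_⟩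
  · refine localEffect_eval hadm fun g hg => ?_
    rw [readsValue_iff]
    exact (h.glob g).congr fun y w hw => ⟨fun _ => h.write_le hμ hconf hedge hg hw, fun _ => hw.mem⟩
  -- By completeness a create edge from the last configuration of `t` would require the very step
  -- that is about to be added.
  · intro e he
    obtain ⟨T, hT⟩ := hcompl _ _ he
    exact absurd hT.mem_succ h.not_mem_succ
  · rintro m rfl
    exact (h.mutex _ _).1 hadm

theorem EndsWith.extend (h : τ.EndsWith c σ.M σ.G σ.C) {μ : P.glob.Name → P.Mutex}
    (hμ : Protected P μ) {e₀ : Event} {l' : LState P.loc}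
    (hext : τ.Extendable t (c t) u v l l' a e₀) (hadm : a.Admissible t l σ.M) :
    (τ.extend t (c t) (v, l') a e₀).EndsWith (Function.update c t (c t + 1))
      (σ.step t v l a).M (σ.step t v l a).G (σ.step t v l a).C := by
  have hold : ∀ t', t' ≠ t → ∀ j, j < c t' → ∀ b,
      (τ.extend t (c t) (v, l') a e₀).Performs t' j b ↔ τ.Performs t' j b := fun t' ht j hj =>
    hext.performs_extend_of_mem (h.mem t' (Nat.ne_zero_of_lt hj)) j hj
  have hnew := hext.isStep_new.performs
  refine ⟨hext.isGlobalTrace, ?_, ?_, ?_, ?_, ?_⟩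
  · intro t' k hm
    rcases mem_extend.1 hm with h1 | h1
    · refine (h.le _ _ h1).trans ?_
      by_cases ht : t' = t
      · subst ht
        simp
      · rw [Function.update_of_ne ht]
    · obtain ⟨rfl, rfl⟩ := Prod.mk.inj h1
      simp
  · intro t' ht'
    rw [mem_extend]
    by_cases ht : t' = t
    · subst ht
      simp
    · rw [Function.update_of_ne ht] at ht' ⊢
      exact .inl (h.mem _ ht')
  · refine Stmt.own_eq_some_iff (H := fun t m => τ.Holds t (c t) m) h.mutex hadm ?_ ?_
    · intro m
      rw [Function.update_self, holds_succ_iff hnew,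
        Holds.congr (hext.performs_extend_of_mem hext.mem_old)]
    · intro t' m ht
      rw [Function.update_of_ne ht, Holds.congr (hold t' ht)]
  · intro g
    simp only [Machine.step]
    rcases a.eval_snd l σ.G g with ⟨f, rfl, h1⟩ | ⟨h1, h2⟩
    · rw [h1]
      refine .inl ⟨(t, c t + 1), hext.isWrite_extend.2 (.inr ⟨rfl, f, rfl, rfl⟩), mem_extend.2
        (.inr rfl), fun y w hw _ => ?_⟩
      rcases hext.isWrite_extend.1 hw with h2 | ⟨rfl, -⟩
      · exact (le_extend (h.write_le hμ hext.conf hext.edge (by simp [Stmt.accessed]) h2)).trans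
          hext.le_new
      · exact .refl
    · rw [h2]
      refine (hext.lastValue_extend hext.new (h.glob g)).congr fun y w hw => ?_
      rw [mem_extend, or_iff_left_of_imp]
      rintro rfl
      rcases hext.isWrite_extend.1 hw with h3 | ⟨-, f, h3, -⟩
      · exact h3.mem
      · exact absurd h3 (h1 f)
  · intro t'
    simp only [Machine.step]
    by_cases ht : t' = t
    · subst ht
      rw [Function.update_self]
      refine count_eq_numCreates hnew ?_
      rw [numCreates_congr (hext.performs_extend_of_mem hext.mem_old), h.count]
    · rw [Function.update_of_ne ht, Stmt.count_of_ne _ _ ht, numCreates_congr (hold t' ht), h.count]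

/-- A machine performs a create action at once, the trace in two stages, `extend` and `spawn`. The
positions of threads agree only after both, which is why they are not part of `EndsWith`. -/
theorem EndsWith.spawn {M : P.Mutex → Option Tid} {G : P.glob.Val} {C : Tid → ℕ}
    (h : τ.EndsWith c M G C) {p : Tid} {k : ℕ} {T : P.Templ} (hsp : τ.Spawnable p k u l T) :
    (τ.spawn p k (P.start T, ⟨p ++ [τ.numCreates p k], l.vars⟩)).EndsWith c M G C where
  trace := hsp.isGlobalTrace
  le t j hm := by
    rcases mem_spawn.1 hm with h1 | h1
    · exact h.le _ _ h1
    · simp [(Prod.mk.inj h1).2]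
  mem t ht := mem_spawn.2 (.inl (h.mem t ht))
  mutex m t := by rw [hsp.holds_spawn, h.mutex]
  glob g := by
    refine (hsp.lastValue_spawn (h.glob g)).congr fun y w hw => ?_
    have := ((hsp.isWrite_spawn).1 hw).mem
    simp [mem_spawn, this]
  count t := by rw [hsp.numCreates_spawn, h.count]

end Step

/-- Every reachable configuration is reached at the end of a global trace. -/
theorem _root_.GhostWitness.Machine.Reach.exists_endsWith {μ : P.glob.Name → P.Mutex}
    (hμ : Protected P μ) {σ : Machine P} (hσ : σ.Reach) :
    ∃ (τ : RawTrace P) (c : Tid → ℕ), τ.EndsWith c σ.M σ.G σ.C ∧ τ.Complete ∧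
      ∀ t, σ.L t = τ.conf t (c t) := by
  induction hσ with
  | init =>
    exact ⟨.initial P, fun _ => 0, endsWith_initial, fun _ _ h => h.elim,
      fun t => by simp [Machine.initial, initial]⟩
  | @step σ t u v l a hσ hL hedge hadm ih =>
    obtain ⟨τ, c, h, hcompl, hloc⟩ := ih
    have hconf : τ.conf t (c t) = some (u, l) := (hloc t).symm.trans hL
    obtain ⟨e₀, hext⟩ := h.exists_extendable hμ hcompl hconf hedge hadm
    have h' := h.extend hμ hext hadm
    set l' := (a.eval (l, σ.G)).1 with hl'
    set c' := Function.update c t (c t + 1) with hc'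
    have hcompl' : (τ.extend t (c t) (v, l') a e₀).Complete := fun e e' he => by
      obtain ⟨T, hT⟩ := hcompl e e' he
      exact ⟨T, hext.performs_extend.2 (.inl hT)⟩
    have hself : σ.moves t v l a t = (τ.extend t (c t) (v, l') a e₀).conf t (c' t) := by
      rw [Machine.moves_self, hc', Function.update_self, conf_extend_new]
    have hother : ∀ t', t' ≠ t → σ.L t' = (τ.extend t (c t) (v, l') a e₀).conf t' (c' t') := by
      intro t' ht
      rw [hc', Function.update_of_ne ht, hloc,
        τ.conf_extend _ a e₀ (e := (t', c t')) (by simp [ht])]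
    by_cases ha : ∃ T, a = .create T
    · obtain ⟨T, rfl⟩ := ha
      have hnum : (τ.extend t (c t) (v, l') (.create T) e₀).numCreates t (c t) = σ.C t := by
        rw [numCreates_congr (hext.performs_extend_of_mem hext.mem_old), h.count]
      have hsp : (τ.extend t (c t) (v, l') (.create T) e₀).Spawnable t (c t) u l T :=
        { trace := hext.isGlobalTrace
          conf := by rw [τ.conf_extend _ _ e₀ (e := (t, c t)) (by simp), hconf]
          performs := hext.isStep_new.performs
          -- If the child were present, its create edge would belong to the old trace, and
          -- completeness of that trace would provide the create step there.
          new := fun hm => by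
            obtain ⟨T', hT'⟩ := hcompl _ _
              (hext.isGlobalTrace.createOrd_of_performs hext.isStep_new.performs hm)
            exact h.not_mem_succ hT'.mem_succ }
      have hchild : t ++ [(τ.extend t (c t) (v, l') (.create T) e₀).numCreates t (c t)] =
          σ.child t := by rw [hnum, Machine.child]
      -- The start of the child is not yet in the trace, so the child cannot have taken any step.
      have hc0 : c' (σ.child t) = 0 := by
        by_contra hne
        refine hsp.new ?_
        rw [hchild]
        exact h'.trace.mem_of_le_index (Nat.zero_le _) (h'.mem _ hne)
      refine ⟨_, c', h'.spawn hsp, ?_, fun t' => ?_⟩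
      · rintro e e' (he | ⟨rfl, -⟩)
        · obtain ⟨T', hT'⟩ := hcompl' e e' he
          exact ⟨T', hsp.performs_spawn.2 hT'⟩
        · exact ⟨T, hsp.performs_spawn.2 hsp.performs⟩
      · simp only [Machine.step]
        by_cases ht : t' = t
        · subst ht
          rw [hself, conf_spawn (e := (t', c' t')) _ _ (by simp)]
        · by_cases htc : t' = σ.child t
          · subst htc
            rw [Machine.moves_create, hc0, ← hchild, conf_spawn_new]
          · rw [Machine.moves_of_ne _ _ _ _ ht fun _ => htc, hother t' ht,
              conf_spawn (e := (t', c' t')) _ _ (by simp [hchild, htc])]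
    · refine ⟨_, c', h', hcompl', fun t' => ?_⟩
      simp only [Machine.step]
      by_cases ht : t' = t
      · subst ht
        exact hself
      · rw [Machine.moves_of_ne _ _ _ _ ht fun h1 => absurd h1 ha, hother t' ht]

end RawTrace

/-- If all accesses to globals are protected, then the safety with respect to the local trace
semantics is that of the reachable configurations. -/
theorem safeLocalTraces_iff {P : Lang.{u}} {μ : P.glob.Name → P.Mutex} (hμ : Protected P μ) :
    SafeLocalTraces P ↔ ∀ σ : Machine P, σ.Reach → ¬ σ.Bad := by
  constructor
  · rintro hsafe σ hσ ⟨t, u, v, l, p, hL, hedge, hp⟩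
    obtain ⟨τ, c, h, hcompl, hloc⟩ := hσ.exists_endsWith hμ
    -- The assertion is always admissible, so its step can be appended; the past of this step is the
    -- violating local trace.
    obtain ⟨e₀, hext⟩ := h.exists_extendable hμ hcompl ((hloc t).symm.trans hL) hedge trivial
    have hs := hext.isStep_new
    exact hsafe _ (hext.isGlobalTrace.isLocalTrace_below hs.performs.mem_succ)
      ⟨t, c t, l, _, p, (RawTrace.isStep_below hext.isGlobalTrace).2 ⟨hs, .refl⟩, hp⟩
  · intro hsafe τ hτ hv
    obtain ⟨σ, hσ, hbad⟩ := hτ.1.exists_bad hμ hv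
    exact hsafe σ hσ hbad

end MachinesToTraces

/-! ### Critical sections of the split program -/

section CriticalSections

section Actions

variable {G X : Decls.{u}} {M T : Type u}

theorem Stmt.accessed_addMutexes (a : Stmt G X M T) : a.addMutexes.accessed = a.accessed := by
  rcases a with (_ | _ | _ | _) | _ | _ | _ | _ | _ <;> rfl

namespace Action

variable (ord : LinearOrder G.Name) (a : Action G X M T)

/-- The statements after the first one. -/
def rest : Action G X M T → List (SimpleStmt G X)
  | .base _ => []
  | .atomic _ as => as

theorem stmts_eq : a.stmts = a.first :: a.rest.map .simple := by
  cases a <;> rfl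

theorem length_stmts_pos : 0 < a.stmts.length := by
  simp [stmts_eq]

theorem nodup_accessed : (a.accessed ord).Nodup := by
  unfold accessed
  exact Finset.sort_nodup ..

theorem mem_accessed {g : G.Name} : g ∈ a.accessed ord ↔ ∃ b ∈ a.stmts, g ∈ b.accessed := by
  classical
  unfold accessed
  simp only [Finset.mem_sort, List.mem_toFinset, List.mem_flatMap]

theorem length_expand : (a.expand ord).length =
    (a.accessed ord).length + a.stmts.length + (a.accessed ord).length := by
  simp [expand, add_assoc]

theorem expand_getElem?_lock {j : ℕ} (hj : j < (a.accessed ord).length) :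
    (a.expand ord)[j]? = some (.lock (.inr (a.accessed ord)[j])) := by
  rw [expand, List.getElem?_append_left (by simp; omega),
    List.getElem?_append_left (by simpa using hj)]
  simp [hj]

theorem expand_getElem?_stmt {k : ℕ} (hk : k < a.stmts.length) :
    (a.expand ord)[(a.accessed ord).length + k]? = some a.stmts[k].addMutexes := by
  rw [expand, List.getElem?_append_left (by simp; omega), List.getElem?_append_right (by simp)]
  simp [hk]

theorem expand_getElem?_unlock {r : ℕ} (hr : r < (a.accessed ord).length) :
    (a.expand ord)[(a.accessed ord).length + a.stmts.length + r]? =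
      some (.unlock (.inr ((a.accessed ord)[(a.accessed ord).length - 1 - r]'(by omega)))) := by
  rw [expand, List.getElem?_append_right (by simp)]
  simp [hr]

theorem expand_cases {j : ℕ} {b : Stmt G X (M ⊕ G.Name) T} (h : (a.expand ord)[j]? = some b) :
    (∃ hj : j < (a.accessed ord).length, b = .lock (.inr (a.accessed ord)[j])) ∨
    (∃ k, ∃ hk : k < a.stmts.length, j = (a.accessed ord).length + k ∧
      b = a.stmts[k].addMutexes) ∨
    (∃ r, ∃ hr : r < (a.accessed ord).length,
      j = (a.accessed ord).length + a.stmts.length + r ∧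
      b = .unlock (.inr ((a.accessed ord)[(a.accessed ord).length - 1 - r]'(by omega)))) := by
  have hlt : j < (a.expand ord).length := by
    by_contra hge
    rw [List.getElem?_eq_none (by omega)] at h
    simp at h
  rw [length_expand] at hlt
  by_cases h1 : j < (a.accessed ord).length
  · rw [expand_getElem?_lock ord a h1] at h
    exact .inl ⟨h1, (Option.some.inj h).symm⟩
  · by_cases h2 : j < (a.accessed ord).length + a.stmts.length
    · obtain ⟨k, rfl⟩ := Nat.exists_eq_add_of_le (not_lt.1 h1)
      rw [expand_getElem?_stmt ord a (by omega)] at h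
      exact .inr (.inl ⟨k, by omega, rfl, (Option.some.inj h).symm⟩)
    · obtain ⟨r, rfl⟩ := Nat.exists_eq_add_of_le (not_lt.1 h2)
      rw [expand_getElem?_unlock ord a (by omega)] at h
      exact .inr (.inr ⟨r, by omega, rfl, (Option.some.inj h).symm⟩)

end Action

end Actions

variable {Q : LangAtomic.{u}} (ord : LinearOrder Q.glob.Name)

theorem splitStmts_of_edge {u v : Q.Node} {a : Action Q.glob Q.loc Q.Mutex Q.Templ}
    (h : Q.edge u v = some a) : splitStmts Q ord u v = a.expand ord := by
  simp [splitStmts, h]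

theorem exists_edge_of_splitStmts {u v : Q.Node} {j : ℕ}
    {b : Stmt Q.glob Q.loc (Q.Mutex ⊕ Q.glob.Name) Q.Templ}
    (h : (splitStmts Q ord u v)[j]? = some b) : ∃ a, Q.edge u v = some a := by
  refine Option.isSome_iff_exists.1 (isSome_edge_of_splitStmts Q ord ?_)
  have := (List.getElem?_eq_some_iff.1 h).1
  omega

/-- The node before the `j`-th statement on the path from `u` to `v`. -/
def pathNode (u v : Q.Node) (j : ℕ) : SplitNode Q ord :=
  if j = 0 then .inl u
  else if h : j - 1 < (splitStmts Q ord u v).length - 1 then .inr ⟨(u, v), ⟨j - 1, h⟩⟩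
  else .inl v

theorem pathNode_zero (u v : Q.Node) : pathNode ord u v 0 = .inl u := rfl

theorem pathNode_inner {u v : Q.Node} {k : ℕ} (h : k < (splitStmts Q ord u v).length - 1) :
    pathNode ord u v (k + 1) = .inr ⟨(u, v), ⟨k, h⟩⟩ := by
  simp [pathNode, h]

theorem pathNode_last {u v : Q.Node} {j : ℕ} (h0 : j ≠ 0)
    (h : (splitStmts Q ord u v).length ≤ j) : pathNode ord u v j = .inl v := by
  unfold pathNode
  rw [if_neg h0, dif_neg (by omega)]

/-- Replaces the four cases of `splitEdge` by one description: an edge of the split program is a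
statement at some position of a path. -/
theorem splitEdge_iff {x y : SplitNode Q ord}
    {b : Stmt Q.glob Q.loc (Q.Mutex ⊕ Q.glob.Name) Q.Templ} :
    splitEdge Q ord x y = some b ↔ ∃ u v j, x = pathNode ord u v j ∧
      y = pathNode ord u v (j + 1) ∧ (splitStmts Q ord u v)[j]? = some b := by
  constructor
  · intro h
    rcases x with u | ⟨⟨u, v⟩, k, hk⟩ <;> rcases y with v' | ⟨⟨u', v'⟩, k', hk'⟩ <;>
      simp only [splitEdge, Option.ite_none_right_eq_some] at h
    · obtain ⟨h1, h2⟩ := h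
      exact ⟨u, v', 0, rfl, (pathNode_last ord (by simp) (by omega)).symm, h2⟩
    · obtain ⟨⟨rfl, rfl⟩, h2⟩ := h
      exact ⟨u', v', 0, rfl, (pathNode_inner ord hk').symm, h2⟩
    · obtain ⟨⟨rfl, h1⟩, h2⟩ := h
      exact ⟨u, v, k + 1, (pathNode_inner ord hk).symm,
        (pathNode_last ord (by simp) (by omega)).symm, h2⟩
    · obtain ⟨⟨h1, rfl⟩, h2⟩ := h
      obtain ⟨rfl, rfl⟩ := Prod.mk.inj h1
      exact ⟨u, v, k + 1, (pathNode_inner ord hk).symm, (pathNode_inner ord hk').symm, h2⟩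
  · rintro ⟨u, v, j, rfl, rfl, h⟩
    have hlt := (List.getElem?_eq_some_iff.1 h).1
    cases j with
    | zero =>
      rw [pathNode_zero]
      by_cases h1 : 0 < (splitStmts Q ord u v).length - 1
      · rw [pathNode_inner ord h1]
        simpa [splitEdge] using h
      · rw [pathNode_last ord (by simp) (by omega)]
        simp only [splitEdge]
        rw [if_pos (by omega)]
        exact h
    | succ k =>
      rw [pathNode_inner ord (u := u) (v := v) (k := k) (by omega)]
      by_cases h1 : k + 1 < (splitStmts Q ord u v).length - 1
      · rw [pathNode_inner ord h1]
        simpa [splitEdge] using h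
      · rw [pathNode_last ord (by simp) (by omega)]
        simp only [splitEdge]
        rw [if_pos ⟨trivial, by omega⟩]
        exact h

/-- The bound on `j` makes the node an inner one, and inner nodes record their path and position.
End nodes are shared by several paths. -/
theorem pathNode_succ_inj {u v u' v' : Q.Node} {j j' : ℕ}
    (hj : j + 1 < (splitStmts Q ord u v).length)
    (h : pathNode ord u v (j + 1) = pathNode ord u' v' (j' + 1)) : u = u' ∧ v = v' ∧ j = j' := by
  rw [pathNode_inner ord (by omega)] at h
  by_cases h1 : j' < (splitStmts Q ord u' v').length - 1
  · rw [pathNode_inner ord h1] at h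
    have h2 := Sum.inr.inj h
    simp only [Sigma.mk.injEq, Prod.mk.injEq] at h2
    obtain ⟨⟨rfl, rfl⟩, h2⟩ := h2
    simpa using h2
  · rw [pathNode_last ord (by simp) (by omega)] at h
    cases h

/-- A thread inside a path has performed the previous statements of the path. -/
theorem performs_of_pathNode {τ : RawTrace (split Q ord)} (h : τ.IsGlobalTrace) {t : Tid}
    {u v : Q.Node} : ∀ {j k : ℕ} {l : LState Q.loc}, j < (splitStmts Q ord u v).length →
    τ.conf t k = some (pathNode ord u v j, l) →
    j ≤ k ∧ ∀ i, i < j → ∃ b, (splitStmts Q ord u v)[i]? = some b ∧ τ.Performs t (k - j + i) b := by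
  intro j
  induction j with
  | zero =>
    intro k l _ _
    exact ⟨Nat.zero_le k, fun i hi => absurd hi (by omega)⟩
  | succ j ih =>
    intro k l hj hconf
    cases k with
    | zero =>
      -- Initial and created threads start at a node of `Q`, never inside a path.
      exfalso
      rw [pathNode_inner ord (by omega)] at hconf
      by_cases ht : t = []
      · subst ht
        rw [h.init] at hconf
        cases (Prod.mk.inj (Option.some.inj hconf)).1
      · obtain ⟨e, he, -⟩ := h.created t ht (Option.isSome_of_eq_some hconf)
        obtain ⟨_, _, T, -, -, -, h4⟩ := h.create_spec _ _ he
        simp only at h4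
        rw [h4] at hconf
        cases (Prod.mk.inj (Option.some.inj hconf)).1
    | succ k =>
      obtain ⟨l₁, a, l₂, x, y, h1, h2, h3⟩ := h.path t k (Option.isSome_of_eq_some hconf)
      obtain ⟨u', v', j', rfl, rfl, h4⟩ := (splitEdge_iff ord).1 h3
      rw [h2] at hconf
      obtain ⟨rfl, rfl, rfl⟩ :=
        pathNode_succ_inj ord hj (Prod.mk.inj (Option.some.inj hconf)).1.symm
      obtain ⟨h5, h6⟩ := ih (by omega) h1
      refine ⟨by omega, fun i hi => ?_⟩
      rw [show k + 1 - (j + 1) + i = k - j + i by omega]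
      rcases Nat.lt_succ_iff_lt_or_eq.1 hi with h7 | rfl
      · exact h6 i h7
      · refine ⟨a, h4, ?_⟩
        rw [Nat.sub_add_cancel h5]
        exact ⟨_, _, _, _, h1, h2, h3⟩

/-- In the split program every global is protected by its dedicated mutex. -/
theorem protected_split : Protected (split Q ord) Sum.inr := by
  intro τ h t k x l y b g hconf hedge hg
  obtain ⟨u, v, j, rfl, rfl, hb⟩ := (splitEdge_iff ord).1 hedge
  obtain ⟨h1, h2⟩ := performs_of_pathNode ord h (List.getElem?_eq_some_iff.1 hb).1 hconf
  obtain ⟨a, ha⟩ := exists_edge_of_splitStmts ord hb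
  rw [splitStmts_of_edge ord ha] at hb h2
  rcases a.expand_cases ord hb with ⟨_, rfl⟩ | ⟨i, hi, rfl, rfl⟩ | ⟨_, _, _, rfl⟩
  · exact absurd hg List.not_mem_nil
  · have hmem : g ∈ a.accessed ord :=
      (a.mem_accessed ord).2 ⟨_, List.getElem_mem hi, Stmt.accessed_addMutexes a.stmts[i] ▸ hg⟩
    obtain ⟨r, hr', rfl⟩ := List.getElem_of_mem hmem
    have hr : r < (a.accessed ord).length := hr'
    have hget : ∀ j, j < (a.accessed ord).length + i → ∃ b, (a.expand ord)[j]? = some b ∧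
        τ.Performs t (k - ((a.accessed ord).length + i) + j) b := h2
    -- The path was entered `(a.accessed ord).length + i` steps ago, and its statement with index
    -- `r` locks the mutex of the `r`-th accessed global.
    refine ⟨k - ((a.accessed ord).length + i) + r, by omega, ?_, fun m hm hmk hun => ?_⟩
    · obtain ⟨b, h3, h4⟩ := hget r (by omega)
      rw [a.expand_getElem?_lock ord hr] at h3
      rwa [← Option.some.inj h3] at h4
    · obtain ⟨b, h3, h4⟩ := hget (m - (k - ((a.accessed ord).length + i))) (by omega)
      rw [show k - ((a.accessed ord).length + i) + (m - (k - ((a.accessed ord).length + i))) = m by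
        omega] at h4
      obtain rfl := h4.unique hun
      -- Among the statements passed so far there is no unlock of a dedicated mutex: those of the
      -- action itself unlock mutexes tagged `inl`, and the final unlocks come after position `i`.
      rcases a.expand_cases ord h3 with ⟨_, h5⟩ | ⟨i', hi', -, h5⟩ | ⟨r', hr', h5, -⟩
      · cases h5
      · cases hst : a.stmts[i'] <;> rw [hst] at h5 <;> cases h5
      · omega
  · exact absurd hg List.not_mem_nil

end CriticalSections

/-! ### Interleavings as runs of the split program -/

section InterleavingsToMachines

section Statements

variable {G X : Decls.{u}} {M T : Type u}

theorem Stmt.eval_addMutexes (a : Stmt G X M T) (x : LState X × G.Val) :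
    a.addMutexes.eval x = a.eval x := by
  rcases a with (_ | _ | _ | _) | _ | _ | _ | _ | _ <;> rfl

theorem Stmt.count_addMutexes (a : Stmt G X M T) (t : Tid) (C : Tid → ℕ) :
    a.addMutexes.count t C = a.count t C := by
  rcases a with (_ | _ | _ | _) | _ | _ | _ | _ | _ <;> rfl

theorem Stmt.own_addMutexes_inl (a : Stmt G X M T) (t : Tid) (own : M ⊕ G.Name → Option Tid)
    (m : M) : a.addMutexes.own t own (.inl m) = a.own t (fun m => own (.inl m)) m := by
  classical
  rcases a with (_ | _ | _ | _) | m' | m' | _ | _ | _ <;> try rfl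
  all_goals
    by_cases hm : m = m'
    · subst hm
      simp [Stmt.own, Stmt.addMutexes]
    · simp [Stmt.own, Stmt.addMutexes, hm]

theorem Stmt.own_addMutexes_inr (a : Stmt G X M T) (t : Tid) (own : M ⊕ G.Name → Option Tid)
    (g : G.Name) : a.addMutexes.own t own (.inr g) = own (.inr g) := by
  rcases a with (_ | _ | _ | _) | m' | m' | _ | _ | _ <;> simp [Stmt.own, Stmt.addMutexes]

theorem Stmt.own_lock_self (m : M) (t : Tid) (own : M → Option Tid) :
    (Stmt.lock m : Stmt G X M T).own t own m = some t := by
  simp [Stmt.own]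

theorem Stmt.own_lock_of_ne {m m' : M} (t : Tid) (own : M → Option Tid) (h : m' ≠ m) :
    (Stmt.lock m : Stmt G X M T).own t own m' = own m' := by
  simp [Stmt.own, h]

theorem Stmt.own_unlock_self (m : M) (t : Tid) (own : M → Option Tid) :
    (Stmt.unlock m : Stmt G X M T).own t own m = none := by
  simp [Stmt.own]

theorem Stmt.own_unlock_of_ne {m m' : M} (t : Tid) (own : M → Option Tid) (h : m' ≠ m) :
    (Stmt.unlock m : Stmt G X M T).own t own m' = own m' := by
  simp [Stmt.own, h]

theorem Stmt.addMutexes_eq_create {a : Stmt G X M T} {t : T} :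
    a.addMutexes = .create t ↔ a = .create t := by
  rcases a with (_ | _ | _ | _) | _ | _ | _ | _ | _ <;> simp [Stmt.addMutexes]

theorem Stmt.addMutexes_eq_assert {a : Stmt G X M T} {p : LState X → Bool} :
    a.addMutexes = .simple (.assert p) ↔ a = .simple (.assert p) := by
  rcases a with (_ | _ | _ | _) | _ | _ | _ | _ | _ <;> simp [Stmt.addMutexes]

theorem Stmt.admissible_addMutexes (a : Stmt G X M T) (t : Tid) (l : LState X)
    (own : M ⊕ G.Name → Option Tid) :
    a.addMutexes.Admissible t l own ↔ a.Admissible t l (fun m => own (.inl m)) := by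
  rcases a with (_ | _ | _ | _) | _ | _ | _ | _ | _ <;> rfl

theorem Stmt.self_eval (a : Stmt G X M T) (x : LState X × G.Val) : (a.eval x).1.self = x.1.self := by
  rcases a with (_ | _ | _ | _) | _ | _ | _ | _ | _ <;> rfl

/-- The effect of a sequence of statements on the local state and the globals. -/
def evalAll (as : List (Stmt G X M T)) (x : LState X × G.Val) : LState X × G.Val :=
  as.foldl (fun x a => a.eval x) x

theorem evalAll_cons (a : Stmt G X M T) (as : List (Stmt G X M T)) (x : LState X × G.Val) :
    evalAll (a :: as) x = evalAll as (a.eval x) := rfl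

theorem Action.getElem_stmts_zero (a : Action G X M T) :
    a.stmts[0]'a.length_stmts_pos = a.first := by
  cases a <;> rfl

theorem Action.exists_getElem_stmts_succ (a : Action G X M T) {k : ℕ}
    (hk : k + 1 < a.stmts.length) : ∃ b, a.stmts[k + 1] = .simple b := by
  cases a with
  | base a => simp [Action.stmts] at hk
  | atomic a as => exact ⟨as[k]'(by simpa [Action.stmts] using hk), by simp [Action.stmts]⟩

end Statements

/-! ### Effects of statements in the interleaving semantics -/

section Effects

variable {Q : LangAtomic.{u}} {t : Tid} {n v : Q.Node} {c : Tid} {s : State Q} {l : LState Q.loc}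

theorem effect_L_self (hL : s.L t = some (n, l)) (hc : c ≠ t)
    (a : Stmt Q.glob Q.loc Q.Mutex Q.Templ) :
    (Stmt.effect t v c s a).L t = some (v, (a.eval (l, s.G)).1) := by
  rcases a with (_ | _ | _ | _) | _ | _ | _ | _ | _ <;>
    simp [Stmt.effect, hL, Stmt.eval, Function.update_of_ne hc.symm]

theorem effect_L_of_ne (hL : s.L t = some (n, l)) {a : Stmt Q.glob Q.loc Q.Mutex Q.Templ}
    {t' : Tid} (ht : t' ≠ t) (hc : (∃ T, a = .create T) → t' ≠ c) :
    (Stmt.effect t v c s a).L t' = s.L t' := by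
  rcases a with (_ | _ | _ | _) | _ | _ | T | _ | _ <;> simp only [Stmt.effect, hL] <;>
    try exact Function.update_of_ne ht _ _
  rw [Function.update_of_ne (hc ⟨T, rfl⟩), Function.update_of_ne ht]

theorem effect_L_create (hL : s.L t = some (n, l)) (T : Q.Templ) :
    (Stmt.effect t v c s (.create T)).L c = some (Q.start T, ⟨c, l.vars⟩) := by
  simp [Stmt.effect, hL]

theorem effect_M (hL : s.L t = some (n, l)) (a : Stmt Q.glob Q.loc Q.Mutex Q.Templ) :
    (Stmt.effect t v c s a).M = a.own t s.M := by
  rcases a with (_ | _ | _ | _) | _ | _ | _ | _ | _ <;> simp [Stmt.effect, hL, Stmt.own]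

theorem effect_G (hL : s.L t = some (n, l)) (a : Stmt Q.glob Q.loc Q.Mutex Q.Templ) :
    (Stmt.effect t v c s a).G = (a.eval (l, s.G)).2 := by
  rcases a with (_ | _ | _ | _) | _ | _ | _ | _ | _ <;> simp [Stmt.effect, hL, Stmt.eval]

theorem effects_cons (a : Stmt Q.glob Q.loc Q.Mutex Q.Templ)
    (as : List (Stmt Q.glob Q.loc Q.Mutex Q.Templ)) :
    effects t v c s (a :: as) = effects t v c (Stmt.effect t v c s a) as := rfl

theorem effects_concat (a : Stmt Q.glob Q.loc Q.Mutex Q.Templ)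
    (as : List (Stmt Q.glob Q.loc Q.Mutex Q.Templ)) :
    effects t v c s (as ++ [a]) = Stmt.effect t v c (effects t v c s as) a := by
  simp [effects]

/-- The acting thread sees only its local state and the globals, which evolve by `evalAll`. The
condition `c ≠ t` keeps a create action from overwriting the creator. -/
theorem effects_self (hc : c ≠ t) (as : List (Stmt Q.glob Q.loc Q.Mutex Q.Templ)) :
    ∀ {s : State Q} {n : Q.Node} {l : LState Q.loc}, s.L t = some (n, l) →
    (∃ n', (effects t v c s as).L t = some (n', (evalAll as (l, s.G)).1) ∧ (as ≠ [] → n' = v)) ∧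
      (effects t v c s as).G = (evalAll as (l, s.G)).2 := by
  induction as with
  | nil => exact fun hL => ⟨⟨_, hL, by simp⟩, rfl⟩
  | cons a as ih =>
    intro s n l hL
    have h1 := effect_L_self (v := v) hL hc a
    obtain ⟨⟨n', h2, h3⟩, h4⟩ := ih h1
    rw [effect_G hL] at h2 h4
    refine ⟨⟨n', h2, fun _ => ?_⟩, h4⟩
    by_cases has : as = []
    · subst has
      have h5 := h1.symm.trans h2
      exact (Prod.mk.inj (Option.some.inj h5)).1.symm
    · exact h3 has

/-- Used for the statements after the first one of an action: mutexes and the other threads are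
affected by the first statement only. -/
theorem effects_simple_M (hc : c ≠ t) (as : List (SimpleStmt Q.glob Q.loc)) :
    ∀ {s : State Q} {n : Q.Node} {l : LState Q.loc}, s.L t = some (n, l) →
    (effects t v c s (as.map .simple)).M = s.M ∧
      ∀ t', t' ≠ t → (effects t v c s (as.map .simple)).L t' = s.L t' := by
  induction as with
  | nil => exact fun _ => ⟨rfl, fun _ _ => rfl⟩
  | cons a as ih =>
    intro s n l hL
    obtain ⟨h1, h2⟩ := ih (effect_L_self (v := v) hL hc (.simple a))
    refine ⟨h1.trans (effect_M hL _), fun t' ht => (h2 t' ht).trans (effect_L_of_ne hL ht ?_)⟩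
    rintro ⟨T, hT⟩
    cases hT

/-- All threads know their own ids. -/
def State.SelfConsistent (s : State Q) : Prop :=
  ∀ t n l, s.L t = some (n, l) → l.self = t

theorem State.SelfConsistent.effect (h : s.SelfConsistent) (hc : c ≠ t)
    (a : Stmt Q.glob Q.loc Q.Mutex Q.Templ) : (Stmt.effect t v c s a).SelfConsistent := by
  intro t' n' l' hL'
  cases hL : s.L t with
  | none =>
    simp only [Stmt.effect, hL] at hL'
    exact h _ _ _ hL'
  | some x =>
    obtain ⟨n, l⟩ := x
    by_cases ht : t' = t
    · subst ht
      rw [effect_L_self hL hc] at hL'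
      rw [← (Prod.mk.inj (Option.some.inj hL')).2, Stmt.self_eval]
      exact h _ _ _ hL
    · by_cases hcr : (∃ T, a = .create T) ∧ t' = c
      · obtain ⟨⟨T, rfl⟩, rfl⟩ := hcr
        rw [effect_L_create hL] at hL'
        rw [← (Prod.mk.inj (Option.some.inj hL')).2]
      · rw [effect_L_of_ne hL ht fun h1 h2 => hcr ⟨h1, h2⟩] at hL'
        exact h _ _ _ hL'

theorem State.SelfConsistent.effects (hc : c ≠ t)
    (as : List (Stmt Q.glob Q.loc Q.Mutex Q.Templ)) :
    ∀ {s : State Q}, s.SelfConsistent → (effects t v c s as).SelfConsistent := by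
  induction as with
  | nil => exact fun h => h
  | cons a as ih => exact fun h => ih (h.effect hc a)

/-- The number of threads that each thread creates in the steps `i`. -/
def creates (i : List (Step Q)) (t : Tid) : ℕ := by
  classical exact i.countP fun st => decide (st.thread = t ∧ st.act.first.IsCreate)

theorem newTid_eq (i : List (Step Q)) (t : Tid) : newTid t i = t ++ [creates i t] := by
  unfold newTid creates
  congr!

theorem newTid_ne (i : List (Step Q)) (t : Tid) : newTid t i ≠ t := by
  simp [newTid]

/-- Only the first statement of an action can create a thread, so the history count of the
interleaving semantics is the counter of the machine. -/
theorem creates_concat (i : List (Step Q)) (st : Step Q) :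
    creates (i ++ [st]) = st.act.first.count st.thread (creates i) := by
  classical
  funext t
  have h1 : creates (i ++ [st]) t =
      creates i t + if st.thread = t ∧ st.act.first.IsCreate then 1 else 0 := by
    simp [creates, List.countP_append, List.countP_singleton]
  rw [h1]
  by_cases hc : ∃ T, st.act.first = .create T
  · obtain ⟨T, hT⟩ := hc
    rw [hT]
    by_cases ht : t = st.thread
    · subst ht
      simp [Stmt.IsCreate, Stmt.count]
    · rw [Stmt.count_of_ne _ _ ht]
      simp [Ne.symm ht]
  · have h2 : ¬ st.act.first.IsCreate := by
      intro h3
      cases h4 : st.act.first with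
      | create T => exact hc ⟨T, h4⟩
      | _ => simp [h4, Stmt.IsCreate] at h3
    have h3 : st.act.first.count st.thread (creates i) = creates i := by
      unfold Stmt.count
      split
      · rename_i h4
        exact absurd ⟨_, h4⟩ hc
      · rfl
    rw [h3]
    simp [h2]

theorem Interleaving.selfConsistent {i : List (Step Q)} (h : Interleaving Q i s) :
    s.SelfConsistent := by
  induction h with
  | init =>
    intro t n l hL
    simp only [State.initial, Option.ite_none_right_eq_some, Option.some.injEq, Prod.mk.injEq] at hL
    obtain ⟨rfl, -, rfl⟩ := hL
    rfl
  | extend t u v a l hi hedge hloc hadm ih =>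
    rw [ih _ _ _ hloc]
    exact State.SelfConsistent.effects (newTid_ne _ t) _ ih

theorem Interleaving.exists_prefix {i : List (Step Q)} (h : Interleaving Q i s) :
    ∀ {i₁ i₂ : List (Step Q)} {st : Step Q}, i = i₁ ++ st :: i₂ →
    Interleaving Q i₁ st.src ∧ Q.edge st.u st.v = some st.act ∧
      ∃ l, st.src.L st.thread = some (st.u, l) ∧ st.act.first.Admissible st.thread l st.src.M := by
  induction h with
  | init =>
    intro i₁ i₂ st h
    simp at h
  | extend t u v a l hi hedge hloc hadm ih =>
    intro i₁ i₂ st h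
    rcases List.eq_nil_or_concat i₂ with rfl | ⟨i₂, x, rfl⟩
    · obtain ⟨rfl, h2⟩ := List.append_inj' h rfl
      obtain rfl := (List.cons.inj h2).1
      exact ⟨hi, hedge, l, hloc, hadm⟩
    · rw [List.concat_eq_append, ← List.cons_append, ← List.append_assoc] at h
      exact ih (List.append_inj' h rfl).1

end Effects

variable {Q : LangAtomic.{u}} (ord : LinearOrder Q.glob.Name)

open Classical in
/-- The configuration `s` as a configuration of the split program in which `t` is at `x` and holds the
mutexes dedicated to the globals in `H`. -/
def embed (s : State Q) (C : Tid → ℕ) (t : Tid) (x : SplitNode Q ord) (H : List Q.glob.Name) :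
    Machine (split Q ord) where
  L t' := (s.L t').map fun y => (if t' = t then x else .inl y.1, y.2)
  M := Sum.elim s.M fun g => if g ∈ H then some t else none
  G := s.G
  C := C

/-- The configuration `s` as a configuration of the split program. -/
def embedIdle (s : State Q) (C : Tid → ℕ) : Machine (split Q ord) where
  L t' := (s.L t').map fun y => (.inl y.1, y.2)
  M := Sum.elim s.M fun _ => none
  G := s.G
  C := C

/-! ### Single machine steps between embedded configurations -/

section Embed

variable {s : State Q} {C : Tid → ℕ} {t : Tid} {n : Q.Node} {l : LState Q.loc}
  {x y : SplitNode Q ord} {H H' : List Q.glob.Name}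

theorem embed_L_self (hL : s.L t = some (n, l)) : (embed ord s C t x H).L t = some (x, l) := by
  change (s.L t).map _ = _
  rw [hL]
  simp only [Option.map_some]
  rfl

theorem embed_inl_nil (hL : s.L t = some (n, l)) :
    embed ord s C t (.inl n) [] = embedIdle ord s C := by
  refine Machine.ext ?_ ?_ rfl rfl
  · funext t'
    by_cases ht : t' = t
    · subst ht
      refine (embed_L_self ord hL).trans ?_
      change _ = (s.L t').map _
      rw [hL]
      rfl
    · change (s.L t').map _ = (s.L t').map _
      simp [ht]
  · funext m
    rcases m with m | g
    · rfl
    · change (if g ∈ [] then some t else none) = none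
      simp

/-- Lists of held mutexes matter only through membership, so `H'` is fixed only up to that. -/
theorem embed_lock (hL : s.L t = some (n, l)) {g : Q.glob.Name}
    (hH : ∀ g', g' ∈ H' ↔ g' = g ∨ g' ∈ H) :
    (embed ord s C t x H).step t y l (.lock (.inr g)) = embed ord s C t y H' := by
  classical
  refine Machine.ext ?_ ?_ rfl rfl
  · funext t'
    by_cases ht : t' = t
    · subst ht
      change (embed ord s C t' x H).moves t' y l (.lock (.inr g)) t' = _
      refine (Machine.moves_self ..).trans ?_
      exact (embed_L_self ord hL).symm
    · change (embed ord s C t x H).moves t y l (.lock (.inr g)) t' = _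
      refine (Machine.moves_of_ne _ _ _ _ ht ?_).trans ?_
      · rintro ⟨T, hT⟩
        cases hT
      change (s.L t').map _ = (s.L t').map _
      simp [ht]
  · funext m
    rcases m with m | g'
    · exact Stmt.own_lock_of_ne (G := Q.glob) (X := Q.loc) (T := Q.Templ) t
        (embed ord s C t x H).M (m := .inr g) (m' := .inl m) nofun
    · by_cases hg : g' = g
      · subst hg
        refine (Stmt.own_lock_self (G := Q.glob) (X := Q.loc) (T := Q.Templ) (.inr g') t
          (embed ord s C t x H).M).trans ?_
        change some t = if g' ∈ H' then some t else none
        rw [if_pos ((hH g').2 (.inl rfl))]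
      · refine (Stmt.own_lock_of_ne (G := Q.glob) (X := Q.loc) (T := Q.Templ) t
          (embed ord s C t x H).M (m := .inr g) (m' := .inr g')
          fun h => hg (Sum.inr.inj h)).trans ?_
        change (if g' ∈ H then some t else none) = if g' ∈ H' then some t else none
        simp [hH, hg]

theorem embed_unlock (hL : s.L t = some (n, l)) {g : Q.glob.Name}
    (hH : ∀ g', g' ∈ H' ↔ g' ≠ g ∧ g' ∈ H) :
    (embed ord s C t x H).step t y l (.unlock (.inr g)) = embed ord s C t y H' := by
  classical
  refine Machine.ext ?_ ?_ rfl rfl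
  · funext t'
    by_cases ht : t' = t
    · subst ht
      change (embed ord s C t' x H).moves t' y l (.unlock (.inr g)) t' = _
      refine (Machine.moves_self ..).trans ?_
      exact (embed_L_self ord hL).symm
    · change (embed ord s C t x H).moves t y l (.unlock (.inr g)) t' = _
      refine (Machine.moves_of_ne _ _ _ _ ht ?_).trans ?_
      · rintro ⟨T, hT⟩
        cases hT
      change (s.L t').map _ = (s.L t').map _
      simp [ht]
  · funext m
    rcases m with m | g'
    · exact Stmt.own_unlock_of_ne (G := Q.glob) (X := Q.loc) (T := Q.Templ) t
        (embed ord s C t x H).M (m := .inr g) (m' := .inl m) nofun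
    · by_cases hg : g' = g
      · subst hg
        refine (Stmt.own_unlock_self (G := Q.glob) (X := Q.loc) (T := Q.Templ) (.inr g') t
          (embed ord s C t x H).M).trans ?_
        change none = if g' ∈ H' then some t else none
        rw [if_neg fun h => ((hH g').1 h).1 rfl]
      · refine (Stmt.own_unlock_of_ne (G := Q.glob) (X := Q.loc) (T := Q.Templ) t
          (embed ord s C t x H).M (m := .inr g) (m' := .inr g')
          fun h => hg (Sum.inr.inj h)).trans ?_
        change (if g' ∈ H then some t else none) = if g' ∈ H' then some t else none
        simp [hH, hg]

/-- The node `w` is arbitrary because `embed` places `t` at its own node. The id `c` has to be that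
of the next child only if the statement creates a thread. -/
theorem embed_stmt (hL : s.L t = some (n, l)) {c : Tid} (hct : c ≠ t)
    (b : Stmt Q.glob Q.loc Q.Mutex Q.Templ) (hc : (∃ T, b = .create T) → c = t ++ [C t])
    (w : Q.Node) : (embed ord s C t x H).step t y l b.addMutexes =
      embed ord (Stmt.effect t w c s b) (b.count t C) t y H := by
  classical
  refine Machine.ext ?_ ?_ ?_ (Stmt.count_addMutexes b t C)
  · funext t'
    by_cases ht : t' = t
    · subst ht
      refine (Machine.moves_self ..).trans ?_
      rw [embed_L_self ord (effect_L_self hL hct b)]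
      exact congrArg (fun z : LState Q.loc × Q.glob.Val => some (y, z.1))
        (Stmt.eval_addMutexes b (l, s.G))
    · by_cases hcr : (∃ T, b = .create T) ∧ t' = c
      · obtain ⟨⟨T, rfl⟩, rfl⟩ := hcr
        obtain rfl := hc ⟨T, rfl⟩
        refine (Machine.moves_create (embed ord s C t x H) t y l T).trans ?_
        change _ = ((Stmt.effect t w (t ++ [C t]) s (.create T)).L (t ++ [C t])).map _
        rw [effect_L_create hL]
        simp only [Option.map_some, ht]
        rfl
      · refine (Machine.moves_of_ne _ _ _ _ ht ?_).trans ?_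
        · rintro ⟨T, hT⟩ heq
          have hT' := Stmt.addMutexes_eq_create.1 hT
          exact hcr ⟨⟨T, hT'⟩, heq.trans (hc ⟨T, hT'⟩).symm⟩
        · change (s.L t').map _ = ((Stmt.effect t w c s b).L t').map _
          rw [effect_L_of_ne hL ht fun h1 h2 => hcr ⟨h1, h2⟩]
          simp [ht]
  · funext m
    rcases m with m | g
    · refine (Stmt.own_addMutexes_inl b t _ m).trans ?_
      exact (congrFun (effect_M hL b) m).symm
    · exact Stmt.own_addMutexes_inr b t _ g
  · exact (congrArg Prod.snd (Stmt.eval_addMutexes b (l, s.G))).trans (effect_G hL b).symm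

end Embed

/-! ### Uninterrupted execution of an action -/

section Blocks

variable {s : State Q} {C : Tid → ℕ} {t : Tid} {u v : Q.Node} {l : LState Q.loc}
  {a : Action Q.glob Q.loc Q.Mutex Q.Templ}

theorem reach_pathNode {σ : Machine (split Q ord)} (hσ : σ.Reach) {j : ℕ}
    {b : Stmt Q.glob Q.loc (Q.Mutex ⊕ Q.glob.Name) Q.Templ} (hedge : Q.edge u v = some a)
    (hb : (a.expand ord)[j]? = some b) (hL : σ.L t = some (pathNode ord u v j, l))
    (hadm : b.Admissible t l σ.M) : (σ.step t (pathNode ord u v (j + 1)) l b).Reach :=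
  hσ.step hL ((splitEdge_iff ord).2 ⟨u, v, j, rfl, rfl, by rwa [splitStmts_of_edge ord hedge]⟩) hadm

/-- The dedicated mutexes are all free at the start, nobody else moves, and the accessed globals are
listed without repetitions, so no lock is blocked. -/
theorem reach_locked (hs : (embedIdle ord s C).Reach) (hL : s.L t = some (u, l))
    (hedge : Q.edge u v = some a) {j : ℕ} (hj : j ≤ (a.accessed ord).length) :
    (embed ord s C t (pathNode ord u v j) ((a.accessed ord).take j)).Reach := by
  induction j with
  | zero =>
    rw [pathNode_zero, List.take_zero, embed_inl_nil ord hL]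
    exact hs
  | succ j ih =>
    have hget := a.expand_getElem?_lock ord hj
    have h1 := reach_pathNode ord (ih (by omega)) hedge hget (embed_L_self ord hL) (by
      change (if (a.accessed ord)[j] ∈ (a.accessed ord).take j then some t else none) = none
      rw [if_neg]
      intro hmem
      obtain ⟨i, hi, heq⟩ := List.mem_take_iff_getElem.1 hmem
      have := (a.nodup_accessed ord).getElem_inj_iff.1 heq
      omega)
    refine (congrArg Machine.Reach (embed_lock ord hL fun g' => ?_)).mp h1
    rw [← List.take_concat_get' _ _ hj]
    simp only [List.mem_append, List.mem_singleton, or_comm]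

/-- Only the first statement can be blocked or create a thread; this explains the hypothesis on
`a.first` and the counter, which changes between `k = 0` and `k = 1` and then stays. The
intermediate configurations are also needed to locate violations inside an action. -/
theorem reach_stmts (hs : (embedIdle ord s C).Reach) (hL : s.L t = some (u, l))
    (hedge : Q.edge u v = some a) (hadm : a.first.Admissible t l s.M) {k : ℕ}
    (hk : k ≤ a.stmts.length) :
    (embed ord (effects t v (t ++ [C t]) s (a.stmts.take k))
      (if k = 0 then C else a.first.count t C) t
      (pathNode ord u v ((a.accessed ord).length + k)) (a.accessed ord)).Reach := by
  have hct : t ++ [C t] ≠ t := by simp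
  induction k with
  | zero =>
    have h1 := reach_locked ord hs hL hedge le_rfl
    rw [List.take_length] at h1
    exact h1
  | succ k ih =>
    have hget := a.expand_getElem?_stmt ord hk
    obtain ⟨⟨n', h2, -⟩, -⟩ := effects_self (v := v) hct (a.stmts.take k) hL
    have h3 : (∃ T, a.stmts[k] = .create T) → k = 0 := by
      rintro ⟨T, hT⟩
      cases k with
      | zero => rfl
      | succ k =>
        obtain ⟨b, hb⟩ := a.exists_getElem_stmts_succ hk
        rw [hb] at hT
        cases hT
    have h4 := reach_pathNode ord (ih (by omega)) hedge hget (embed_L_self ord h2) (by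
      refine (Stmt.admissible_addMutexes _ _ _ _).2 ?_
      cases k with
      | zero =>
        rw [a.getElem_stmts_zero]
        exact hadm
      | succ k =>
        obtain ⟨b, hb⟩ := a.exists_getElem_stmts_succ hk
        rw [hb]
        trivial)
    rw [embed_stmt ord h2 hct _ (fun hT => by rw [h3 hT, if_pos rfl]) v, ← effects_concat,
      List.take_concat_get' _ _ hk] at h4
    have hcount : (if k + 1 = 0 then C else a.first.count t C) =
        a.stmts[k].count t (if k = 0 then C else a.first.count t C) := by
      rw [if_neg (by omega)]
      cases k with
      | zero => rw [a.getElem_stmts_zero, if_pos rfl]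
      | succ k =>
        obtain ⟨b, hb⟩ := a.exists_getElem_stmts_succ hk
        rw [hb, if_neg (by omega)]
        rfl
    rw [hcount]
    exact h4

/-- Unlocking in reverse order leaves an initial segment of the accessed globals locked. -/
theorem reach_unlocked (hs : (embedIdle ord s C).Reach) (hL : s.L t = some (u, l))
    (hedge : Q.edge u v = some a) (hadm : a.first.Admissible t l s.M) {r : ℕ}
    (hr : r ≤ (a.accessed ord).length) :
    (embed ord (effects t v (t ++ [C t]) s a.stmts) (a.first.count t C) t
      (pathNode ord u v ((a.accessed ord).length + a.stmts.length + r))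
      ((a.accessed ord).take ((a.accessed ord).length - r))).Reach := by
  have hct : t ++ [C t] ≠ t := by simp
  obtain ⟨⟨n', h2, -⟩, -⟩ := effects_self (v := v) hct a.stmts hL
  induction r with
  | zero =>
    have h1 := reach_stmts ord hs hL hedge hadm le_rfl
    rw [List.take_length, if_neg a.length_stmts_pos.ne'] at h1
    simpa using h1
  | succ r ih =>
    have hget := a.expand_getElem?_unlock ord hr
    have hlt : (a.accessed ord).length - 1 - r < (a.accessed ord).length := by omega
    have h1 := List.take_concat_get' _ _ hlt
    rw [show (a.accessed ord).length - 1 - r + 1 = (a.accessed ord).length - r by omega] at h1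
    have h4 := reach_pathNode ord (ih (by omega)) hedge hget (embed_L_self ord h2) (by
      change (if (a.accessed ord)[(a.accessed ord).length - 1 - r] ∈
        (a.accessed ord).take ((a.accessed ord).length - r) then some t else none) = some t
      rw [if_pos]
      rw [← h1]
      exact List.mem_append_right _ (List.mem_singleton_self _))
    refine (congrArg Machine.Reach (embed_unlock ord h2 fun g' => ?_)).mp h4
    rw [← h1, show (a.accessed ord).length - (r + 1) = (a.accessed ord).length - 1 - r by omega]
    simp only [List.mem_append, List.mem_singleton]
    constructor
    · intro hmem
      refine ⟨?_, .inl hmem⟩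
      rintro rfl
      obtain ⟨i, hi, heq⟩ := List.mem_take_iff_getElem.1 hmem
      have := (a.nodup_accessed ord).getElem_inj_iff.1 heq
      omega
    · rintro ⟨h5, h6 | h6⟩
      · exact h6
      · exact absurd h6 h5

theorem reach_block (hs : (embedIdle ord s C).Reach) (hL : s.L t = some (u, l))
    (hedge : Q.edge u v = some a) (hadm : a.first.Admissible t l s.M) :
    (embedIdle ord (effects t v (t ++ [C t]) s a.stmts) (a.first.count t C)).Reach := by
  have hct : t ++ [C t] ≠ t := by simp
  obtain ⟨⟨n', h2, h3⟩, -⟩ := effects_self (v := v) hct a.stmts hL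
  obtain rfl := h3 (List.ne_nil_of_length_pos a.length_stmts_pos)
  have h1 := reach_unlocked ord hs hL hedge hadm le_rfl
  rwa [Nat.sub_self, List.take_zero, pathNode_last ord, embed_inl_nil ord h2] at h1
  · have := a.length_stmts_pos
    omega
  · rw [splitStmts_of_edge ord hedge, a.length_expand]

end Blocks

theorem Interleaving.reach {i : List (Step Q)} {s : State Q} (h : Interleaving Q i s) :
    (embedIdle ord s (creates i)).Reach := by
  induction h with
  | init =>
    convert Machine.Reach.init (P := split Q ord) using 1
    refine Machine.ext ?_ ?_ rfl ?_
    · funext t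
      change (if t = [] then some (Q.start Q.main, Q.initLoc) else none).map _ =
        if t = [] then some (Sum.inl (Q.start Q.main), Q.initLoc) else none
      split <;> rfl
    · funext m
      rcases m with m | g <;> rfl
    · funext t
      simp [embedIdle, Machine.initial, creates]
  | extend t u v a l hi hedge hloc hadm ih =>
    rw [hi.selfConsistent _ _ _ hloc, newTid_eq, creates_concat]
    exact reach_block ord ih hloc hedge hadm

/-- A violation in an interleaving yields a reachable configuration of the split program in which an
assertion is about to be violated. -/
theorem Interleaving.exists_bad {i : List (Step Q)} {s : State Q} (h : Interleaving Q i s)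
    (hv : ViolatedIn i) : ∃ σ : Machine (split Q ord), σ.Reach ∧ σ.Bad := by
  obtain ⟨i₁, i₂, st, hi, as, bs, p, hst, n, l, hloc, hp⟩ := hv
  obtain ⟨h1, h2, l₀, h3, h4⟩ := h.exists_prefix hi
  have hlen : as.length < st.act.stmts.length := by
    rw [hst]
    simp
  have h5 := reach_stmts ord (h1.reach ord) h3 h2 h4 hlen.le
  have htake : st.act.stmts.take as.length = as := by
    rw [hst]
    simp
  rw [htake, ← newTid_eq] at h5
  refine ⟨_, h5, st.thread, _, pathNode ord st.u st.v ((st.act.accessed ord).length + as.length + 1),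
    l, p, embed_L_self ord hloc, ?_, hp⟩
  refine (splitEdge_iff ord).2 ⟨_, _, _, rfl, rfl, ?_⟩
  rw [splitStmts_of_edge ord h2, st.act.expand_getElem?_stmt ord hlen]
  simp only [hst, List.getElem_append_right le_rfl, Nat.sub_self, List.getElem_cons_zero]
  rfl

end InterleavingsToMachines

/-! ### Runs of the split program as interleavings -/

section MachinesToInterleavings

section Statements

variable {G X : Decls.{u}} {M T : Type u}

theorem Stmt.eval_congr {a : Stmt G X M T} {K : G.Name → Prop} (ha : ∀ g ∈ a.accessed, K g)
    {x x' : G.Val} (hx : ∀ g, K g → x g = x' g) (l : LState X) :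
    (a.eval (l, x)).1 = (a.eval (l, x')).1 ∧
      ∀ g, K g → (a.eval (l, x)).2 g = (a.eval (l, x')).2 g := by
  constructor
  · rcases a with (_ | ⟨g, f⟩ | _ | _) | _ | _ | _ | _ | _ <;> try rfl
    simp only [Stmt.eval]
    rw [hx g (ha g (by simp [Stmt.accessed]))]
  · intro g hg
    rcases a.eval_snd l x g with ⟨f, rfl, h1⟩ | ⟨h1, h2⟩
    · rcases Stmt.eval_snd (.simple (.write g f) : Stmt G X M T) l x' g with ⟨f', h3, h4⟩ | ⟨h3, -⟩
      · rw [h1, h4]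
        simp only [Stmt.simple.injEq, SimpleStmt.write.injEq, heq_eq_eq, true_and] at h3
        rw [h3]
      · exact absurd rfl (h3 f)
    · rcases a.eval_snd l x' g with ⟨f, h3, -⟩ | ⟨-, h4⟩
      · exact absurd h3 (h1 f)
      · rw [h2, h4, hx g hg]

/-- Applied with `K` the globals whose mutexes a thread holds: pending statements access no others,
so their outcome is insensitive to what the other threads write. -/
theorem evalAll_congr {K : G.Name → Prop} {as : List (Stmt G X M T)} :
    (∀ a ∈ as, ∀ g ∈ a.accessed, K g) → ∀ {x x' : G.Val}, (∀ g, K g → x g = x' g) →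
    ∀ (l : LState X), (evalAll as (l, x)).1 = (evalAll as (l, x')).1 ∧
      ∀ g, K g → (evalAll as (l, x)).2 g = (evalAll as (l, x')).2 g := by
  induction as with
  | nil => exact fun _ _ _ hx _ => ⟨rfl, hx⟩
  | cons a as ih =>
    intro ha x x' hx l
    obtain ⟨h1, h2⟩ := Stmt.eval_congr (ha a List.mem_cons_self) hx l
    simp only [evalAll_cons]
    have h3 := ih (fun b hb => ha b (List.mem_cons_of_mem _ hb)) h2 (a.eval (l, x)).1
    rw [show a.eval (l, x') = ((a.eval (l, x)).1, (a.eval (l, x')).2) from Prod.ext h1.symm rfl]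
    exact h3

theorem Stmt.eval_of_notMem {a : Stmt G X M T} {g : G.Name} (hg : g ∉ a.accessed) (l : LState X)
    (x : G.Val) : (a.eval (l, x)).2 g = x g := by
  rcases a.eval_snd l x g with ⟨f, rfl, -⟩ | ⟨-, h⟩
  · simp [Stmt.accessed] at hg
  · exact h

theorem evalAll_of_notMem {as : List (Stmt G X M T)} {g : G.Name} :
    (∀ a ∈ as, g ∉ a.accessed) → ∀ (l : LState X) (x : G.Val), (evalAll as (l, x)).2 g = x g := by
  induction as with
  | nil => exact fun _ _ _ => rfl
  | cons a as ih =>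
    intro ha l x
    exact (ih (fun b hb => ha b (List.mem_cons_of_mem _ hb)) _ _).trans
      (Stmt.eval_of_notMem (ha a List.mem_cons_self) l x)

/-- No assertion is violated when the statements are executed. -/
def AssertsHold (as : List (Stmt G X M T)) (x : LState X × G.Val) : Prop :=
  ∀ as₁ as₂ p, as = as₁ ++ .simple (.assert p) :: as₂ → p (evalAll as₁ x).1 = true

theorem AssertsHold.tail {a : Stmt G X M T} {as : List (Stmt G X M T)} {x : LState X × G.Val}
    (h : AssertsHold (a :: as) x) : AssertsHold as (a.eval x) := by
  rintro as₁ as₂ p rfl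
  exact h (a :: as₁) as₂ p rfl

theorem AssertsHold.congr {K : G.Name → Prop} {as : List (Stmt G X M T)}
    (has : ∀ a ∈ as, ∀ g ∈ a.accessed, K g) {x x' : G.Val} (hx : ∀ g, K g → x g = x' g)
    {l : LState X} (h : AssertsHold as (l, x)) : AssertsHold as (l, x') := by
  rintro as₁ as₂ p rfl
  rw [← (evalAll_congr (fun a ha => has a (List.mem_append_left _ ha)) hx l).1]
  exact h as₁ as₂ p rfl

end Statements

theorem Machine.step_L_self {P : Lang.{u}} (σ : Machine P) (t : Tid) (v : P.Node)
    (l : LState P.loc) (a : Stmt P.glob P.loc P.Mutex P.Templ) :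
    (σ.step t v l a).L t = some (v, (a.eval (l, σ.G)).1) :=
  σ.moves_self t v l a

theorem Machine.step_L_of_ne {P : Lang.{u}} (σ : Machine P) {t t' : Tid} (v : P.Node)
    (l : LState P.loc) (a : Stmt P.glob P.loc P.Mutex P.Templ) (hne : t' ≠ t)
    (hc : (∃ T, a = .create T) → t' ≠ σ.child t) : (σ.step t v l a).L t' = σ.L t' :=
  σ.moves_of_ne v l a hne hc

/-- Threads that have not been created yet do not exist. -/
theorem Machine.Reach.fresh {P : Lang.{u}} {σ : Machine P} (h : σ.Reach) :
    ∀ t n, σ.C t ≤ n → σ.L (t ++ [n]) = none := by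
  induction h with
  | init => simp [Machine.initial]
  | @step σ t u v l a hσ hL hedge hadm ih =>
    intro t' n hn
    simp only [Machine.step] at hn ⊢
    have hle : σ.C t' ≤ a.count t σ.C t' := by
      by_cases ht : t' = t
      · subst ht
        unfold Stmt.count
        split <;> simp
      · rw [Stmt.count_of_ne _ _ ht]
    have hnone := ih t' n (hle.trans hn)
    rw [Machine.moves_of_ne, hnone]
    · intro heq
      rw [heq, hL] at hnone
      cases hnone
    · rintro ⟨T, rfl⟩ heq
      simp only [Machine.child, List.append_singleton_inj] at heq
      obtain ⟨rfl, rfl⟩ := heq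
      simp [Stmt.count] at hn

namespace Action

variable {G X : Decls.{u}} {M T : Type u} (ord : LinearOrder G.Name) (a : Action G X M T)

/-- The statements of an action whose effect is still to come when `j` statements of its encoding
have been executed, provided that its first statement has been executed. -/
def residual (j : ℕ) : List (Stmt G X M T) :=
  if j ≤ (a.accessed ord).length then [] else a.stmts.drop (j - (a.accessed ord).length)

/-- The globals whose mutexes are held when `j` statements of the encoding have been executed. -/
def heldAt (j : ℕ) : List G.Name :=
  (a.accessed ord).take
    (min j ((a.accessed ord).length - (j - (a.accessed ord).length - a.stmts.length)))

/-- While a statement is pending, all locks have been taken and no unlock has been performed; by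
truncated subtraction `heldAt` is then the full list. -/
theorem accessed_of_mem_residual {j : ℕ} {b : Stmt G X M T} (hb : b ∈ a.residual ord j)
    {g : G.Name} (hg : g ∈ b.accessed) : g ∈ a.heldAt ord j := by
  unfold residual at hb
  split_ifs at hb with h
  · simp at hb
  · have hlt : j - (a.accessed ord).length < a.stmts.length := by
      by_contra hge
      rw [List.drop_eq_nil_of_le (by omega)] at hb
      simp at hb
    rw [heldAt, List.take_of_length_le (by omega)]
    exact (a.mem_accessed ord).2 ⟨b, List.mem_of_mem_drop hb, hg⟩

theorem residual_of_le {j : ℕ} (h : j ≤ (a.accessed ord).length) : a.residual ord j = [] :=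
  if_pos h

theorem residual_add {k : ℕ} (h : k ≠ 0) :
    a.residual ord ((a.accessed ord).length + k) = a.stmts.drop k := by
  rw [residual, if_neg (by omega), Nat.add_sub_cancel_left]

theorem heldAt_of_le {j : ℕ} (h : j ≤ (a.accessed ord).length) :
    a.heldAt ord j = (a.accessed ord).take j := by
  rw [heldAt, show j - (a.accessed ord).length - a.stmts.length = 0 by omega, Nat.sub_zero,
    min_eq_left h]

theorem heldAt_add {k : ℕ} (h : k ≤ a.stmts.length) :
    a.heldAt ord ((a.accessed ord).length + k) = a.accessed ord := by
  rw [heldAt, List.take_of_length_le (by omega)]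

theorem heldAt_add_add (r : ℕ) :
    a.heldAt ord ((a.accessed ord).length + a.stmts.length + r) =
      (a.accessed ord).take ((a.accessed ord).length - r) := by
  rw [heldAt]
  congr 1
  omega

end Action

variable {Q : LangAtomic.{u}} (ord : LinearOrder Q.glob.Name)

/-- The statements that a thread at the node still has to execute after the first statement of its
current action. -/
def residual : SplitNode Q ord → List (Stmt Q.glob Q.loc Q.Mutex Q.Templ)
  | .inl _ => []
  | .inr x => (Q.edge x.1.1 x.1.2).elim [] fun a => a.residual ord (x.2 + 1)

/-- The globals whose mutexes are held by a thread at the node. -/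
def heldBy : SplitNode Q ord → List Q.glob.Name
  | .inl _ => []
  | .inr x => (Q.edge x.1.1 x.1.2).elim [] fun a => a.heldAt ord (x.2 + 1)

/-- The node before the current action if its first statement has not been executed, and the node
after it otherwise. -/
def location : SplitNode Q ord → Q.Node
  | .inl u => u
  | .inr x => (Q.edge x.1.1 x.1.2).elim x.1.1 fun a =>
      if x.2 + 1 ≤ (a.accessed ord).length then x.1.1 else x.1.2

theorem heldBy_of_mem_residual {x : SplitNode Q ord}
    {b : Stmt Q.glob Q.loc Q.Mutex Q.Templ} (hb : b ∈ residual ord x) {g : Q.glob.Name}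
    (hg : g ∈ b.accessed) : g ∈ heldBy ord x := by
  rcases x with u | x
  · simp [residual] at hb
  · cases he : Q.edge x.1.1 x.1.2 with
    | none => simp [residual, he] at hb
    | some a =>
      simp only [residual, heldBy, he, Option.elim_some] at hb ⊢
      exact a.accessed_of_mem_residual ord hb hg

section PathNodes

variable {u v : Q.Node} {a : Action Q.glob Q.loc Q.Mutex Q.Templ} (hedge : Q.edge u v = some a)
include hedge

theorem pathNode_cases {j : ℕ} (hj : j ≤ (a.expand ord).length) :
    (j = 0 ∧ pathNode ord u v j = .inl u) ∨
    (j = (a.accessed ord).length + a.stmts.length + (a.accessed ord).length ∧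
      pathNode ord u v j = .inl v) ∨
    ∃ k h, j = k + 1 ∧ pathNode ord u v j = .inr ⟨(u, v), ⟨k, h⟩⟩ := by
  rcases j with _ | k
  · exact .inl ⟨rfl, rfl⟩
  · right
    have hlen := splitStmts_of_edge ord hedge
    by_cases h : k < (splitStmts Q ord u v).length - 1
    · exact .inr ⟨k, h, rfl, pathNode_inner ord h⟩
    · rw [hlen] at h
      rw [a.length_expand] at hj h
      exact .inl ⟨by omega, pathNode_last ord (by simp) (by rw [hlen, a.length_expand]; omega)⟩

theorem residual_pathNode {j : ℕ} (hj : j ≤ (a.expand ord).length) :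
    residual ord (pathNode ord u v j) = a.residual ord j := by
  rcases pathNode_cases ord hedge hj with ⟨rfl, h⟩ | ⟨rfl, h⟩ | ⟨k, hk, rfl, h⟩ <;> rw [h]
  · rw [a.residual_of_le ord (Nat.zero_le _), residual]
  · rw [add_assoc, a.residual_add ord (by have := a.length_stmts_pos; omega),
      List.drop_eq_nil_of_le (by omega), residual]
  · simp only [residual, hedge, Option.elim_some]

theorem heldBy_pathNode {j : ℕ} (hj : j ≤ (a.expand ord).length) :
    heldBy ord (pathNode ord u v j) = a.heldAt ord j := by
  rcases pathNode_cases ord hedge hj with ⟨rfl, h⟩ | ⟨rfl, h⟩ | ⟨k, hk, rfl, h⟩ <;> rw [h]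
  · rw [a.heldAt_of_le ord (Nat.zero_le _), heldBy, List.take_zero]
  · rw [a.heldAt_add_add ord, Nat.sub_self, heldBy, List.take_zero]
  · simp only [heldBy, hedge, Option.elim_some]

theorem location_pathNode {j : ℕ} (hj : j ≤ (a.expand ord).length) :
    location ord (pathNode ord u v j) = if j ≤ (a.accessed ord).length then u else v := by
  rcases pathNode_cases ord hedge hj with ⟨rfl, h⟩ | ⟨rfl, h⟩ | ⟨k, hk, rfl, h⟩ <;> rw [h]
  · rw [location, if_pos (Nat.zero_le _)]
  · rw [location, if_neg (by have := a.length_stmts_pos; omega)]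
  · simp only [location, hedge, Option.elim_some]

end PathNodes

/-- The components `L`, `M`, `G`, `C` of a configuration of the split program correspond to the
interleaving `i` with final configuration `s`, in which an action is executed when its first statement
is executed in the split program. -/
structure Simulates (L : Tid → Option (SplitNode Q ord × LState Q.loc))
    (M : Q.Mutex ⊕ Q.glob.Name → Option Tid) (G : Q.glob.Val) (C : Tid → ℕ) (i : List (Step Q))
    (s : State Q) : Prop where
  loc : ∀ t, s.L t = (L t).map fun y =>
    (location ord y.1, (evalAll (residual ord y.1) (y.2, G)).1)
  mutex : ∀ m, M (.inl m) = s.M m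
  held : ∀ g t, M (.inr g) = some t ↔ ∃ y, L t = some y ∧ g ∈ heldBy ord y.1
  free : ∀ g, M (.inr g) = none → s.G g = G g
  glob : ∀ t y, L t = some y → ∀ g ∈ heldBy ord y.1,
    s.G g = (evalAll (residual ord y.1) (y.2, G)).2 g
  safe : ∀ t y, L t = some y → AssertsHold (residual ord y.1) (y.2, G)
  count : C = creates i

namespace Simulates

variable {ord} {L L' : Tid → Option (SplitNode Q ord × LState Q.loc)}
  {M M' : Q.Mutex ⊕ Q.glob.Name → Option Tid} {G G' : Q.glob.Val} {C C' : Tid → ℕ}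
  {i i' : List (Step Q)} {s s' : State Q}

theorem held_iff (h : Simulates ord L M G C i s) {t : Tid} {x : SplitNode Q ord}
    {l : LState Q.loc} (hL : L t = some (x, l)) {g : Q.glob.Name} :
    M (.inr g) = some t ↔ g ∈ heldBy ord x := by
  rw [h.held]
  constructor
  · rintro ⟨y, hy, hg⟩
    rw [hL] at hy
    rwa [← Option.some.inj hy] at hg
  · exact fun hg => ⟨_, hL, hg⟩

/-- Frame argument shared by all kinds of steps. A mutex has a single owner, so the globals guarded
by other threads are not among those held by `t`, the only ones that may change. Hence the pending
statements of other threads evaluate as before, and only the clauses about `t`, about free globals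
and about a new thread remain. -/
theorem move (h : Simulates ord L M G C i s) {t : Tid} {x y : SplitNode Q ord}
    {l l' : LState Q.loc} (hL : L t = some (x, l)) (hself : L' t = some (y, l'))
    (hother : ∀ t', t' ≠ t → (L' t' = L t' ∧ s'.L t' = s.L t') ∨
      ∃ u l₀, L t' = none ∧ L' t' = some (.inl u, l₀) ∧ s'.L t' = some (u, l₀))
    (hG : ∀ g, g ∉ heldBy ord x → G' g = G g) (hsG : ∀ g, g ∉ heldBy ord x → s'.G g = s.G g)
    (hsL : s'.L t = some (location ord y, (evalAll (residual ord y) (l', G')).1))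
    (hM : ∀ m, M' (.inl m) = s'.M m)
    (hself' : ∀ g, M' (.inr g) = some t ↔ g ∈ heldBy ord y)
    (hother' : ∀ g t', t' ≠ t → (M' (.inr g) = some t' ↔ M (.inr g) = some t'))
    (hfree : ∀ g, M' (.inr g) = none → s'.G g = G' g)
    (hglob : ∀ g ∈ heldBy ord y, s'.G g = (evalAll (residual ord y) (l', G')).2 g)
    (hsafe : AssertsHold (residual ord y) (l', G')) (hcount : C' = creates i') :
    Simulates ord L' M' G' C' i' s' := by
  have hagree : ∀ t', t' ≠ t → ∀ z, L t' = some z → ∀ g, g ∈ heldBy ord z.1 →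
      g ∉ heldBy ord x := by
    intro t' ht z hz g hg hgx
    have h1 := (h.held g t').2 ⟨z, hz, hg⟩
    rw [(h.held_iff hL).2 hgx] at h1
    exact ht (Option.some.inj h1).symm
  have hcongr : ∀ t', t' ≠ t → ∀ z, L t' = some z → ∀ g, g ∈ heldBy ord z.1 → G g = G' g :=
    fun t' ht z hz g hg => (hG g (hagree t' ht z hz g hg)).symm
  have hres : ∀ z : SplitNode Q ord × LState Q.loc, ∀ b ∈ residual ord z.1, ∀ g ∈ b.accessed,
      g ∈ heldBy ord z.1 := fun z b hb g hg => heldBy_of_mem_residual ord hb hg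
  refine ⟨?_, hM, ?_, hfree, ?_, ?_, hcount⟩
  · intro t'
    by_cases ht : t' = t
    · subst ht
      rw [hself, hsL]
      rfl
    · rcases hother t' ht with ⟨h1, h2⟩ | ⟨u, l₀, -, h2, h3⟩
      · rw [h1, h2, h.loc]
        cases hz : L t' with
        | none => rfl
        | some z =>
          simp only [Option.map_some]
          rw [(evalAll_congr (hres z) (hcongr t' ht z hz) z.2).1]
      · rw [h2, h3]
        rfl
  · intro g t'
    by_cases ht : t' = t
    · subst ht
      rw [hself', hself]
      simp
    · rw [hother' g t' ht]
      rcases hother t' ht with ⟨h1, -⟩ | ⟨u, l₀, h1, h2, -⟩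
      · rw [h1, h.held]
      · rw [h.held, h1, h2]
        simp [heldBy]
  · intro t' z hz g hg
    by_cases ht : t' = t
    · subst ht
      rw [hself] at hz
      obtain rfl := Option.some.inj hz
      exact hglob g hg
    · rcases hother t' ht with ⟨h1, -⟩ | ⟨u, l₀, -, h2, -⟩
      · rw [h1] at hz
        rw [hsG g (hagree t' ht z hz g hg), h.glob t' z hz g hg]
        exact (evalAll_congr (hres z) (hcongr t' ht z hz) z.2).2 g hg
      · rw [h2] at hz
        obtain rfl := Option.some.inj hz
        simp [heldBy] at hg
  · intro t' z hz
    by_cases ht : t' = t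
    · subst ht
      rw [hself] at hz
      obtain rfl := Option.some.inj hz
      exact hsafe
    · rcases hother t' ht with ⟨h1, -⟩ | ⟨u, l₀, -, h2, -⟩
      · rw [h1] at hz
        exact (h.safe t' z hz).congr (hres z) (hcongr t' ht z hz)
      · rw [h2] at hz
        obtain rfl := Option.some.inj hz
        intro as₁ as₂ p hp
        simp [residual] at hp

theorem initial : Simulates ord (Machine.initial (split Q ord)).L (Machine.initial (split Q ord)).M
    (Machine.initial (split Q ord)).G (Machine.initial (split Q ord)).C [] (State.initial Q) := by
  have hnode : ∀ t (y : SplitNode Q ord × LState Q.loc),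
      (Machine.initial (split Q ord)).L t = some y → y = (.inl (Q.start Q.main), Q.initLoc) := by
    intro t y hy
    change (if t = [] then some ((.inl (Q.start Q.main), Q.initLoc) :
      SplitNode Q ord × LState Q.loc) else none) = some y at hy
    split_ifs at hy
    exact (Option.some.inj hy).symm
  refine ⟨fun t => ?_, fun _ => rfl, fun g t => ?_, fun _ _ => rfl, fun t y hy g hg => ?_,
    fun t y hy => ?_, ?_⟩
  · change (if t = [] then some (Q.start Q.main, Q.initLoc) else none) = Option.map _
      (if t = [] then some ((.inl (Q.start Q.main), Q.initLoc) :
        SplitNode Q ord × LState Q.loc) else none)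
    split_ifs <;> rfl
  · refine ⟨fun h => absurd (show (none : Option Tid) = some t from h) nofun, ?_⟩
    rintro ⟨y, hy, hg⟩
    rw [hnode t y hy] at hg
    simp [heldBy] at hg
  · rw [hnode t y hy] at hg
    simp [heldBy] at hg
  · intro as₁ as₂ p hp
    rw [hnode t y hy] at hp
    simp [residual] at hp
  · funext t
    simp [Machine.initial, creates]

end Simulates

/-- If the program is safe, then all assertions hold in an action that can be executed. -/
theorem Interleaving.assertsHold {i : List (Step Q)} {s : State Q} (hi : Interleaving Q i s)
    (hsafe : SafeInterleaving Q) {t : Tid} {u v : Q.Node}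
    {a : Action Q.glob Q.loc Q.Mutex Q.Templ} {l : LState Q.loc} (hedge : Q.edge u v = some a)
    (hL : s.L t = some (u, l)) (hadm : a.first.Admissible t l s.M) :
    AssertsHold a.stmts (l, s.G) := by
  intro as₁ as₂ p hst
  by_contra hp
  obtain ⟨⟨n', h1, -⟩, -⟩ := effects_self (v := v) (newTid_ne i t) as₁ hL
  exact hsafe _ _ (hi.extend t u v a l hedge hL hadm)
    ⟨i, [], _, rfl, as₁, as₂, p, hst, n', _, h1, by simpa using hp⟩

/-! ### Simulation of lock, unlock, later statements and first statements -/

section Steps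

variable {ord} {σ : Machine (split Q ord)} {i : List (Step Q)} {s : State Q} {t : Tid}
  {u v : Q.Node} {l : LState Q.loc} {a : Action Q.glob Q.loc Q.Mutex Q.Templ}

/-- The interleaving does not move. The clause `glob` for the newly protected global is the clause
`free` from before the lock. -/
theorem Simulates.lock (h : Simulates ord σ.L σ.M σ.G σ.C i s) (hedge : Q.edge u v = some a)
    {j : ℕ} (hj : j < (a.accessed ord).length) (hL : σ.L t = some (pathNode ord u v j, l))
    (hfree : σ.M (.inr (a.accessed ord)[j]) = none) {σ' : Machine (split Q ord)}
    (hσ' : σ' = σ.step t (pathNode ord u v (j + 1)) l (.lock (.inr (a.accessed ord)[j]))) :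
    Simulates ord σ'.L σ'.M σ'.G σ'.C i s := by
  subst hσ'
  have hlen := a.length_expand ord
  have hrx := (residual_pathNode ord hedge (j := j) (by omega)).trans
    (a.residual_of_le ord (by omega))
  have hry := (residual_pathNode ord hedge (j := j + 1) (by omega)).trans
    (a.residual_of_le ord hj)
  have hhx := (heldBy_pathNode ord hedge (j := j) (by omega)).trans (a.heldAt_of_le ord (by omega))
  have hhy := (heldBy_pathNode ord hedge (j := j + 1) (by omega)).trans (a.heldAt_of_le ord hj)
  have hly := location_pathNode ord hedge (j := j + 1) (by omega)
  have hlx := location_pathNode ord hedge (j := j) (by omega)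
  rw [if_pos (by omega)] at hlx hly
  have hmem : ∀ g, g ∈ heldBy ord (pathNode ord u v (j + 1)) ↔
      g ∈ heldBy ord (pathNode ord u v j) ∨ g = (a.accessed ord)[j] := by
    intro g
    rw [hhx, hhy, ← List.take_concat_get' _ _ hj, List.mem_append, List.mem_singleton]
  have hown : ∀ g, g ≠ (a.accessed ord)[j] → (Stmt.lock (.inr (a.accessed ord)[j]) :
      Stmt Q.glob Q.loc (Q.Mutex ⊕ Q.glob.Name) Q.Templ).own t σ.M (.inr g) = σ.M (.inr g) :=
    fun g hg => Stmt.own_lock_of_ne t σ.M fun h => hg (Sum.inr.inj h)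
  have hself := σ.step_L_self t (pathNode ord u v (j + 1)) l (.lock (.inr (a.accessed ord)[j]))
  have hother := fun t' (ht : t' ≠ t) => σ.step_L_of_ne (pathNode ord u v (j + 1)) l (.lock (.inr (a.accessed ord)[j])) ht
    fun ⟨T, hT⟩ => nomatch hT
  refine h.move hL hself (fun t' ht => .inl ⟨hother t' ht, rfl⟩) (fun _ _ => rfl) (fun _ _ => rfl) ?_ ?_ ?_ ?_ ?_ ?_ ?_ h.count
  · rw [h.loc, hL, hly, hry]
    simp only [Option.map_some, hlx, hrx]
    rfl
  · intro m
    exact (Stmt.own_lock_of_ne (G := Q.glob) (X := Q.loc) (T := Q.Templ) t σ.M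
      (m := .inr (a.accessed ord)[j]) (m' := .inl m) nofun).trans (h.mutex m)
  · intro g
    rw [hmem]
    by_cases hg : g = (a.accessed ord)[j]
    · subst hg
      refine ⟨fun _ => .inr rfl, fun _ => ?_⟩
      exact Stmt.own_lock_self (G := Q.glob) (X := Q.loc) (T := Q.Templ) _ t σ.M
    · rw [or_iff_left hg, ← h.held_iff hL]
      exact Eq.congr_left (hown g hg)
  · intro g t' ht
    by_cases hg : g = (a.accessed ord)[j]
    · subst hg
      rw [hfree]
      refine iff_of_false (fun h1 => ht ?_) nofun
      exact Option.some.inj (h1.symm.trans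
        (Stmt.own_lock_self (G := Q.glob) (X := Q.loc) (T := Q.Templ) _ t σ.M))
    · exact Eq.congr_left (hown g hg)
  · intro g hg
    refine h.free g ?_
    by_cases hgj : g = (a.accessed ord)[j]
    · rw [hgj, hfree]
    · exact (hown g hgj).symm.trans hg
  · intro g hg
    rw [hry]
    rcases (hmem g).1 hg with h1 | rfl
    · have h2 := h.glob t _ hL g h1
      simp only [hrx] at h2
      exact h2
    · exact h.free _ hfree
  · rw [hry]
    intro as₁ as₂ p hp
    simp at hp

/-- Nothing is pending any more, so the machine has caught up with the interleaving on the held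
globals, and the clause `free` may be restored for the released one. -/
theorem Simulates.unlock (h : Simulates ord σ.L σ.M σ.G σ.C i s) (hedge : Q.edge u v = some a)
    {r : ℕ} (hr : r < (a.accessed ord).length)
    (hL : σ.L t = some (pathNode ord u v ((a.accessed ord).length + a.stmts.length + r), l))
    {σ' : Machine (split Q ord)}
    (hσ' : σ' = σ.step t (pathNode ord u v ((a.accessed ord).length + a.stmts.length + r + 1)) l
      (.unlock (.inr ((a.accessed ord)[(a.accessed ord).length - 1 - r]'(by omega))))) :
    Simulates ord σ'.L σ'.M σ'.G σ'.C i s := by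
  subst hσ'
  have hpos := a.length_stmts_pos
  have hlen := a.length_expand ord
  set n := (a.accessed ord).length with hn
  have hlt : n - 1 - r < (a.accessed ord).length := by omega
  set g₀ := (a.accessed ord)[n - 1 - r] with hg₀
  have hrx : residual ord (pathNode ord u v (n + a.stmts.length + r)) = [] := by
    rw [residual_pathNode ord hedge (by omega), add_assoc, a.residual_add ord (by omega),
      List.drop_eq_nil_of_le (by omega)]
  have hry : residual ord (pathNode ord u v (n + a.stmts.length + r + 1)) = [] := by
    rw [residual_pathNode ord hedge (by omega), add_assoc, add_assoc, a.residual_add ord (by omega),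
      List.drop_eq_nil_of_le (by omega)]
  have hhx := (heldBy_pathNode ord hedge (j := n + a.stmts.length + r) (by omega)).trans
    (a.heldAt_add_add ord r)
  have hhy := (heldBy_pathNode ord hedge (j := n + a.stmts.length + r + 1) (by omega)).trans
    (a.heldAt_add_add ord (r + 1))
  have hly := location_pathNode ord hedge (j := n + a.stmts.length + r + 1) (by omega)
  have hlx := location_pathNode ord hedge (j := n + a.stmts.length + r) (by omega)
  rw [if_neg (by omega)] at hlx hly
  have hmem : ∀ g, g ∈ heldBy ord (pathNode ord u v (n + a.stmts.length + r + 1)) ↔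
      g ∈ heldBy ord (pathNode ord u v (n + a.stmts.length + r)) ∧ g ≠ g₀ := by
    intro g
    have h1 := List.take_concat_get' _ _ hlt
    rw [show n - 1 - r + 1 = n - r by omega] at h1
    rw [hhx, hhy, ← hn, ← h1, show n - (r + 1) = n - 1 - r by omega]
    simp only [List.mem_append, List.mem_singleton]
    constructor
    · intro hg
      refine ⟨.inl hg, ?_⟩
      rintro rfl
      obtain ⟨i, hi, heq⟩ := List.mem_take_iff_getElem.1 hg
      have := (a.nodup_accessed ord).getElem_inj_iff.1 heq
      omega
    · rintro ⟨h2 | h2, h3⟩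
      · exact h2
      · exact absurd h2 h3
  have hheld : g₀ ∈ heldBy ord (pathNode ord u v (n + a.stmts.length + r)) := by
    have h1 := List.take_concat_get' _ _ hlt
    rw [show n - 1 - r + 1 = n - r by omega] at h1
    rw [hhx, ← hn, ← h1]
    exact List.mem_append_right _ (List.mem_singleton_self _)
  have hglob : ∀ g ∈ heldBy ord (pathNode ord u v (n + a.stmts.length + r)), s.G g = σ.G g := by
    intro g hg
    have h2 := h.glob t _ hL g hg
    simp only [hrx] at h2
    exact h2
  have hown : ∀ g, g ≠ g₀ → (Stmt.unlock (.inr g₀) : Stmt Q.glob Q.loc (Q.Mutex ⊕ Q.glob.Name)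
      Q.Templ).own t σ.M (.inr g) = σ.M (.inr g) := fun g hg =>
    Stmt.own_unlock_of_ne t σ.M fun h => hg (Sum.inr.inj h)
  have hown₀ : (Stmt.unlock (.inr g₀) : Stmt Q.glob Q.loc (Q.Mutex ⊕ Q.glob.Name)
      Q.Templ).own t σ.M (.inr g₀) = none := Stmt.own_unlock_self _ t σ.M
  have hself := σ.step_L_self t (pathNode ord u v (n + a.stmts.length + r + 1)) l (.unlock (.inr g₀))
  have hother := fun t' (ht : t' ≠ t) => σ.step_L_of_ne (pathNode ord u v (n + a.stmts.length + r + 1)) l (.unlock (.inr g₀)) ht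
    fun ⟨T, hT⟩ => nomatch hT
  refine h.move hL hself (fun t' ht => .inl ⟨hother t' ht, rfl⟩) (fun _ _ => rfl) (fun _ _ => rfl) ?_ ?_ ?_ ?_ ?_ ?_ ?_ h.count
  · rw [h.loc, hL, hly, hry]
    simp only [Option.map_some, hlx, hrx]
    rfl
  · intro m
    exact (Stmt.own_unlock_of_ne (G := Q.glob) (X := Q.loc) (T := Q.Templ) t σ.M
      (m := .inr g₀) (m' := .inl m) nofun).trans (h.mutex m)
  · intro g
    rw [hmem]
    by_cases hg : g = g₀
    · refine iff_of_false (fun h1 => ?_) fun h1 => h1.2 hg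
      rw [hg] at h1
      exact nomatch h1.symm.trans hown₀
    · rw [and_iff_left hg, ← h.held_iff hL]
      exact Eq.congr_left (hown g hg)
  · intro g t' ht
    by_cases hg : g = g₀
    · subst hg
      refine iff_of_false (fun h1 => nomatch h1.symm.trans hown₀) fun h1 => ht ?_
      exact Option.some.inj (h1.symm.trans ((h.held_iff hL).2 hheld))
    · exact Eq.congr_left (hown g hg)
  · intro g hg
    by_cases hgj : g = g₀
    · subst hgj
      exact hglob _ hheld
    · exact h.free g ((hown g hgj).symm.trans hg)
  · intro g hg
    rw [hry]
    exact hglob g ((hmem g).1 hg).1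
  · rw [hry]
    intro as₁ as₂ p hp
    simp at hp

/-- The interleaving already contains the effect of this statement: executing it merely moves the
head of the pending list into the machine state. -/
theorem Simulates.stmt (h : Simulates ord σ.L σ.M σ.G σ.C i s) (hedge : Q.edge u v = some a)
    {k : ℕ} (hk0 : k ≠ 0) (hk : k < a.stmts.length)
    (hL : σ.L t = some (pathNode ord u v ((a.accessed ord).length + k), l))
    {σ' : Machine (split Q ord)}
    (hσ' : σ' = σ.step t (pathNode ord u v ((a.accessed ord).length + k + 1)) l
      a.stmts[k].addMutexes) :
    Simulates ord σ'.L σ'.M σ'.G σ'.C i s := by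
  subst hσ'
  have hlen := a.length_expand ord
  have hsimple : ∃ b, a.stmts[k] = .simple b := by
    obtain ⟨k, rfl⟩ := Nat.exists_eq_succ_of_ne_zero hk0
    exact a.exists_getElem_stmts_succ hk
  obtain ⟨b, hb⟩ := hsimple
  set n := (a.accessed ord).length with hn
  have hrx : residual ord (pathNode ord u v (n + k)) = .simple b :: a.stmts.drop (k + 1) := by
    rw [residual_pathNode ord hedge (by omega), a.residual_add ord hk0, ← hb,
      List.cons_getElem_drop_succ]
  have hry : residual ord (pathNode ord u v (n + k + 1)) = a.stmts.drop (k + 1) := by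
    rw [residual_pathNode ord hedge (by omega), add_assoc, a.residual_add ord (by omega)]
  have hhx := (heldBy_pathNode ord hedge (j := n + k) (by omega)).trans
    (a.heldAt_add ord hk.le)
  have hhy := (heldBy_pathNode ord hedge (j := n + k + 1) (by omega)).trans
    (a.heldAt_add ord (k := k + 1) hk)
  have hly := location_pathNode ord hedge (j := n + k + 1) (by omega)
  have hlx := location_pathNode ord hedge (j := n + k) (by omega)
  rw [if_neg (by omega)] at hlx hly
  rw [hb]
  have hsafe := h.safe t _ hL
  simp only [hrx] at hsafe
  have heval : (((Stmt.simple b : Stmt Q.glob Q.loc Q.Mutex Q.Templ).addMutexes.eval (l, σ.G)).1,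
      ((Stmt.simple b : Stmt Q.glob Q.loc Q.Mutex Q.Templ).addMutexes.eval (l, σ.G)).2) =
      (Stmt.simple b : Stmt Q.glob Q.loc Q.Mutex Q.Templ).eval (l, σ.G) := Stmt.eval_addMutexes _ _
  have hG : ∀ g, g ∉ a.accessed ord →
      ((Stmt.simple b : Stmt Q.glob Q.loc Q.Mutex Q.Templ).addMutexes.eval (l, σ.G)).2 g = σ.G g := by
    intro g hg
    rw [Stmt.eval_addMutexes]
    exact Stmt.eval_of_notMem
      (fun hg' => hg ((a.mem_accessed ord).2 ⟨_, List.getElem_mem hk, hb ▸ hg'⟩)) l σ.G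
  have hself := σ.step_L_self t (pathNode ord u v (n + k + 1)) l
    (Stmt.simple b : Stmt Q.glob Q.loc Q.Mutex Q.Templ).addMutexes
  have hother := fun t' (ht : t' ≠ t) => σ.step_L_of_ne (pathNode ord u v (n + k + 1)) l (.simple b) ht
    fun ⟨T, hT⟩ => nomatch hT
  refine h.move hL hself (fun t' ht => .inl ⟨hother t' ht, rfl⟩) ?_ (fun _ _ => rfl) ?_ h.mutex ?_ (fun _ _ _ => Iff.rfl) ?_ ?_ ?_ h.count
  · exact fun g hg => hG g fun hg' => hg (by rw [hhx]; exact hg')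
  · rw [h.loc, hL, hly, hry]
    simp only [Option.map_some, hlx, hrx]
    rw [evalAll_cons, ← heval]
    rfl
  · intro g
    rw [hhy, ← hhx, ← h.held_iff hL]
    exact Iff.rfl
  · intro g hg
    rw [h.free g hg]
    exact (hG g fun hg' =>
      nomatch hg.symm.trans ((h.held_iff hL).2 (by rw [hhx]; exact hg'))).symm
  · intro g hg
    rw [hhy, ← hhx] at hg
    have h2 := h.glob t _ hL g hg
    simp only [hrx] at h2
    rw [evalAll_cons, ← heval] at h2
    rw [hry]
    exact h2
  · rw [hry]
    have h2 := hsafe.tail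
    rw [← heval] at h2
    exact h2

/-- The moment at which the interleaving executes the whole action. All accessed globals are held
and nothing is pending, so machine and interleaving agree on them. The conclusion about assertions
is stated separately because it is also needed before the step, when the first statement itself is
an assertion. -/
theorem Simulates.first (h : Simulates ord σ.L σ.M σ.G σ.C i s) (hi : Interleaving Q i s)
    (hsafe : SafeInterleaving Q) (hfresh : σ.L (σ.child t) = none) (hedge : Q.edge u v = some a)
    (hL : σ.L t = some (pathNode ord u v (a.accessed ord).length, l))
    (hadm : a.first.Admissible t l fun m => σ.M (.inl m))
    {σ' : Machine (split Q ord)}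
    (hσ' : σ' = σ.step t (pathNode ord u v ((a.accessed ord).length + 1)) l
      a.first.addMutexes) :
    AssertsHold a.stmts (l, σ.G) ∧
      ∃ i' s', Interleaving Q i' s' ∧ Simulates ord σ'.L σ'.M σ'.G σ'.C i' s' := by
  subst hσ'
  have hlen := a.length_expand ord
  have hpos := a.length_stmts_pos
  have hrx := (residual_pathNode ord hedge (j := (a.accessed ord).length) (by omega)).trans
    (a.residual_of_le ord le_rfl)
  have hry : residual ord (pathNode ord u v ((a.accessed ord).length + 1)) =
      a.rest.map .simple := by
    rw [residual_pathNode ord hedge (by omega), a.residual_add ord (by omega), a.stmts_eq]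
    rfl
  have hhx := (heldBy_pathNode ord hedge (j := (a.accessed ord).length) (by omega)).trans
    (a.heldAt_add ord (k := 0) (by omega))
  have hhy := (heldBy_pathNode ord hedge (j := (a.accessed ord).length + 1) (by omega)).trans
    (a.heldAt_add ord (k := 1) hpos)
  have hly := location_pathNode ord hedge (j := (a.accessed ord).length + 1) (by omega)
  have hlx := location_pathNode ord hedge (j := (a.accessed ord).length) (by omega)
  rw [if_neg (by omega)] at hly
  rw [if_pos le_rfl] at hlx
  have hsL : s.L t = some (u, l) := by
    rw [h.loc, hL]
    simp only [Option.map_some, hlx, hrx]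
    rfl
  have hMs : (fun m => σ.M (.inl m)) = s.M := funext h.mutex
  rw [hMs] at hadm
  have hagree : ∀ g, g ∈ a.accessed ord → s.G g = σ.G g := by
    intro g hg
    have h2 := h.glob t _ hL g (by rw [hhx]; exact hg)
    simp only [hrx] at h2
    exact h2
  have hacc : ∀ b ∈ a.stmts, ∀ g ∈ b.accessed, g ∈ a.accessed ord := fun b hb g hg =>
    (a.mem_accessed ord).2 ⟨b, hb, hg⟩
  -- Safety of `Q` speaks about the globals of the interleaving; the action accesses only those on
  -- which the machine has the same values.
  have hasserts := (hi.assertsHold hsafe hedge hsL hadm).congr hacc hagree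
  refine ⟨hasserts, _, _, hi.extend t u v a l hedge hsL hadm, ?_⟩
  have hself : l.self = t := hi.selfConsistent _ _ _ hsL
  -- The id computed from the history of the interleaving is the one that the machine assigns.
  have hchild : newTid l.self i = σ.child t := by
    rw [hself, newTid_eq, Machine.child, h.count]
  have hct := σ.child_ne t
  rw [hchild]
  obtain ⟨⟨n', h1, h2⟩, h3⟩ := effects_self (v := v) hct a.stmts hsL
  obtain rfl := h2 (List.ne_nil_of_length_pos hpos)
  obtain ⟨h4, h5⟩ := evalAll_congr hacc hagree l
  have h6 : evalAll (a.rest.map (.simple (M := Q.Mutex) (T := Q.Templ))) (a.first.eval (l, σ.G)) =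
      evalAll a.stmts (l, σ.G) := by
    rw [a.stmts_eq]
    rfl
  have h7 := effect_L_self (v := n') hsL hct a.first
  obtain ⟨h8, h9⟩ := effects_simple_M (v := n') hct a.rest h7
  rw [← effects_cons, ← a.stmts_eq] at h8 h9
  have hnot : ∀ g, g ∉ heldBy ord (pathNode ord u n' (a.accessed ord).length) →
      g ∉ a.accessed ord := fun g hg => by rwa [hhx] at hg
  have hfirst : a.first ∈ a.stmts := by
    rw [a.stmts_eq]
    exact List.mem_cons_self
  have hsG : ∀ g, g ∉ a.accessed ord →
      (effects t n' (σ.child t) s a.stmts).G g = s.G g := by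
    intro g hg
    rw [h3]
    exact evalAll_of_notMem (fun b hb hgb => hg (hacc b hb g hgb)) _ _
  have hG : ∀ g, g ∉ a.accessed ord → (a.first.addMutexes.eval (l, σ.G)).2 g = σ.G g := by
    intro g hg
    rw [Stmt.eval_addMutexes]
    exact Stmt.eval_of_notMem (fun hgb => hg (hacc _ hfirst g hgb)) _ _
  have hown : ∀ g, (σ.step t (pathNode ord u n' ((a.accessed ord).length + 1)) l
      a.first.addMutexes).M (.inr g) = σ.M (.inr g) := Stmt.own_addMutexes_inr a.first t σ.M
  have heval : ((a.first.addMutexes.eval (l, σ.G)).1, (a.first.addMutexes.eval (l, σ.G)).2) =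
      a.first.eval (l, σ.G) := Stmt.eval_addMutexes a.first (l, σ.G)
  have hselfL := σ.step_L_self t (pathNode ord u n' ((a.accessed ord).length + 1)) l
    a.first.addMutexes
  refine h.move hL hselfL ?_ (fun g hg => hG g (hnot g hg))
    (fun g hg => hsG g (hnot g hg)) ?_ ?_ ?_ (fun g t' _ => by rw [hown]) ?_ ?_ ?_ ?_
  · intro t' ht
    rw [h9 t' ht]
    by_cases hcr : (∃ T, a.first = .create T) ∧ t' = σ.child t
    · obtain ⟨⟨T, hT⟩, rfl⟩ := hcr
      refine .inr ⟨Q.start T, ⟨σ.child t, l.vars⟩, hfresh, ?_, ?_⟩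
      · rw [hT]
        exact σ.moves_create t _ l T
      · rw [hT]
        exact effect_L_create hsL T
    · refine .inl ⟨σ.step_L_of_ne _ l _ ht fun ⟨T, hT⟩ heq => ?_, ?_⟩
      · exact hcr ⟨⟨T, Stmt.addMutexes_eq_create.1 hT⟩, heq⟩
      · exact effect_L_of_ne hsL ht fun hT heq => hcr ⟨hT, heq⟩
  · rw [h1, hly, hry, h4, ← h6, ← heval]
    rfl
  · intro m
    rw [h8, effect_M hsL, ← hMs]
    exact Stmt.own_addMutexes_inl a.first t σ.M m
  · intro g
    rw [hown, hhy, ← hhx]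
    exact h.held_iff hL
  · intro g hg
    rw [hown] at hg
    have hga : g ∉ a.accessed ord := fun hga =>
      nomatch hg.symm.trans ((h.held_iff hL).2 (by rw [hhx]; exact hga))
    rw [hsG g hga, h.free g hg]
    exact (hG g hga).symm
  · intro g hg
    rw [hhy] at hg
    rw [h3, h5 g hg, hry, ← h6, ← heval]
    rfl
  · rw [hry]
    have h10 := hasserts
    rw [a.stmts_eq] at h10
    have h11 := h10.tail
    rw [← heval] at h11
    exact h11
  · rw [creates_concat, ← h.count]
    exact Stmt.count_addMutexes a.first t σ.C

end Steps

theorem Machine.Reach.exists_simulates {σ : Machine (split Q ord)} (hσ : σ.Reach)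
    (hsafe : SafeInterleaving Q) :
    ∃ i s, Interleaving Q i s ∧ Simulates ord σ.L σ.M σ.G σ.C i s := by
  induction hσ with
  | init => exact ⟨_, _, .init, .initial⟩
  | @step σ t x y l b hσ hL hedge hadm ih =>
    obtain ⟨i, s, hi, h⟩ := ih
    obtain ⟨u, v, j, rfl, rfl, hb⟩ := (splitEdge_iff ord).1 hedge
    obtain ⟨a, ha⟩ := exists_edge_of_splitStmts ord hb
    rw [splitStmts_of_edge ord ha] at hb
    rcases a.expand_cases ord hb with ⟨hj, rfl⟩ | ⟨k, hk, rfl, rfl⟩ | ⟨r, hr, rfl, rfl⟩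
    · exact ⟨i, s, hi, h.lock ha hj hL hadm rfl⟩
    · by_cases hk0 : k = 0
      · subst hk0
        have hfirst := a.getElem_stmts_zero
        rw [hfirst] at hadm ⊢
        exact (h.first hi hsafe (hσ.fresh t _ le_rfl) ha hL
          ((Stmt.admissible_addMutexes _ _ _ _).1 hadm) rfl).2
      · exact ⟨i, s, hi, h.stmt ha hk0 hk hL rfl⟩
    · exact ⟨i, s, hi, h.unlock ha hr hL rfl⟩

/-- The false assertion is either the first statement of its action, which could be scheduled now
and is covered by `Simulates.first`, or a pending one, which is covered by the clause `safe` of the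
simulation. -/
theorem Machine.Reach.not_bad {σ : Machine (split Q ord)} (hσ : σ.Reach)
    (hsafe : SafeInterleaving Q) : ¬ σ.Bad := by
  rintro ⟨t, x, y, l, p, hL, hedge, hp⟩
  obtain ⟨i, s, hi, h⟩ := hσ.exists_simulates ord hsafe
  obtain ⟨u, v, j, rfl, rfl, hb⟩ := (splitEdge_iff ord).1 hedge
  obtain ⟨a, ha⟩ := exists_edge_of_splitStmts ord hb
  rw [splitStmts_of_edge ord ha] at hb
  rcases a.expand_cases ord hb with ⟨hj, h1⟩ | ⟨k, hk, rfl, h1⟩ | ⟨r, hr, rfl, h1⟩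
  · cases h1
  · have h2 : a.stmts[k] = .simple (.assert p) := Stmt.addMutexes_eq_assert.1 h1.symm
    have h3 : AssertsHold (a.stmts.drop k) (l, σ.G) := by
      by_cases hk0 : k = 0
      · subst hk0
        have hfirst := a.getElem_stmts_zero
        rw [hfirst] at h2
        refine (h.first hi hsafe (hσ.fresh t _ le_rfl) ha hL ?_ rfl).1
        rw [h2]
        trivial
      · have h4 := h.safe t _ hL
        have hlen := a.length_expand ord
        simp only [residual_pathNode ord ha (j := (a.accessed ord).length + k) (by omega),
          a.residual_add ord hk0] at h4
        exact h4
    have h5 := h3 [] (a.stmts.drop (k + 1)) p (by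
      rw [← h2, List.nil_append, List.cons_getElem_drop_succ])
    exact Bool.false_ne_true (hp.symm.trans h5)
  · cases h1

/-- A program with atomic blocks is safe with respect to the interleaving semantics if and only if the
program in which these are encoded as critical sections is safe with respect to the local trace
semantics. -/
theorem safeInterleaving_iff : SafeInterleaving Q ↔ SafeLocalTraces (split Q ord) := by
  rw [safeLocalTraces_iff (protected_split ord)]
  constructor
  · exact fun hsafe σ hσ => hσ.not_bad ord hsafe
  · intro hsafe i s hi hv
    obtain ⟨σ, hσ, hbad⟩ := hi.exists_bad ord hv
    exact hsafe σ hσ hbad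

end MachinesToInterleavings

end GhostWitness

end

theorem mainTheorem1 (P : GhostWitness.Lang.{u}) (W : GhostWitness.Witness P)
    (ord : LinearOrder W.instrument.glob.Name) :
    W.ValidInterleaving ↔ W.ValidLocalTraces ord :=
  GhostWitness.safeInterleaving_iff ord
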